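/- **Setting.** Fix a first-order signature whose only predicate is equality $\approx$, and an infinite set of variables. Literals are $s\approx t$ and $s\not\approx t$ (written $s\,\#\,t$), with unordered sides; clauses are finite multisets (disjunctions) of literals; $\mathrm{comp}$ is the complement; $\models$ is first-order entailment. Positions, $t|_p$, $t[s]_p$ and most general unifiers (idempotent, introducing no fresh variables) are as usual; $C\cdot\sigma$ is a closure, $\sigma$ grounding for $C$. Let $\prec_T$ be a well-founded rewrite ordering on terms, total on ground terms, with only finitely many ground terms below each ground term. It is extended to literals by the multiset extension, with $s\approx t\mapsto\{s,t\}$ and $s\not\approx t\mapsto\{s,s,t,t\}$, and literals and clauses are compared with a term $\beta$ through $\{\beta\}$ and $\{\{\beta\}\}$. For a set $\Gamma$ of ground literals, $\mathrm{conv}(\Gamma)$ is a convergent rewrite system for the positive equations of $\Gamma$, oriented by $\prec_T$. A substitution is irreducible if all terms of its codomain are. **Trails.** A trail is a sequence $\Gamma=[L_1^{i_1:C_1\cdot\sigma_1},\dots,L_n^{i_n:C_n\cdot\sigma_n}]$ of ground literals with levels $i_j\in\mathbb N$ and closures ($L_j$ is the instance under $\sigma_j$ of a distinguished literal of $C_j$).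 A ground literal $L$ is true (false) in $\Gamma$ if $\Gamma\models L$ ($\Gamma\models\mathrm{comp}(L)$), defined if it is true or false, otherwise undefined. For a ground term $\beta$, $L$ is $\beta$-true / $\beta$-false / $\beta$-defined if $L\prec_T\beta$ and $L$ is true / false / defined, and $\beta$-undefined if $\beta\prec_T L$ or $L$ is undefined. A ground clause is $\beta$-true if some literal is, $\beta$-false if all literals are, and $\beta$-undefined otherwise. A core of a defined $L$ is a minimal subsequence of $\Gamma$ in which $L$ is defined; the defining literal of $L$ is the last literal of a core whose last literal is earliest in $\Gamma$ (there is none if the only core is empty). The level of $L$ is its annotation if $L\in\Gamma$, otherwise the level of its defining literal, and $0$ if there is none. The level of a clause is the maximum of the levels of its literals ($0$ if it is empty). A trail literal is a decision literal if its level exceeds the level of its predecessor ($0$ if it is the first literal) by one. **Trail induced ordering.** Given $\Gamma$ and $\beta$, $\prec_{\Gamma^*}$ on ground literals is given as follows. Let $L_i$ be the trail literals, and call $M$ of index $i$ if $M$ is $\beta$-defined, $M\notin\Gamma\cup\mathrm{comp}(\Gamma)$ and $M$ has defining literal $L_i$. On $\beta$-defined literals of level $>0$: for $M$ of index $i$ and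 $M'$ of index $k$, $M\prec_{\Gamma^*}M'$ if $i<k$, or $i=k$ and $M\prec_T M'$; each of $L_i,\mathrm{comp}(L_i)$ is smaller than each of $L_j,\mathrm{comp}(L_j)$ if $i<j$; $L_i\prec_{\Gamma^*}\mathrm{comp}(L_i)$; $L_i$ and $\mathrm{comp}(L_i)$ are smaller than $M$ of index $k$ if $i\le k$, and greater than it if $k<i$. On $\beta$-defined literals of level $0$ it is $\prec_T$, and these are smaller than the $\beta$-defined literals of level $>0$. On $\beta$-undefined literals it is $\prec_T$, and $\beta$-defined literals are smaller than $\beta$-undefined ones. It is extended to ground clauses by multiset extension. **Reduction chains.** A rewrite step consists of a closure $(s\,\#\,t\lor C)\cdot\sigma$ with distinguished literal $s\,\#\,t$, and either two earlier rewrite steps and a position, or nothing (a leaf). From steps with closures $(l_1\approx r_1\lor C_1)\cdot\sigma_1$ and $(l_2\,\#\,r_2\lor C_2)\cdot\sigma_2$, renamed to be variable disjoint, with $r_1\sigma_1\prec_T l_1\sigma_1=(l_2\,\#\,r_2)\sigma_2|_p$, a rewrite inference yields the closure $((l_2\,\#\,r_2)\delta[r_1]_p\mu\lor C_1\mu\lor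 C_2\delta\mu)\cdot\sigma_1\sigma_2\rho$ with distinguished literal $(l_2\,\#\,r_2)\delta[r_1]_p\mu$, where $\mu=\mathrm{mgu}((l_2\,\#\,r_2)\delta|_p,l_1)$; here $\delta,\rho$ are identities if $p$ is a position of $l_2\,\#\,r_2$, and otherwise $\delta$ introduces only fresh variables, $(l_2\,\#\,r_2)\delta$ is the most general instance with position $p$ that still has $(l_2\,\#\,r_2)\sigma_2$ as an instance, and $\rho$ acts only on the fresh variables, with $(l_2\,\#\,r_2)\delta\sigma_2\rho=(l_2\,\#\,r_2)\sigma_2$. A reduction chain from a trail is a list of rewrite steps, each a leaf annotating a trail literal or inferred from two earlier members. A reduction chain application from $\Gamma$ to a closure with distinguished ground literal $K$ is a reduction chain from $\Gamma$ and this closure whose last ground literal is the $\mathrm{conv}(\Gamma)$-normal form of $K$, and which loses this property when any step is removed. A refutation from $\Gamma$ and a closure with $\beta$-false distinguished literal is such a chain whose last ground literal has the form $s\not\approx s$, and which loses this property when any step but the last is removed. **The calculus SCL(EQ).** States are tuples $(\Gamma;N;U;\beta;k;D)$: a trail, the sets of initial and learned clauses, a ground term, the decision level, and $D\in\{\top,\bot\}$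 or a closure. The initial state is $(\epsilon;N;\emptyset;\beta;0;\top)$. The rules are as follows; only the components that change are described. * *Propagate* ($D=\top$): there are $C_0\lor C_1\lor L\in N\cup U$ and a grounding $\sigma$, irreducible by $\mathrm{conv}(\Gamma)$, such that all literals of $C_0\sigma$ are false in $\Gamma$, all literals of $C_1\sigma$ equal $L\sigma$, $\mu$ is the mgu of $L$ and the literals of $C_1$, $L\sigma$ is $\beta$-undefined, $(C_0\lor L)\mu\sigma\prec_T\beta$, and there is a reduction chain application from $\Gamma$ to $(L\mu\lor C_0\mu)\cdot\sigma$ with last closure $(s\,\#\,t\lor C)\cdot\tau$. Append $(s\,\#\,t)\tau$ with level $k$ and this closure to $\Gamma$. * *Decide* ($D=\top$): there are $C_0\lor L\in N\cup U$ and a grounding $\sigma$, irreducible by $\mathrm{conv}(\Gamma)$, such that $C_0\sigma$ is $\beta$-undefined or $\beta$-true, $L\sigma$ is $\beta$-undefined, $(C_0\lor L)\sigma\prec_T\beta$, and there is a reduction chain application from $\Gamma$ to $(L\lor C_0)\cdot\sigma$ with last closure $(s\,\#\,t\lor C)\cdot\tau$. Append $(s\,\#\,t)\tau$ with level $k+1$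 and closure $(s\,\#\,t\lor\mathrm{comp}(s\,\#\,t))\cdot\tau$; $k$ becomes $k+1$. * *Conflict* ($D=\top$): there are $D'\in N\cup U$ and a grounding $\sigma$, irreducible by $\mathrm{conv}(\Gamma)$, with $D'\sigma$ $\beta$-false. $D$ becomes $\bot$ if $D'\sigma$ is of level $0$, else $D'\cdot\sigma$. * *Skip*: if the trail is $\Gamma',K^{l},L^{k}$, the status is $D\cdot\sigma$, and $D\sigma$ is $\beta$-false in $\Gamma',K$, delete $L$; $k$ becomes $l$. * *Explore-Refutation*: if the status is $(D\lor K)\cdot\sigma$, all literals of $D\sigma$ are $\prec_{\Gamma^*}K\sigma$, the last trail literal is the defining literal of $K\sigma$, and $(s_j\,\#\,t_j\lor C_j)\cdot\sigma_j$ occurs in a refutation from $\Gamma$ and $(K\lor D)\cdot\sigma$, with $(s_j\,\#\,t_j\lor C_j)\sigma_j\prec_{\Gamma^*}(D\lor K)\sigma$ and $\beta$-false, it becomes the status. * *Factorize*: $(D\lor L\lor L')\cdot\sigma$ with $L\sigma=L'\sigma$ becomes $(D\lor L)\mu\cdot\sigma$, $\mu=\mathrm{mgu}(L,L')$. *Equality-Resolution*: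 $(D\lor s\not\approx s')\cdot\sigma$ with $s\sigma=s'\sigma$ becomes $D\mu\cdot\sigma$, $\mu=\mathrm{mgu}(s,s')$. * *Backtrack*: if the status is $(D\lor L)\cdot\sigma$, $D\sigma$ is of level $<k$, and $\Gamma',K$ is the shortest prefix of the trail for which some ground instance of $D\lor L$ is $\beta$-false in $\Gamma',K$ but not in $\Gamma'$, then the trail becomes $\Gamma'$, $D\lor L$ is added to $U$, the status becomes $\top$, and $k$ becomes $j-i$, where $j$ is the level of $K$, and $i=1$ if $K$ is a decision literal, $i=0$ otherwise. * *Grow* ($D=\top$): the trail becomes empty, $k$ becomes $0$, and $\beta$ is replaced by a ground term $\beta'$ with $\beta\prec_T\beta'$. A run is a finite sequence of rule applications from an initial state. It is *regular* if (1) Conflict and Factorize have precedence over all other rules; (2) in states with $k=0$, Propagate has precedence over Decide; (3) if Propagate could append $L^{k:C\cdot\sigma}$ with $C\in N\cup U$, then Decide does not append $\mathrm{comp}(L)$; (4) between an application of Conflict and the Backtrack that ends its conflict resolution, Skip is applied at least once, unless Conflict was applied immediately after Decide; (5) if Conflict was applied immediately after Decide, then that Backtrack is only applied in a state with trail $\Gamma,L'$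 and status $D\cdot\sigma$ such that $L\sigma=\mathrm{comp}(L')$ for some $L\in D$. **Lemma (Unit Rewriting).** Let $(\Gamma;N;U;\beta;k;D)$ be a state resulting from a regular run, with $k>0$, and let $l\approx r\in N$ be a unit clause. Let $C\lor L[l']_p\in N$ with $l'=l\mu$ for a matcher $\mu$. Let $\sigma'$ be grounding for $C\lor L[l']_p$ and $\sigma$ grounding for $l\approx r$, with $l\sigma=l'\sigma'$ and $r\sigma\prec_T l\sigma$. Then $$C\sigma'\lor (L\sigma')[r\sigma]_p\;\prec_{\Gamma^*}\;(C\lor L[l']_p)\sigma'.$$ In particular, if $l\approx r$ and $C\lor L[l']_p$ have no variables in common, $\mu$ moves only variables of $l$, and $\sigma$ moves only variables of $l\approx r$, then $$(C\lor L[r\mu\sigma\sigma']_p)\sigma'\;\prec_{\Gamma^*}\;(C\lor L[l']_p)\sigma'.$$ -/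

import Mathlib

namespace SCLEQ

universe u v w

/-! ## Terms, substitutions, positions

Terms over the signature `L` with variables from `V` are Mathlib's first-order terms `L.Term V`.
The only predicate is equality, so relation symbols of `L` play no role. -/

/-- A substitution; it is applied with `Term.subst`. -/
abbrev Subst (L : FirstOrder.Language.{u, v}) (V : Type w) := V → L.Term V

/-- The domain of a substitution. -/
def Subst.dom {L : FirstOrder.Language.{u, v}} {V : Type w} (σ : Subst L V) : Set V :=
  {x | σ x ≠ FirstOrder.Language.Term.var x}

/-- Composition `στ`: first `σ`, then `τ`. -/
def Subst.comp {L : FirstOrder.Language.{u, v}} {V : Type w} (σ τ : Subst L V) : Subst L V :=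
  fun x => (σ x).subst τ

/-- The variables of a term. -/
def vars {L : FirstOrder.Language.{u, v}} {V : Type w} : L.Term V → Set V
  | .var x => {x}
  | .func _ ts => ⋃ i, vars (ts i)

/-- The subterm `t|_p`; it is `none` iff `p` is not a position of `t`. -/
def subtermAt {L : FirstOrder.Language.{u, v}} {V : Type w} : L.Term V → List ℕ → Option (L.Term V)
  | t, [] => some t
  | .var _, _ :: _ => none
  | .func (l := n) _ ts, i :: p => if h : i < n then subtermAt (ts ⟨i, h⟩) p else none

/-- The replacement `t[s]_p` (it is `t` itself if `p` is not a position of `t`). -/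
def replaceAt {L : FirstOrder.Language.{u, v}} {V : Type w} : L.Term V → List ℕ → L.Term V → L.Term V
  | _, [], s => s
  | .var x, _ :: _, _ => .var x
  | .func f ts, i :: p, s => .func f (fun j => if j.val = i then replaceAt (ts j) p s else ts j)

/-- `μ` is a most general unifier of the equations in `E`; mgus are idempotent and do not
introduce fresh variables. -/
def IsMGU {L : FirstOrder.Language.{u, v}} {V : Type w} (E : Set (L.Term V × L.Term V))
    (μ : Subst L V) : Prop :=
  (∀ e ∈ E, e.1.subst μ = e.2.subst μ) ∧
  (∀ θ : Subst L V, (∀ e ∈ E, e.1.subst θ = e.2.subst θ) → ∃ ρ : Subst L V, θ = μ.comp ρ) ∧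
  μ.comp μ = μ ∧
  (∀ x ∈ μ.dom, (∃ e ∈ E, x ∈ vars e.1 ∪ vars e.2) ∧
    ∀ y ∈ vars (μ x), ∃ e ∈ E, y ∈ vars e.1 ∪ vars e.2)

/-! ## Orderings -/

/-- The (Dershowitz-Manna) multiset extension of a relation. -/
def MulExt {α : Type*} (r : α → α → Prop) (M N : Multiset α) : Prop :=
  ∃ X Y Z : Multiset α, Y ≠ 0 ∧ M = Z + X ∧ N = Z + Y ∧ ∀ x ∈ X, ∃ y ∈ Y, r x y

/-- A desired term ordering: a well-founded rewrite ordering, total on ground terms, with only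
finitely many ground terms below each ground term. -/
structure IsDesired {L : FirstOrder.Language.{u, v}} {V : Type w} (lt : L.Term V → L.Term V → Prop) :
    Prop where
  wf : WellFounded lt
  trans : ∀ s t u, lt s t → lt t u → lt s u
  subst : ∀ (s t : L.Term V) (σ : Subst L V), lt s t → lt (s.subst σ) (t.subst σ)
  context : ∀ (s t c : L.Term V) (p : List ℕ), subtermAt c p ≠ none → lt s t →
    lt (replaceAt c p s) (replaceAt c p t)
  total : ∀ s t : L.Term V, vars s = ∅ → vars t = ∅ → lt s t ∨ s = t ∨ lt t s
  finite_below : ∀ t : L.Term V, vars t = ∅ → {s | vars s = ∅ ∧ lt s t}.Finite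

/-! ## Rewrite systems -/

/-- `s → t` by a rule of `R`. -/
def Rewrites {L : FirstOrder.Language.{u, v}} {V : Type w} (R : Set (L.Term V × L.Term V))
    (s t : L.Term V) : Prop :=
  ∃ e ∈ R, ∃ (p : List ℕ) (θ : Subst L V),
    subtermAt s p = some (e.1.subst θ) ∧ t = replaceAt s p (e.2.subst θ)

def Irreducible {L : FirstOrder.Language.{u, v}} {V : Type w} (R : Set (L.Term V × L.Term V))
    (t : L.Term V) : Prop :=
  ∀ t', ¬ Rewrites R t t'

/-- `s` is a normal form of `t`. -/
def IsNormalForm {L : FirstOrder.Language.{u, v}} {V : Type w} (R : Set (L.Term V × L.Term V))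
    (s t : L.Term V) : Prop :=
  Relation.ReflTransGen (Rewrites R) t s ∧ Irreducible R s

/-- A substitution all of whose codomain terms are irreducible. -/
def SubstIrreducible {L : FirstOrder.Language.{u, v}} {V : Type w} (R : Set (L.Term V × L.Term V))
    (σ : Subst L V) : Prop :=
  ∀ x ∈ σ.dom, Irreducible R (σ x)

/-! ## Literals and clauses -/

/-- An equational literal `s ≈ t` (`pos = true`) or `s ≉ t` (`pos = false`). The two sides of an
equation are unordered. -/
@[ext]
structure Lit (L : FirstOrder.Language.{u, v}) (V : Type w) where
  pos : Bool
  eqn : Sym2 (L.Term V)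

def Lit.comp {L : FirstOrder.Language.{u, v}} {V : Type w} (K : Lit L V) : Lit L V := ⟨!K.pos, K.eqn⟩

def Lit.subst {L : FirstOrder.Language.{u, v}} {V : Type w} (K : Lit L V) (σ : Subst L V) : Lit L V :=
  ⟨K.pos, K.eqn.map (fun t => t.subst σ)⟩

def Lit.vars {L : FirstOrder.Language.{u, v}} {V : Type w} (K : Lit L V) : Set V :=
  {x | ∃ t ∈ K.eqn, x ∈ SCLEQ.vars t}

def Lit.Ground {L : FirstOrder.Language.{u, v}} {V : Type w} (K : Lit L V) : Prop := K.vars = ∅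

/-- The multiset `{s,t}` for `s ≈ t` and `{s,s,t,t}` for `s ≉ t`. -/
def Lit.termMultiset {L : FirstOrder.Language.{u, v}} {V : Type w} (K : Lit L V) : Multiset (L.Term V) :=
  if K.pos then K.eqn.toMultiset else K.eqn.toMultiset + K.eqn.toMultiset

abbrev Clause (L : FirstOrder.Language.{u, v}) (V : Type w) := Multiset (Lit L V)

def Clause.subst {L : FirstOrder.Language.{u, v}} {V : Type w} (C : Clause L V) (σ : Subst L V) :
    Clause L V :=
  Multiset.map (fun K => K.subst σ) C

def Clause.vars {L : FirstOrder.Language.{u, v}} {V : Type w} (C : Clause L V) : Set V :=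
  {x | ∃ K ∈ C, x ∈ Lit.vars K}

def Clause.Ground {L : FirstOrder.Language.{u, v}} {V : Type w} (C : Clause L V) : Prop :=
  ∀ K ∈ C, Lit.Ground K

/-- `σ` (with finite domain) is grounding for `C`. -/
def Grounding {L : FirstOrder.Language.{u, v}} {V : Type w} (σ : Subst L V) (C : Clause L V) : Prop :=
  σ.dom.Finite ∧ Clause.Ground (Clause.subst C σ)

/-- `≺_T` on literals. -/
def LitLt {L : FirstOrder.Language.{u, v}} {V : Type w} (lt : L.Term V → L.Term V → Prop)
    (K H : Lit L V) : Prop :=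
  MulExt lt K.termMultiset H.termMultiset

/-- `K ≺_T β` for a literal `K` and a term `β`. -/
def LitLtTerm {L : FirstOrder.Language.{u, v}} {V : Type w} (lt : L.Term V → L.Term V → Prop)
    (K : Lit L V) (β : L.Term V) : Prop :=
  MulExt lt K.termMultiset {β}

/-- `β ≺_T K` for a literal `K` and a term `β`. -/
def TermLtLit {L : FirstOrder.Language.{u, v}} {V : Type w} (lt : L.Term V → L.Term V → Prop)
    (β : L.Term V) (K : Lit L V) : Prop :=
  MulExt lt {β} K.termMultiset

/-- `C ≺_T β` for a clause `C` and a term `β`. -/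
def ClauseLtTerm {L : FirstOrder.Language.{u, v}} {V : Type w} (lt : L.Term V → L.Term V → Prop)
    (C : Clause L V) (β : L.Term V) : Prop :=
  MulExt (MulExt lt) (Multiset.map Lit.termMultiset C) {{β}}

/-! ## Semantics -/

def Lit.Holds {L : FirstOrder.Language.{u, v}} {V : Type w} {M : Type*} [L.Structure M] (a : V → M)
    (K : Lit L V) : Prop :=
  if K.pos then (K.eqn.map (fun t => t.realize a)).IsDiag
  else ¬ (K.eqn.map (fun t => t.realize a)).IsDiag

/-- Semantic entailment `G ⊨ K` for a set of (ground) literals `G`. -/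
def Entails {L : FirstOrder.Language.{u, v}} {V : Type w} (G : Set (Lit L V)) (K : Lit L V) : Prop :=
  ∀ (M : Type (max u w)) [L.Structure M] [Nonempty M] (a : V → M),
    (∀ H ∈ G, Lit.Holds a H) → Lit.Holds a K

/-- `K` is true or false in `G`. -/
def Defined {L : FirstOrder.Language.{u, v}} {V : Type w} (G : Set (Lit L V)) (K : Lit L V) : Prop :=
  Entails G K ∨ Entails G K.comp

/-! ## Trails -/

/-- A closure `(K ∨ C)·σ` with a distinguished literal `K`. -/
structure Closure (L : FirstOrder.Language.{u, v}) (V : Type w) where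
  lit : Lit L V
  rest : Clause L V
  sub : Subst L V

def Closure.clause {L : FirstOrder.Language.{u, v}} {V : Type w} (c : Closure L V) : Clause L V :=
  c.lit ::ₘ c.rest

/-- The ground literal of a closure. -/
def Closure.glit {L : FirstOrder.Language.{u, v}} {V : Type w} (c : Closure L V) : Lit L V :=
  c.lit.subst c.sub

def Closure.vars {L : FirstOrder.Language.{u, v}} {V : Type w} (c : Closure L V) : Set V :=
  Clause.vars c.clause

/-- An annotated literal `Kσ^{i:(K ∨ C)·σ}`. -/
structure AnnLit (L : FirstOrder.Language.{u, v}) (V : Type w) where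
  closure : Closure L V
  level : ℕ

def AnnLit.glit {L : FirstOrder.Language.{u, v}} {V : Type w} (a : AnnLit L V) : Lit L V := a.closure.glit

/-- A sequence of annotated ground literals, in chronological order. -/
abbrev Trail (L : FirstOrder.Language.{u, v}) (V : Type w) := List (AnnLit L V)

/-- The set of ground literals of a trail. -/
def Trail.lits {L : FirstOrder.Language.{u, v}} {V : Type w} (Γ : Trail L V) : Set (Lit L V) :=
  {K | ∃ a ∈ Γ, AnnLit.glit a = K}

/-- The convergent rewrite system `conv(G)` of the positive equations in `G`: all ground rules
`l → r` with `r ≺_T l` such that `l ≈ r` follows from these equations. All rules are oriented by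
`≺_T`, and the normal form of a ground term is the `≺_T`-least ground term equal to it modulo
the equations; so normal forms (and irreducibility) of ground terms are those of any convergent
system oriented by `≺_T` that presents the same equations. -/
def conv {L : FirstOrder.Language.{u, v}} {V : Type w} (lt : L.Term V → L.Term V → Prop)
    (G : Set (Lit L V)) : Set (L.Term V × L.Term V) :=
  {e | vars e.1 = ∅ ∧ vars e.2 = ∅ ∧ lt e.2 e.1 ∧
    Entails {K | K ∈ G ∧ K.pos = true} ⟨true, s(e.1, e.2)⟩}

def BTrue {L : FirstOrder.Language.{u, v}} {V : Type w} (lt : L.Term V → L.Term V → Prop)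
    (Γ : Trail L V) (β : L.Term V) (K : Lit L V) : Prop :=
  LitLtTerm lt K β ∧ Entails (Trail.lits Γ) K

def BFalse {L : FirstOrder.Language.{u, v}} {V : Type w} (lt : L.Term V → L.Term V → Prop)
    (Γ : Trail L V) (β : L.Term V) (K : Lit L V) : Prop :=
  LitLtTerm lt K β ∧ Entails (Trail.lits Γ) K.comp

def BUndef {L : FirstOrder.Language.{u, v}} {V : Type w} (lt : L.Term V → L.Term V → Prop)
    (Γ : Trail L V) (β : L.Term V) (K : Lit L V) : Prop :=
  TermLtLit lt β K ∨ ¬ Defined (Trail.lits Γ) K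

def BDef {L : FirstOrder.Language.{u, v}} {V : Type w} (lt : L.Term V → L.Term V → Prop)
    (Γ : Trail L V) (β : L.Term V) (K : Lit L V) : Prop :=
  LitLtTerm lt K β ∧ Defined (Trail.lits Γ) K

def ClauseBTrue {L : FirstOrder.Language.{u, v}} {V : Type w} (lt : L.Term V → L.Term V → Prop)
    (Γ : Trail L V) (β : L.Term V) (C : Clause L V) : Prop :=
  ∃ K ∈ C, BTrue lt Γ β K

def ClauseBFalse {L : FirstOrder.Language.{u, v}} {V : Type w} (lt : L.Term V → L.Term V → Prop)
    (Γ : Trail L V) (β : L.Term V) (C : Clause L V) : Prop :=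
  ∀ K ∈ C, BFalse lt Γ β K

def ClauseBUndef {L : FirstOrder.Language.{u, v}} {V : Type w} (lt : L.Term V → L.Term V → Prop)
    (Γ : Trail L V) (β : L.Term V) (C : Clause L V) : Prop :=
  ¬ ClauseBTrue lt Γ β C ∧ ¬ ClauseBFalse lt Γ β C

/-! ## Cores, defining literals, levels -/

/-- The literals of the subsequence of `Γ` with index set `Δ`. -/
def subLits {L : FirstOrder.Language.{u, v}} {V : Type w} (Γ : Trail L V) (Δ : Finset (Fin Γ.length)) :
    Set (Lit L V) :=
  {K | ∃ i ∈ Δ, (Γ.get i).glit = K}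

/-- A core of `K`: a minimal subsequence of `Γ` in which `K` is defined. -/
def IsCore {L : FirstOrder.Language.{u, v}} {V : Type w} (Γ : Trail L V) (K : Lit L V)
    (Δ : Finset (Fin Γ.length)) : Prop :=
  Minimal (fun Δ => Defined (subLits Γ Δ) K) Δ

/-- The `i`-th literal of `Γ` is the defining literal of `K`: it is the maximum of a core whose
maximum is smallest among all cores. -/
def IsDefining {L : FirstOrder.Language.{u, v}} {V : Type w} (Γ : Trail L V) (K : Lit L V)
    (i : Fin Γ.length) : Prop :=
  (∃ Δ, IsCore Γ K Δ ∧ IsGreatest (Δ : Set (Fin Γ.length)) i) ∧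
  ∀ Λ, IsCore Γ K Λ → ∃ j, IsGreatest (Λ : Set (Fin Γ.length)) j ∧ i ≤ j

/-- The ground literal `K` is of level `n` in `Γ`. -/
def HasLevel {L : FirstOrder.Language.{u, v}} {V : Type w} (Γ : Trail L V) (K : Lit L V) (n : ℕ) : Prop :=
  (∃ a ∈ Γ, AnnLit.glit a = K ∧ a.level = n) ∨
  (K ∉ Trail.lits Γ ∧ Defined (Trail.lits Γ) K ∧
    ((∃ i, IsDefining Γ K i ∧ (Γ.get i).level = n) ∨ ((¬ ∃ i, IsDefining Γ K i) ∧ n = 0)))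

/-- The ground clause `C` is of level `n` in `Γ`: `n` is the maximum of the levels of its
literals (`0` for the empty clause). -/
def ClauseHasLevel {L : FirstOrder.Language.{u, v}} {V : Type w} (Γ : Trail L V) (C : Clause L V)
    (n : ℕ) : Prop :=
  (∀ K ∈ C, ∃ m ≤ n, HasLevel Γ K m) ∧ ((C = 0 ∧ n = 0) ∨ ∃ K ∈ C, HasLevel Γ K n)

/-- The level of the last literal, `0` for the empty trail. -/
def Trail.lastLevel {L : FirstOrder.Language.{u, v}} {V : Type w} (Γ : Trail L V) : ℕ :=
  (Γ.getLast?.map AnnLit.level).getD 0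

/-! ## The trail induced ordering -/

/-- `β`-defined and of level greater than zero. -/
def Pos {L : FirstOrder.Language.{u, v}} {V : Type w} (lt : L.Term V → L.Term V → Prop)
    (Γ : Trail L V) (β : L.Term V) (K : Lit L V) : Prop :=
  BDef lt Γ β K ∧ ∃ n, 0 < n ∧ HasLevel Γ K n

/-- `β`-defined and of level zero. -/
def Zero {L : FirstOrder.Language.{u, v}} {V : Type w} (lt : L.Term V → L.Term V → Prop)
    (Γ : Trail L V) (β : L.Term V) (K : Lit L V) : Prop :=
  BDef lt Γ β K ∧ HasLevel Γ K 0

/-- `K` is one of the `β`-defined literals `M_{i,_}`: neither `K` nor its complement is on the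
trail, and the `i`-th trail literal is its defining literal. -/
def IsM {L : FirstOrder.Language.{u, v}} {V : Type w} (lt : L.Term V → L.Term V → Prop)
    (Γ : Trail L V) (β : L.Term V) (i : Fin Γ.length) (K : Lit L V) : Prop :=
  BDef lt Γ β K ∧ K ∉ Trail.lits Γ ∧ K.comp ∉ Trail.lits Γ ∧ IsDefining Γ K i

/-- The clauses of the trail induced ordering; `K.comp = L_i` expresses `K = comp(L_i)`, and
the literals `M_{i,j}` with the same defining literal `L_i` are enumerated along `≺_T`. -/
inductive TrailRel {L : FirstOrder.Language.{u, v}} {V : Type w} (lt : L.Term V → L.Term V → Prop)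
    (Γ : Trail L V) (β : L.Term V) : Lit L V → Lit L V → Prop
  | mm (K H : Lit L V) (i j : Fin Γ.length) : Pos lt Γ β K → Pos lt Γ β H →
      IsM lt Γ β i K → IsM lt Γ β j H → (i < j ∨ (i = j ∧ LitLt lt K H)) → TrailRel lt Γ β K H
  | ll (K H : Lit L V) (i j : Fin Γ.length) : Pos lt Γ β K → Pos lt Γ β H →
      K = (Γ.get i).glit → H = (Γ.get j).glit → i < j → TrailRel lt Γ β K H
  | cl (K H : Lit L V) (i j : Fin Γ.length) : Pos lt Γ β K → Pos lt Γ β H →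
      K.comp = (Γ.get i).glit → H = (Γ.get j).glit → i < j → TrailRel lt Γ β K H
  | lc (K H : Lit L V) (i j : Fin Γ.length) : Pos lt Γ β K → Pos lt Γ β H →
      K = (Γ.get i).glit → H.comp = (Γ.get j).glit → (i < j ∨ i = j) → TrailRel lt Γ β K H
  | cc (K H : Lit L V) (i j : Fin Γ.length) : Pos lt Γ β K → Pos lt Γ β H →
      K.comp = (Γ.get i).glit → H.comp = (Γ.get j).glit → i < j → TrailRel lt Γ β K H
  | lm (K H : Lit L V) (i k : Fin Γ.length) : Pos lt Γ β K → Pos lt Γ β H →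
      (K = (Γ.get i).glit ∨ K.comp = (Γ.get i).glit) → IsM lt Γ β k H → i ≤ k →
      TrailRel lt Γ β K H
  | ml (K H : Lit L V) (k i : Fin Γ.length) : Pos lt Γ β K → Pos lt Γ β H →
      IsM lt Γ β k K → (H = (Γ.get i).glit ∨ H.comp = (Γ.get i).glit) → k < i →
      TrailRel lt Γ β K H
  | zz (K H : Lit L V) : Zero lt Γ β K → Zero lt Γ β H → LitLt lt K H → TrailRel lt Γ β K H
  | zp (K H : Lit L V) : Zero lt Γ β K → Pos lt Γ β H → TrailRel lt Γ β K H
  | uu (K H : Lit L V) : BUndef lt Γ β K → BUndef lt Γ β H → LitLt lt K H → TrailRel lt Γ β K H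
  | du (K H : Lit L V) : BDef lt Γ β K → BUndef lt Γ β H → TrailRel lt Γ β K H

/-- The trail induced ordering `≺_{Γ*}` on ground literals. -/
def TrailLt {L : FirstOrder.Language.{u, v}} {V : Type w} (lt : L.Term V → L.Term V → Prop)
    (Γ : Trail L V) (β : L.Term V) (K H : Lit L V) : Prop :=
  K.Ground ∧ H.Ground ∧ TrailRel lt Γ β K H

/-- The trail induced ordering `≺_{Γ*}` on ground clauses. -/
def TrailClauseLt {L : FirstOrder.Language.{u, v}} {V : Type w} (lt : L.Term V → L.Term V → Prop)
    (Γ : Trail L V) (β : L.Term V) (C D : Clause L V) : Prop :=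
  MulExt (TrailLt lt Γ β) C D

/-! ## Rewrite steps, reduction chains, refutations -/

/-- Rewrite steps `(K·σ, (K ∨ C)·σ, R, S, p)`; in `leaf` the last three entries are empty. -/
inductive RStep (L : FirstOrder.Language.{u, v}) (V : Type w) : Type (max u w)
  | leaf (c : Closure L V) : RStep L V
  | node (c : Closure L V) (R S : RStep L V) (p : List ℕ) : RStep L V

def RStep.closure {L : FirstOrder.Language.{u, v}} {V : Type w} : RStep L V → Closure L V
  | .leaf c => c
  | .node c _ _ _ => c

/-- `c'` is a variant of `c`: its clause is renamed, and its substitution has the same ground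
instance and acts on the variables of its clause only. -/
def IsVariant {L : FirstOrder.Language.{u, v}} {V : Type w} (c c' : Closure L V) : Prop :=
  ∃ π : Equiv.Perm V,
    c'.lit = c.lit.subst (fun x => FirstOrder.Language.Term.var (π x)) ∧
    c'.rest = Clause.subst c.rest (fun x => FirstOrder.Language.Term.var (π x)) ∧
    (∀ x ∈ c.vars, c'.sub (π x) = c.sub x) ∧
    c'.sub.dom ⊆ c'.vars

/-- `I₃` is the result of a rewrite inference from `I₁` and `I₂`, which are made variable
disjoint by renaming. The first alternative rewrites at a position of the literal of `I₂`, the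
second one at a position below a variable of it: there `δ` gives the most general instance with
the position `p` that still has the ground literal of `I₂` as an instance, `δ` introduces only
fresh variables, and `ρ` instantiates just these. As literals are unordered, the rewritten side
may be called `l₂`. -/
def IsRewriteInference {L : FirstOrder.Language.{u, v}} {V : Type w} (lt : L.Term V → L.Term V → Prop)
    (I₁ I₂ I₃ : RStep L V) : Prop :=
  ∃ c₁ c₂ : Closure L V, IsVariant I₁.closure c₁ ∧ IsVariant I₂.closure c₂ ∧
    Disjoint c₁.vars c₂.vars ∧
  ∃ (l₁ r₁ l₂ r₂ : L.Term V) (b : Bool) (p : List ℕ),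
    c₁.lit = ⟨true, s(l₁, r₁)⟩ ∧ c₂.lit = ⟨b, s(l₂, r₂)⟩ ∧
    lt (r₁.subst c₁.sub) (l₁.subst c₁.sub) ∧
    subtermAt (l₂.subst c₂.sub) p = some (l₁.subst c₁.sub) ∧
    ((∃ (t : L.Term V) (μ : Subst L V), subtermAt l₂ p = some t ∧ IsMGU {(t, l₁)} μ ∧
        I₃ = RStep.node
          ⟨Lit.subst ⟨b, s(replaceAt l₂ p r₁, r₂)⟩ μ,
            Clause.subst c₁.rest μ + Clause.subst c₂.rest μ, c₁.sub.comp c₂.sub⟩ I₁ I₂ p) ∨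
     (subtermAt l₂ p = none ∧ ∃ (δ ρ μ : Subst L V) (t : L.Term V),
        δ.dom ⊆ vars l₂ ∪ vars r₂ ∧
        (∀ x ∈ δ.dom, Disjoint (vars (δ x)) (c₁.vars ∪ c₂.vars)) ∧
        subtermAt (l₂.subst δ) p = some t ∧
        ((l₂.subst δ).subst c₂.sub).subst ρ = l₂.subst c₂.sub ∧
        ((r₂.subst δ).subst c₂.sub).subst ρ = r₂.subst c₂.sub ∧
        ρ.dom ⊆ (vars (l₂.subst δ) ∪ vars (r₂.subst δ)) \ (c₁.vars ∪ c₂.vars) ∧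
        (∀ θ : Subst L V, subtermAt (l₂.subst θ) p ≠ none →
          (∃ τ : Subst L V, (l₂.subst θ).subst τ = l₂.subst c₂.sub ∧
            (r₂.subst θ).subst τ = r₂.subst c₂.sub) →
          ∃ τ : Subst L V, l₂.subst θ = (l₂.subst δ).subst τ ∧
            r₂.subst θ = (r₂.subst δ).subst τ) ∧
        IsMGU {(t, l₁)} μ ∧
        I₃ = RStep.node
          ⟨Lit.subst ⟨b, s(replaceAt (l₂.subst δ) p r₁, r₂.subst δ)⟩ μ,
            Clause.subst c₁.rest μ + Clause.subst (Clause.subst c₂.rest δ) μ,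
            (c₁.sub.comp c₂.sub).comp ρ⟩ I₁ I₂ p))

/-- A reduction chain from the closures in `S`. -/
def IsChain {L : FirstOrder.Language.{u, v}} {V : Type w} (lt : L.Term V → L.Term V → Prop)
    (S : Set (Closure L V)) (P : List (RStep L V)) : Prop :=
  ∀ i : Fin P.length, (∃ c ∈ S, P.get i = RStep.leaf c) ∨
    ∃ j k : Fin P.length, j < i ∧ k < i ∧ IsRewriteInference lt (P.get j) (P.get k) (P.get i)

/-- The closures annotating the literals of `Γ`, together with `c`. -/
def leafSet {L : FirstOrder.Language.{u, v}} {V : Type w} (Γ : Trail L V) (c : Closure L V) :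
    Set (Closure L V) :=
  {d | d = c ∨ ∃ a ∈ Γ, AnnLit.closure a = d}

/-- `K'` is the normal form of the literal `K`. -/
def IsLitNormalForm {L : FirstOrder.Language.{u, v}} {V : Type w} (R : Set (L.Term V × L.Term V))
    (K' K : Lit L V) : Prop :=
  ∃ (b : Bool) (s t s' t' : L.Term V), K = ⟨b, s(s, t)⟩ ∧ K' = ⟨b, s(s', t')⟩ ∧
    IsNormalForm R s' s ∧ IsNormalForm R t' t

/-- Reduction chain application, before minimality is imposed. -/
def ReducesTo {L : FirstOrder.Language.{u, v}} {V : Type w} (lt : L.Term V → L.Term V → Prop)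
    (Γ : Trail L V) (c : Closure L V) (P : List (RStep L V)) : Prop :=
  IsChain lt (leafSet Γ c) P ∧ ∃ I, P.getLast? = some I ∧
    IsLitNormalForm (conv lt (Trail.lits Γ)) I.closure.glit c.glit

/-- `P` is a (minimal) reduction chain application from `Γ` to the literal of `c`. -/
def IsReductionChainApp {L : FirstOrder.Language.{u, v}} {V : Type w} (lt : L.Term V → L.Term V → Prop)
    (Γ : Trail L V) (c : Closure L V) (P : List (RStep L V)) : Prop :=
  ReducesTo lt Γ c P ∧ ∀ i < P.length, ¬ ReducesTo lt Γ c (P.eraseIdx i)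

/-- Refutation, before minimality is imposed. -/
def Refutes {L : FirstOrder.Language.{u, v}} {V : Type w} (lt : L.Term V → L.Term V → Prop)
    (Γ : Trail L V) (c : Closure L V) (P : List (RStep L V)) : Prop :=
  IsChain lt (leafSet Γ c) P ∧ ∃ I, P.getLast? = some I ∧
    ∃ s : L.Term V, I.closure.glit = ⟨false, s(s, s)⟩

/-- `P` is a (minimal) refutation from `Γ` and the `β`-false literal of `c`. -/
def IsRefutation {L : FirstOrder.Language.{u, v}} {V : Type w} (lt : L.Term V → L.Term V → Prop)
    (Γ : Trail L V) (β : L.Term V) (c : Closure L V) (P : List (RStep L V)) : Prop :=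
  BFalse lt Γ β c.glit ∧ Refutes lt Γ c P ∧
    ∀ i, i + 1 < P.length → ¬ Refutes lt Γ c (P.eraseIdx i)

/-! ## The calculus -/

/-- The status of a state: `⊤`, `⊥` or a closure `D·σ`. -/
inductive Status (L : FirstOrder.Language.{u, v}) (V : Type w) : Type (max u w)
  | top : Status L V
  | bot : Status L V
  | confl (D : Clause L V) (σ : Subst L V) : Status L V

/-- A state `(Γ; N; U; β; k; D)`. -/
structure State (L : FirstOrder.Language.{u, v}) (V : Type w) where
  trail : Trail L V
  N : Set (Clause L V)
  U : Set (Clause L V)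
  β : L.Term V
  k : ℕ
  status : Status L V

inductive Rule
  | propagate | decide | conflict | skip | explore | factorize | eqRes | backtrack | grow

/-- Some ground instance of `C` is `β`-false in `Γ, K` but not in `Γ`. -/
def BecomesFalse {L : FirstOrder.Language.{u, v}} {V : Type w} (lt : L.Term V → L.Term V → Prop)
    (Γ : Trail L V) (K : AnnLit L V) (β : L.Term V) (C : Clause L V) : Prop :=
  ∃ τ : Subst L V, Grounding τ C ∧ ClauseBFalse lt (Γ ++ [K]) β (Clause.subst C τ) ∧
    ¬ ClauseBFalse lt Γ β (Clause.subst C τ)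

/-- The inference rules. -/
inductive Step {L : FirstOrder.Language.{u, v}} {V : Type w} (lt : L.Term V → L.Term V → Prop) :
    Rule → State L V → State L V → Prop
  | propagate (Γ : Trail L V) (N U : Set (Clause L V)) (β : L.Term V) (k : ℕ)
      (C₀ : Clause L V) (C₁ : Multiset (L.Term V × L.Term V)) (b : Bool) (s t : L.Term V)
      (σ μ : Subst L V) (P : List (RStep L V)) (I : RStep L V) :
      -- the clause is `C₀ ∨ C₁ ∨ (s # t)`, where `C₁` consists of the literals `e.1 # e.2`
      ((⟨b, s(s, t)⟩ : Lit L V) ::ₘ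
        (C₀ + C₁.map (fun e => (⟨b, s(e.1, e.2)⟩ : Lit L V)))) ∈ N ∪ U →
      Grounding σ ((⟨b, s(s, t)⟩ : Lit L V) ::ₘ
        (C₀ + C₁.map (fun e => (⟨b, s(e.1, e.2)⟩ : Lit L V)))) →
      (∀ K ∈ Clause.subst C₀ σ, Entails (Trail.lits Γ) (Lit.comp K)) →
      (∀ e ∈ C₁, e.1.subst σ = s.subst σ ∧ e.2.subst σ = t.subst σ) →
      IsMGU {d | ∃ e ∈ C₁, d = (e.1, s) ∨ d = (e.2, t)} μ →
      BUndef lt Γ β (Lit.subst ⟨b, s(s, t)⟩ σ) →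
      ClauseLtTerm lt
        (Clause.subst (Clause.subst ((⟨b, s(s, t)⟩ : Lit L V) ::ₘ C₀) μ) σ) β →
      SubstIrreducible (conv lt (Trail.lits Γ)) σ →
      IsReductionChainApp lt Γ ⟨Lit.subst ⟨b, s(s, t)⟩ μ, Clause.subst C₀ μ, σ⟩ P →
      P.getLast? = some I →
      Step lt Rule.propagate ⟨Γ, N, U, β, k, Status.top⟩
        ⟨Γ ++ [⟨I.closure, k⟩], N, U, β, k, Status.top⟩
  | decide (Γ : Trail L V) (N U : Set (Clause L V)) (β : L.Term V) (k : ℕ)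
      (C₀ : Clause L V) (K : Lit L V) (σ : Subst L V) (P : List (RStep L V)) (I : RStep L V) :
      (K ::ₘ C₀) ∈ N ∪ U →
      Grounding σ (K ::ₘ C₀) →
      (ClauseBUndef lt Γ β (Clause.subst C₀ σ) ∨ ClauseBTrue lt Γ β (Clause.subst C₀ σ)) →
      BUndef lt Γ β (K.subst σ) →
      ClauseLtTerm lt (Clause.subst (K ::ₘ C₀) σ) β →
      SubstIrreducible (conv lt (Trail.lits Γ)) σ →
      IsReductionChainApp lt Γ ⟨K, C₀, σ⟩ P →
      P.getLast? = some I →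
      Step lt Rule.decide ⟨Γ, N, U, β, k, Status.top⟩
        ⟨Γ ++ [⟨⟨I.closure.lit, {I.closure.lit.comp}, I.closure.sub⟩, k + 1⟩], N, U, β, k + 1,
          Status.top⟩
  | conflictBot (Γ : Trail L V) (N U : Set (Clause L V)) (β : L.Term V) (k : ℕ)
      (D : Clause L V) (σ : Subst L V) :
      D ∈ N ∪ U → Grounding σ D → ClauseBFalse lt Γ β (Clause.subst D σ) →
      SubstIrreducible (conv lt (Trail.lits Γ)) σ →
      ClauseHasLevel Γ (Clause.subst D σ) 0 →
      Step lt Rule.conflict ⟨Γ, N, U, β, k, Status.top⟩ ⟨Γ, N, U, β, k, Status.bot⟩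
  | conflict (Γ : Trail L V) (N U : Set (Clause L V)) (β : L.Term V) (k : ℕ)
      (D : Clause L V) (σ : Subst L V) :
      D ∈ N ∪ U → Grounding σ D → ClauseBFalse lt Γ β (Clause.subst D σ) →
      SubstIrreducible (conv lt (Trail.lits Γ)) σ →
      ¬ ClauseHasLevel Γ (Clause.subst D σ) 0 →
      Step lt Rule.conflict ⟨Γ, N, U, β, k, Status.top⟩ ⟨Γ, N, U, β, k, Status.confl D σ⟩
  | skip (Γ : Trail L V) (K H : AnnLit L V) (N U : Set (Clause L V)) (β : L.Term V) (k : ℕ)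
      (D : Clause L V) (σ : Subst L V) :
      H.level = k →
      ClauseBFalse lt (Γ ++ [K]) β (Clause.subst D σ) →
      Step lt Rule.skip ⟨Γ ++ [K, H], N, U, β, k, Status.confl D σ⟩
        ⟨Γ ++ [K], N, U, β, K.level, Status.confl D σ⟩
  | explore (Γ : Trail L V) (N U : Set (Clause L V)) (β : L.Term V) (k : ℕ)
      (D : Clause L V) (K : Lit L V) (σ : Subst L V) (i : Fin Γ.length)
      (P : List (RStep L V)) (I : RStep L V) :
      (∀ H ∈ Clause.subst D σ, TrailLt lt Γ β H (K.subst σ)) →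
      -- the last trail literal is the defining literal
      i.val + 1 = Γ.length → IsDefining Γ (K.subst σ) i →
      IsRefutation lt Γ β ⟨K, D, σ⟩ P →
      I ∈ P →
      TrailClauseLt lt Γ β (Clause.subst I.closure.clause I.closure.sub)
        (Clause.subst (K ::ₘ D) σ) →
      ClauseBFalse lt Γ β (Clause.subst I.closure.clause I.closure.sub) →
      Step lt Rule.explore ⟨Γ, N, U, β, k, Status.confl (K ::ₘ D) σ⟩
        ⟨Γ, N, U, β, k, Status.confl I.closure.clause I.closure.sub⟩
  | factorize (Γ : Trail L V) (N U : Set (Clause L V)) (β : L.Term V) (k : ℕ)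
      (D : Clause L V) (b : Bool) (s t s' t' : L.Term V) (σ μ : Subst L V) :
      s.subst σ = s'.subst σ → t.subst σ = t'.subst σ →
      IsMGU {(s, s'), (t, t')} μ →
      Step lt Rule.factorize
        ⟨Γ, N, U, β, k,
          Status.confl ((⟨b, s(s, t)⟩ : Lit L V) ::ₘ (⟨b, s(s', t')⟩ : Lit L V) ::ₘ D) σ⟩
        ⟨Γ, N, U, β, k,
          Status.confl (Clause.subst ((⟨b, s(s, t)⟩ : Lit L V) ::ₘ D) μ) σ⟩
  | eqRes (Γ : Trail L V) (N U : Set (Clause L V)) (β : L.Term V) (k : ℕ)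
      (D : Clause L V) (s s' : L.Term V) (σ μ : Subst L V) :
      s.subst σ = s'.subst σ → IsMGU {(s, s')} μ →
      Step lt Rule.eqRes
        ⟨Γ, N, U, β, k, Status.confl ((⟨false, s(s, s')⟩ : Lit L V) ::ₘ D) σ⟩
        ⟨Γ, N, U, β, k, Status.confl (Clause.subst D μ) σ⟩
  | backtrack (Γ Γ' : Trail L V) (K : AnnLit L V) (N U : Set (Clause L V)) (β : L.Term V)
      (k i i' : ℕ) (D : Clause L V) (H : Lit L V) (σ : Subst L V) :
      ClauseHasLevel (Γ ++ K :: Γ') (Clause.subst D σ) i' → i' < k →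
      BecomesFalse lt Γ K β (H ::ₘ D) →
      (∀ (Γ₁ Γ₂ : Trail L V) (K₁ : AnnLit L V), Γ ++ K :: Γ' = Γ₁ ++ K₁ :: Γ₂ →
        Γ₁.length < Γ.length → ¬ BecomesFalse lt Γ₁ K₁ β (H ::ₘ D)) →
      -- `i = 1` if `K` is a decision literal, `i = 0` otherwise
      (K.level = Trail.lastLevel Γ + 1 → i = 1) →
      (K.level ≠ Trail.lastLevel Γ + 1 → i = 0) →
      Step lt Rule.backtrack ⟨Γ ++ K :: Γ', N, U, β, k, Status.confl (H ::ₘ D) σ⟩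
        ⟨Γ, N, U ∪ {H ::ₘ D}, β, K.level - i, Status.top⟩
  | grow (Γ : Trail L V) (N U : Set (Clause L V)) (β β' : L.Term V) (k : ℕ) :
      vars β' = ∅ → lt β β' →
      Step lt Rule.grow ⟨Γ, N, U, β, k, Status.top⟩ ⟨[], N, U, β', 0, Status.top⟩

/-- A run of length `n`: `st i` is the `i`-th state and `rl i` the rule that is applied in it. -/
structure IsRun {L : FirstOrder.Language.{u, v}} {V : Type w} (lt : L.Term V → L.Term V → Prop)
    (n : ℕ) (st : ℕ → State L V) (rl : ℕ → Rule) : Prop where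
  init : ∃ (N : Set (Clause L V)) (β : L.Term V), vars β = ∅ ∧
    st 0 = ⟨[], N, ∅, β, 0, Status.top⟩
  step : ∀ i < n, Step lt (rl i) (st i) (st (i + 1))

/-- The rule `ρ` is applicable in the state `S`. -/
def Applicable {L : FirstOrder.Language.{u, v}} {V : Type w} (lt : L.Term V → L.Term V → Prop)
    (ρ : Rule) (S : State L V) : Prop :=
  ∃ S', Step lt ρ S S'

/-- The application of Conflict at step `m` starts the conflict resolution that is finished by
the application of Backtrack at step `j`. -/
def Resolves (rl : ℕ → Rule) (m j : ℕ) : Prop :=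
  m < j ∧ rl m = Rule.conflict ∧ rl j = Rule.backtrack ∧
    ∀ i, m < i → i < j → rl i ≠ Rule.conflict ∧ rl i ≠ Rule.backtrack

/-- The application of Conflict at step `m` immediately follows an application of Decide. -/
def AfterDecide (rl : ℕ → Rule) (m : ℕ) : Prop :=
  ∃ i, m = i + 1 ∧ rl i = Rule.decide

/-- A regular run. -/
structure IsRegularRun {L : FirstOrder.Language.{u, v}} {V : Type w} (lt : L.Term V → L.Term V → Prop)
    (n : ℕ) (st : ℕ → State L V) (rl : ℕ → Rule) : Prop extends IsRun lt n st rl where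
  precedence : ∀ i < n, rl i ≠ Rule.conflict → rl i ≠ Rule.factorize →
    ¬ Applicable lt Rule.conflict (st i) ∧ ¬ Applicable lt Rule.factorize (st i)
  propagateFirst : ∀ i < n, (st i).k = 0 → rl i = Rule.decide →
    ¬ Applicable lt Rule.propagate (st i)
  noDecideComp : ∀ i < n, rl i = Rule.decide → ∀ (S' : State L V) (a a' : AnnLit L V),
    Step lt Rule.propagate (st i) S' → S'.trail = (st i).trail ++ [a] →
    a.closure.clause ∈ (st i).N ∪ (st i).U →
    (st (i + 1)).trail = (st i).trail ++ [a'] → a'.glit ≠ a.glit.comp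
  skipOnce : ∀ m j, j < n → Resolves rl m j →
    (∃ i, m < i ∧ i < j ∧ rl i = Rule.skip) ∨ AfterDecide rl m
  backtrackAfterDecide : ∀ m j, j < n → Resolves rl m j → AfterDecide rl m →
    ∃ (Γ : Trail L V) (a : AnnLit L V) (D : Clause L V) (σ : Subst L V) (K : Lit L V),
      (st j).trail = Γ ++ [a] ∧ (st j).status = Status.confl D σ ∧ K ∈ D ∧
      K.subst σ = a.glit.comp

/-- `S` is a state resulting from a regular run. -/
def ResultsFromRegularRun {L : FirstOrder.Language.{u, v}} {V : Type w}
    (lt : L.Term V → L.Term V → Prop) (S : State L V) : Prop :=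
  ∃ (n : ℕ) (st : ℕ → State L V) (rl : ℕ → Rule), IsRegularRun lt n st rl ∧ st n = S

end SCLEQ

/-!
In a regular run the first decision is made when neither Conflict nor Propagate applies. If some
instance `lσ ≈ rσ` below `β` of a unit equation of `N` were not entailed by the trail at that
moment, then one of the two rules would apply to the unit clause under the substitution obtained
from `σ` by normalization with respect to `conv Γ`. The reduction chain that Propagate asks for
exists because ground superposition over the trail reaches all of `conv Γ` and every ground
superposition lifts to a rewrite inference. So every trail prefix that precedes a literal of level
`> 0` entails all instances of units below `β`.

Hence rewriting a `β`-defined literal with such an instance changes neither the truth value nor a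
defining literal of level `> 0`. Trail literals are irreducible when they are appended, so neither
the reducible literal nor its complement is on the trail at a level `> 0`. Therefore the rewritten
literal either is a trail literal (or a complement of one), which precedes the literals that it
defines, or has the same index, and there the comparison is by `≺_T`.
-/

namespace SCLEQ

open FirstOrder.Language (Term)
open Relation

universe u v w

variable {L : FirstOrder.Language.{u, v}} {V : Type w}

/-! ## Substitutions and positions -/

section Substitution

variable {t : L.Term V} {σ τ : Subst L V} {x y : V}

lemma mem_vars_var : y ∈ vars (Term.var x : L.Term V) ↔ y = x := Iff.rfl

lemma mem_vars_func {n : ℕ} {f : L.Functions n} {ts : Fin n → L.Term V} :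
    x ∈ vars (Term.func f ts) ↔ ∃ i, x ∈ vars (ts i) := by
  simp only [vars, Set.mem_iUnion]

lemma finite_vars (t : L.Term V) : (vars t).Finite := by
  induction t with
  | var x => exact Set.finite_singleton x
  | func _ _ ih => exact Set.finite_iUnion ih

lemma subst_subst (t : L.Term V) (σ τ : Subst L V) :
    (t.subst σ).subst τ = t.subst (σ.comp τ) := by
  induction t with
  | var x => rfl
  | func f ts ih => simp only [Term.subst, ih]

lemma Subst.comp_assoc (σ τ ρ : Subst L V) : (σ.comp τ).comp ρ = σ.comp (τ.comp ρ) :=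
  funext fun x => subst_subst (σ x) τ ρ

lemma subst_congr (h : ∀ x ∈ vars t, σ x = τ x) : t.subst σ = t.subst τ := by
  induction t with
  | var x => exact h x rfl
  | func f ts ih =>
    simp only [Term.subst]
    congr 1
    exact funext fun i => ih i fun x hx => h x (mem_vars_func.2 ⟨i, hx⟩)

lemma eqOn_vars_of_subst_eq (h : t.subst σ = t.subst τ) : Set.EqOn σ τ (vars t) := by
  induction t with
  | var x => rintro y rfl; exact h
  | func f ts ih =>
    intro x hx
    obtain ⟨i, hi⟩ := mem_vars_func.1 hx
    simp only [Term.subst, Term.func.injEq, heq_eq_eq, true_and] at h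
    exact ih i (congrFun h i) hi

lemma subst_var (t : L.Term V) : t.subst Term.var = t := by
  induction t with
  | var x => rfl
  | func f ts ih => simp only [Term.subst, ih]

lemma subst_eq_self (h : ∀ x ∈ vars t, σ x = Term.var x) : t.subst σ = t :=
  (subst_congr h).trans (subst_var t)

lemma subst_of_ground (h : vars t = ∅) (σ : Subst L V) : t.subst σ = t :=
  subst_eq_self fun x hx => absurd hx (h ▸ Set.notMem_empty x)

lemma mem_vars_subst : y ∈ vars (t.subst σ) ↔ ∃ x ∈ vars t, y ∈ vars (σ x) := by
  induction t with
  | var x => simp only [Term.subst, mem_vars_var, exists_eq_left]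
  | func f ts ih =>
    simp only [Term.subst, mem_vars_func, ih]
    exact ⟨fun ⟨i, x, hx, hy⟩ => ⟨x, ⟨i, hx⟩, hy⟩, fun ⟨x, ⟨i, hx⟩, hy⟩ => ⟨i, x, hx, hy⟩⟩

lemma vars_subst_eq_empty : vars (t.subst σ) = ∅ ↔ ∀ x ∈ vars t, vars (σ x) = ∅ := by
  simp only [Set.eq_empty_iff_forall_notMem, mem_vars_subst]
  exact ⟨fun h x hx y hy => h y ⟨x, hx, hy⟩, fun h y ⟨x, hx, hy⟩ => h x hx y hy⟩

open Classical in
/-- The substitution `[x := t]`. -/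
noncomputable def Subst.single (x : V) (t : L.Term V) : Subst L V :=
  fun y => if y = x then t else Term.var y

lemma Subst.single_self (x : V) (t : L.Term V) : Subst.single x t x = t :=
  if_pos rfl

lemma Subst.single_of_ne (h : y ≠ x) (t : L.Term V) : Subst.single x t y = Term.var y :=
  if_neg h

lemma Subst.single_comp (h : σ x = t.subst σ) : (Subst.single x t).comp σ = σ := by
  funext y
  by_cases hy : y = x
  · rw [hy, Subst.comp, Subst.single_self, h]
  · rw [Subst.comp, Subst.single_of_ne hy, Term.subst]

lemma subst_single_of_notMem (h : x ∉ vars t) (s : L.Term V) :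
    t.subst (Subst.single x s) = t :=
  subst_eq_self fun _ hy => Subst.single_of_ne (ne_of_mem_of_not_mem hy h) s

lemma vars_subst_single_subset (s : L.Term V) :
    vars (s.subst (Subst.single x t)) ⊆ vars s ∪ vars t := by
  intro y hy
  obtain ⟨z, hz, hy⟩ := mem_vars_subst.1 hy
  by_cases hzx : z = x
  · rw [hzx, Subst.single_self] at hy
    exact Or.inr hy
  · rw [Subst.single_of_ne hzx] at hy
    exact Or.inl (mem_vars_var.1 hy ▸ hz)

lemma notMem_vars_subst_single (hx : x ∉ vars t) (s : L.Term V) :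
    x ∉ vars (s.subst (Subst.single x t)) := by
  intro h
  obtain ⟨z, -, hz⟩ := mem_vars_subst.1 h
  by_cases hzx : z = x
  · exact hx (by rwa [hzx, Subst.single_self] at hz)
  · rw [Subst.single_of_ne hzx] at hz
    exact hzx (mem_vars_var.1 hz).symm

open Classical in
/-- The substitution that agrees with `τ` on `A` and is the identity elsewhere. -/
noncomputable def Subst.restrict (τ : Subst L V) (A : Set V) : Subst L V :=
  fun x => if x ∈ A then τ x else Term.var x

lemma Subst.restrict_of_mem {A : Set V} (τ : Subst L V) (h : x ∈ A) : τ.restrict A x = τ x :=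
  if_pos h

lemma Subst.restrict_of_notMem {A : Set V} (τ : Subst L V) (h : x ∉ A) :
    τ.restrict A x = Term.var x :=
  if_neg h

lemma Subst.dom_restrict_subset (τ : Subst L V) (A : Set V) : (τ.restrict A).dom ⊆ A :=
  fun _ hx => of_not_not fun h => hx (τ.restrict_of_notMem h)

end Substitution

section Position

variable {s t : L.Term V} {p : List ℕ}

lemma subtermAt_nil (t : L.Term V) : subtermAt t [] = some t := by
  cases t <;> rfl

lemma replaceAt_nil (t s : L.Term V) : replaceAt t [] s = s := by
  cases t <;> rfl

lemma subtermAt_func {n : ℕ} (f : L.Functions n) (ts : Fin n → L.Term V) (i : Fin n)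
    (p : List ℕ) : subtermAt (Term.func f ts) (i.val :: p) = subtermAt (ts i) p := by
  simp only [subtermAt, i.isLt, ↓reduceDIte]

lemma replaceAt_func {n : ℕ} (f : L.Functions n) (ts : Fin n → L.Term V) (i : Fin n)
    (p : List ℕ) (s : L.Term V) :
    replaceAt (Term.func f ts) (i.val :: p) s =
      Term.func f (Function.update ts i (replaceAt (ts i) p s)) := by
  simp only [replaceAt]
  congr 1
  funext j
  by_cases h : j = i
  · subst h; simp
  · simp [Fin.val_inj, h]

lemma exists_func_of_subtermAt_cons {i : ℕ} (h : subtermAt t (i :: p) = some s) :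
    ∃ (n : ℕ) (f : L.Functions n) (ts : Fin n → L.Term V) (j : Fin n),
      t = Term.func f ts ∧ i = j.val ∧ subtermAt (ts j) p = some s := by
  cases t with
  | var x => cases h
  | @func n f ts =>
    simp only [subtermAt] at h
    split_ifs at h with hi
    exact ⟨n, f, ts, ⟨i, hi⟩, rfl, rfl, h⟩

lemma subtermAt_append (t : L.Term V) (p q : List ℕ) :
    subtermAt t (p ++ q) = (subtermAt t p).bind fun s => subtermAt s q := by
  induction p generalizing t with
  | nil => rw [subtermAt_nil, List.nil_append, Option.bind_some]
  | cons i p ih =>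
    cases t with
    | var x => rfl
    | func f ts =>
      simp only [List.cons_append, subtermAt]
      split_ifs
      · exact ih _
      · rfl

lemma subtermAt_subst (h : subtermAt t p = some s) (σ : Subst L V) :
    subtermAt (t.subst σ) p = some (s.subst σ) := by
  induction p generalizing t with
  | nil =>
    rw [subtermAt_nil] at h ⊢
    rw [Option.some.inj h]
  | cons i p ih =>
    obtain ⟨n, f, ts, j, rfl, rfl, h'⟩ := exists_func_of_subtermAt_cons h
    rw [Term.subst, subtermAt_func]
    exact ih h'

lemma subtermAt_replaceAt (h : subtermAt t p ≠ none) (s : L.Term V) :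
    subtermAt (replaceAt t p s) p = some s := by
  induction p generalizing t with
  | nil => rw [replaceAt_nil, subtermAt_nil]
  | cons i p ih =>
    obtain ⟨t', ht'⟩ := Option.ne_none_iff_exists'.1 h
    obtain ⟨n, f, ts, j, rfl, rfl, h'⟩ := exists_func_of_subtermAt_cons ht'
    rw [replaceAt_func, subtermAt_func, Function.update_self]
    exact ih (Option.ne_none_iff_exists'.2 ⟨t', h'⟩)

lemma replaceAt_self (h : subtermAt t p = some s) : replaceAt t p s = t := by
  induction p generalizing t with
  | nil =>
    rw [subtermAt_nil] at h
    rw [replaceAt_nil, Option.some.inj h]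
  | cons i p ih =>
    obtain ⟨n, f, ts, j, rfl, rfl, h'⟩ := exists_func_of_subtermAt_cons h
    rw [replaceAt_func, ih h', Function.update_eq_self]

lemma replaceAt_subst (h : subtermAt t p ≠ none) (s : L.Term V) (σ : Subst L V) :
    (replaceAt t p s).subst σ = replaceAt (t.subst σ) p (s.subst σ) := by
  induction p generalizing t with
  | nil => simp only [replaceAt_nil]
  | cons i p ih =>
    obtain ⟨t', ht'⟩ := Option.ne_none_iff_exists'.1 h
    obtain ⟨n, f, ts, j, rfl, rfl, h'⟩ := exists_func_of_subtermAt_cons ht'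
    rw [replaceAt_func, Term.subst, Term.subst, replaceAt_func, ← ih (by simp [h'])]
    congr 1
    exact Function.comp_update (fun r => r.subst σ) ts j _

lemma vars_subset_of_subtermAt (h : subtermAt t p = some s) : vars s ⊆ vars t := by
  induction p generalizing t with
  | nil =>
    rw [subtermAt_nil] at h
    rw [Option.some.inj h]
  | cons i p ih =>
    obtain ⟨n, f, ts, j, rfl, rfl, h'⟩ := exists_func_of_subtermAt_cons h
    exact (ih h').trans fun x hx => mem_vars_func.2 ⟨j, hx⟩

lemma vars_replaceAt_subset (t : L.Term V) (p : List ℕ) (s : L.Term V) :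
    vars (replaceAt t p s) ⊆ vars t ∪ vars s := by
  induction p generalizing t with
  | nil => rw [replaceAt_nil]; exact Set.subset_union_right
  | cons i p ih =>
    cases t with
    | var x => exact Set.subset_union_left
    | func f ts =>
      intro x hx
      obtain ⟨j, hj⟩ := mem_vars_func.1 hx
      split_ifs at hj
      · exact (ih (ts j) hj).imp_left fun h => mem_vars_func.2 ⟨j, h⟩
      · exact Or.inl (mem_vars_func.2 ⟨j, hj⟩)

lemma vars_replaceAt_eq_empty (ht : vars t = ∅) (hs : vars s = ∅) (p : List ℕ) :
    vars (replaceAt t p s) = ∅ := by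
  have := vars_replaceAt_subset t p s
  rwa [ht, hs, Set.union_self, Set.subset_empty_iff] at this

lemma exists_subtermAt_var_of_subtermAt_subst {σ : Subst L V}
    (h : subtermAt (t.subst σ) p ≠ none) (ht : subtermAt t p = none) :
    ∃ (q q' : List ℕ) (x : V), p = q ++ q' ∧ subtermAt t q = some (Term.var x) := by
  induction p generalizing t with
  | nil => rw [subtermAt_nil] at ht; cases ht
  | cons i p ih =>
    cases t with
    | var x => exact ⟨[], i :: p, x, rfl, rfl⟩
    | @func n f ts =>
      by_cases hi : i < n
      · simp only [Term.subst, subtermAt, hi, dite_true] at h ht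
        obtain ⟨q, q', x, rfl, hq⟩ := ih h ht
        exact ⟨i :: q, q', x, rfl, by simpa [subtermAt, hi] using hq⟩
      · simp [Term.subst, subtermAt, hi] at h

/-- The most general term that has the function symbols of `t` strictly above `p`; each remaining
subterm is a variable, named by its position through `f`. -/
def skeleton (f : List ℕ → V) : L.Term V → List ℕ → L.Term V
  | _, [] => Term.var (f [])
  | Term.var _, _ :: _ => Term.var (f [])
  | Term.func g ts, i :: p => Term.func g fun j =>
      if j.val = i then skeleton (fun q => f (i :: q)) (ts j) p else Term.var (f [j.val])

lemma vars_skeleton_subset (f : List ℕ → V) (t : L.Term V) (p : List ℕ) :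
    vars (skeleton f t p) ⊆ Set.range f := by
  induction p generalizing f t with
  | nil => cases t <;> exact Set.singleton_subset_iff.2 ⟨_, rfl⟩
  | cons i p ih =>
    cases t with
    | var x => exact Set.singleton_subset_iff.2 ⟨_, rfl⟩
    | func g ts =>
      intro x hx
      obtain ⟨j, hj⟩ := mem_vars_func.1 hx
      split_ifs at hj
      · obtain ⟨q, rfl⟩ := ih _ _ hj
        exact ⟨_, rfl⟩
      · exact ⟨_, (mem_vars_var.1 hj).symm⟩

lemma subtermAt_skeleton (f : List ℕ → V) (h : subtermAt t p ≠ none) :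
    subtermAt (skeleton f t p) p = some (Term.var (f p)) := by
  induction p generalizing f t with
  | nil => cases t <;> rfl
  | cons i p ih =>
    obtain ⟨t', ht'⟩ := Option.ne_none_iff_exists'.1 h
    obtain ⟨n, g, ts, j, rfl, rfl, h'⟩ := exists_func_of_subtermAt_cons ht'
    rw [skeleton, subtermAt_func, if_pos rfl]
    exact ih _ (Option.ne_none_iff_exists'.2 ⟨t', h'⟩)

lemma skeleton_subst_eq (f : List ℕ → V) {θ τ : Subst L V} (h : subtermAt s p ≠ none)
    (hs : s.subst θ = t) (hτ : ∀ q s', subtermAt s q = some s' → τ (f q) = s') :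
    (skeleton f t p).subst τ = s := by
  induction p generalizing f s t with
  | nil => cases t <;> exact hτ [] s (subtermAt_nil s)
  | cons i p ih =>
    obtain ⟨s', hs'⟩ := Option.ne_none_iff_exists'.1 h
    obtain ⟨n, g, ts, j, rfl, rfl, h'⟩ := exists_func_of_subtermAt_cons hs'
    subst hs
    simp only [Term.subst, skeleton]
    congr 1
    funext k
    split_ifs with hk
    · obtain rfl := Fin.ext hk
      exact ih _ (Option.ne_none_iff_exists'.2 ⟨s', h'⟩) rfl fun q t hq =>
        hτ _ _ (by rwa [subtermAt_func])
    · exact hτ [k.val] (ts k) (by rw [subtermAt_func, subtermAt_nil])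

end Position

/-! ## Unification -/

section Unification

variable {E F : Set (L.Term V × L.Term V)} {s t : L.Term V} {x : V} {θ μ : Subst L V}

/-- `θ` is a unifier of the equations in `E`. -/
def Unifies (θ : Subst L V) (E : Set (L.Term V × L.Term V)) : Prop :=
  ∀ e ∈ E, e.1.subst θ = e.2.subst θ

/-- The variables of the equations in `E`. -/
def eqnVars (E : Set (L.Term V × L.Term V)) : Set V := {x | ∃ e ∈ E, x ∈ vars e.1 ∪ vars e.2}

/-- The instances under `σ` of the equations in `E`. -/
def eqnSubst (σ : Subst L V) (E : Set (L.Term V × L.Term V)) : Set (L.Term V × L.Term V) :=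
  Prod.map (·.subst σ) (·.subst σ) '' E

lemma unifies_insert {e : L.Term V × L.Term V} :
    Unifies θ (insert e E) ↔ e.1.subst θ = e.2.subst θ ∧ Unifies θ E :=
  Set.forall_mem_insert

lemma unifies_eqnSubst {σ : Subst L V} : Unifies θ (eqnSubst σ E) ↔ Unifies (σ.comp θ) E := by
  simp only [Unifies, eqnSubst, Set.forall_mem_image, Prod.map_fst, Prod.map_snd, subst_subst]

lemma eqnVars_mono (h : E ⊆ F) : eqnVars E ⊆ eqnVars F :=
  fun _ ⟨e, he, hx⟩ => ⟨e, h he, hx⟩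

lemma eqnVars_insert (e : L.Term V × L.Term V) (E : Set (L.Term V × L.Term V)) :
    eqnVars (insert e E) = vars e.1 ∪ vars e.2 ∪ eqnVars E := by
  ext x
  exact Set.exists_mem_insert

lemma IsMGU.of_equiv (hμ : IsMGU E μ) (hu : ∀ θ, Unifies θ E ↔ Unifies θ F)
    (hv : eqnVars E ⊆ eqnVars F) : IsMGU F μ :=
  ⟨(hu μ).1 hμ.1, fun θ hθ => hμ.2.1 θ ((hu θ).2 hθ), hμ.2.2.1, fun x hx =>
    ⟨hv (hμ.2.2.2 x hx).1, fun _ hy => hv ((hμ.2.2.2 x hx).2 _ hy)⟩⟩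

lemma IsMGU.comp_eq (hμ : IsMGU E μ) (hθ : Unifies θ E) : μ.comp θ = θ := by
  obtain ⟨ρ, rfl⟩ := hμ.2.1 θ hθ
  rw [← Subst.comp_assoc, hμ.2.2.1]

lemma IsMGU.vars_subst_subset (hμ : IsMGU E μ) (t : L.Term V) :
    vars (t.subst μ) ⊆ vars t ∪ eqnVars E := by
  intro y hy
  obtain ⟨x, hx, hy⟩ := mem_vars_subst.1 hy
  by_cases hd : x ∈ μ.dom
  · exact Or.inr ((hμ.2.2.2 x hd).2 y hy)
  · rw [of_not_not hd, mem_vars_var] at hy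
    exact Or.inl (hy ▸ hx)

lemma isMGU_empty : IsMGU (∅ : Set (L.Term V × L.Term V)) Term.var :=
  ⟨by simp, fun θ _ => ⟨θ, rfl⟩, rfl, fun _ hx => absurd rfl hx⟩

lemma IsMGU.insert_refl (hμ : IsMGU E μ) (t : L.Term V) : IsMGU (insert (t, t) E) μ :=
  hμ.of_equiv (fun _ => by simp only [unifies_insert, true_and])
    (eqnVars_mono (Set.subset_insert _ _))

lemma IsMGU.insert_swap (hμ : IsMGU (insert (s, t) E) μ) : IsMGU (insert (t, s) E) μ :=
  hμ.of_equiv (fun _ => by simp only [unifies_insert, eq_comm])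
    (by simp only [eqnVars_insert, Set.union_comm, subset_refl])

lemma IsMGU.insert_func {n : ℕ} {f : L.Functions n} {ts ss : Fin n → L.Term V}
    (hμ : IsMGU (Set.range (fun i => (ts i, ss i)) ∪ E) μ) :
    IsMGU (insert (Term.func f ts, Term.func f ss) E) μ := by
  refine hμ.of_equiv (fun θ => ?_) ?_
  · rw [unifies_insert]
    simp only [Unifies, Set.mem_union, or_imp, forall_and, Set.forall_mem_range, Term.subst,
      Term.func.injEq, heq_eq_eq, true_and, funext_iff]
  · rintro x ⟨e, ⟨i, rfl⟩ | he, hx⟩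
    · exact ⟨_, Set.mem_insert _ _,
        hx.imp (fun h => mem_vars_func.2 ⟨i, h⟩) fun h => mem_vars_func.2 ⟨i, h⟩⟩
    · exact ⟨e, Set.mem_insert_of_mem _ he, hx⟩

lemma eqnVars_eqnSubst_single_subset (x : V) (t : L.Term V) (E : Set (L.Term V × L.Term V)) :
    eqnVars (eqnSubst (Subst.single x t) E) ⊆ eqnVars (insert (Term.var x, t) E) := by
  rintro y ⟨_, ⟨e, he, rfl⟩, hy⟩
  rw [eqnVars_insert]
  rcases hy with hy | hy <;> rcases vars_subst_single_subset _ hy with hy | hy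
  · exact Or.inr ⟨e, he, Or.inl hy⟩
  · exact Or.inl (Or.inr hy)
  · exact Or.inr ⟨e, he, Or.inr hy⟩
  · exact Or.inl (Or.inr hy)

lemma notMem_eqnVars_eqnSubst_single (hx : x ∉ vars t) :
    x ∉ eqnVars (eqnSubst (Subst.single x t) E) := by
  rintro ⟨_, ⟨e, -, rfl⟩, h | h⟩ <;> exact notMem_vars_subst_single hx _ h

lemma IsMGU.comp_single_idem (hx : x ∉ vars t)
    (hμ : IsMGU (eqnSubst (Subst.single x t) E) μ) :
    ((Subst.single x t).comp μ).comp ((Subst.single x t).comp μ) =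
      (Subst.single x t).comp μ := by
  funext y
  have hxy : x ∉ vars ((Subst.single x t y).subst μ) := fun h =>
    (hμ.vars_subst_subset _ h).elim (notMem_vars_subst_single hx (Term.var y))
      (notMem_eqnVars_eqnSubst_single hx)
  calc ((Subst.single x t y).subst μ).subst ((Subst.single x t).comp μ)
      = (((Subst.single x t y).subst μ).subst (Subst.single x t)).subst μ :=
        (subst_subst _ _ _).symm
    _ = (Subst.single x t y).subst (μ.comp μ) := by
        rw [subst_single_of_notMem hxy, subst_subst]
    _ = (Subst.single x t y).subst μ := by rw [hμ.2.2.1]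

lemma IsMGU.insert_var (hx : x ∉ vars t) (hμ : IsMGU (eqnSubst (Subst.single x t) E) μ) :
    IsMGU (insert (Term.var x, t) E) ((Subst.single x t).comp μ) := by
  have hE := eqnVars_eqnSubst_single_subset x t E
  have htE : vars t ⊆ eqnVars (insert (Term.var x, t) E) := fun y hy =>
    ⟨_, Set.mem_insert _ _, Or.inr hy⟩
  refine ⟨unifies_insert.2 ⟨?_, unifies_eqnSubst.1 hμ.1⟩, fun θ hθ => ?_,
    hμ.comp_single_idem hx, fun y hy => ?_⟩
  · rw [← subst_subst, ← subst_subst, Term.subst, Subst.single_self, subst_single_of_notMem hx]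
  · obtain ⟨hxθ, hθ⟩ := unifies_insert.1 hθ
    have hsingle := Subst.single_comp hxθ
    obtain ⟨ρ, hρ⟩ := hμ.2.1 θ (unifies_eqnSubst.2 (by rwa [hsingle]))
    exact ⟨ρ, by rw [Subst.comp_assoc, ← hρ, hsingle]⟩
  · by_cases hyx : y = x
    · subst hyx
      refine ⟨⟨_, Set.mem_insert _ _, Or.inl rfl⟩, fun z hz => ?_⟩
      rw [Subst.comp, Subst.single_self] at hz
      exact (hμ.vars_subst_subset t hz).elim (@htE z) (@hE z)
    · have hμy : (Subst.single x t).comp μ y = μ y := by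
        rw [Subst.comp, Subst.single_of_ne hyx, Term.subst]
      have hyμ := hμ.2.2.2 y fun h => hy (hμy.trans h)
      rw [hμy]
      exact ⟨hE hyμ.1, fun z hz => hE (hyμ.2 z hz)⟩

/-- The number of symbols of a term. It is the termination measure of unification. -/
def size : L.Term V → ℕ
  | .var _ => 1
  | .func _ ts => 1 + ∑ i, size (ts i)

lemma size_pos (t : L.Term V) : 0 < size t := by
  cases t <;> simp [size]

lemma size_lt_size_func {n : ℕ} (f : L.Functions n) (ts : Fin n → L.Term V) (i : Fin n) :
    size (ts i) < size (Term.func f ts) := by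
  rw [size, add_comm]
  exact Nat.lt_succ_of_le (Finset.single_le_sum (f := fun i => size (ts i))
    (fun _ _ => Nat.zero_le _) (Finset.mem_univ i))

lemma size_apply_le_size_subst (hx : x ∈ vars t) (θ : Subst L V) :
    size (θ x) ≤ size (t.subst θ) := by
  induction t with
  | var y => exact (congrArg (fun z => size (θ z)) hx).le
  | func f ts ih =>
    obtain ⟨i, hi⟩ := mem_vars_func.1 hx
    exact (ih i hi).trans (size_lt_size_func f (fun i => (ts i).subst θ) i).le

lemma eq_var_of_mem_vars_of_unifies (hx : x ∈ vars t) (hθ : θ x = t.subst θ) :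
    t = Term.var x := by
  cases t with
  | var y => exact congrArg Term.var (mem_vars_var.1 hx).symm
  | func f ts =>
    obtain ⟨i, hi⟩ := mem_vars_func.1 hx
    have hlt := size_lt_size_func f (fun i => (ts i).subst θ) i
    exact absurd (congrArg size hθ)
      ((size_apply_le_size_subst hi θ).trans_lt hlt).ne

/-- The total size of the left-hand sides of `E` under `θ`. A unifier `θ` is not affected by
eliminating a variable, so that this measure drops in every step of unification. -/
noncomputable def eqnsSize (θ : Subst L V) (E : List (L.Term V × L.Term V)) : ℕ :=
  (E.map fun e => size (e.1.subst θ)).sum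

lemma exists_isMGU_insert_var {E : List (L.Term V × L.Term V)} (hxt : θ x = t.subst θ)
    (hE : Unifies θ {e | e ∈ E})
    (ih : ∀ F, eqnsSize θ F ≤ eqnsSize θ E → Unifies θ {e | e ∈ F} → ∃ μ, IsMGU {e | e ∈ F} μ) :
    ∃ μ, IsMGU (insert (Term.var x, t) {e | e ∈ E}) μ := by
  by_cases hx : x ∈ vars t
  · rw [eq_var_of_mem_vars_of_unifies hx hxt]
    exact (ih E le_rfl hE).imp fun _ hμ => hμ.insert_refl _
  have hθ := Subst.single_comp hxt
  have himage : {e | e ∈ E.map (Prod.map (·.subst (Subst.single x t)) (·.subst (Subst.single x t)))}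
      = eqnSubst (Subst.single x t) {e | e ∈ E} := Set.ext fun _ => List.mem_map
  obtain ⟨μ, hμ⟩ := ih (E.map (Prod.map (·.subst (Subst.single x t)) (·.subst (Subst.single x t))))
    (by simp only [eqnsSize, List.map_map, Function.comp_def, Prod.map_fst, subst_subst, hθ,
      le_refl])
    (by rwa [himage, unifies_eqnSubst, hθ])
  exact ⟨_, (himage ▸ hμ).insert_var hx⟩

lemma exists_isMGU_insert_func {E : List (L.Term V × L.Term V)} {n : ℕ} {f : L.Functions n}
    {ts ss : Fin n → L.Term V} (hargs : ∀ i, (ts i).subst θ = (ss i).subst θ)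
    (hE : Unifies θ {e | e ∈ E})
    (ih : ∀ F, eqnsSize θ F < eqnsSize θ ((Term.func f ts, Term.func f ss) :: E) →
      Unifies θ {e | e ∈ F} → ∃ μ, IsMGU {e | e ∈ F} μ) :
    ∃ μ, IsMGU (insert (Term.func f ts, Term.func f ss) {e | e ∈ E}) μ := by
  have hrange : {e | e ∈ List.ofFn (fun i => (ts i, ss i)) ++ E} =
      Set.range (fun i => (ts i, ss i)) ∪ {e | e ∈ E} :=
    Set.ext fun _ => by simp only [Set.mem_ofPred_eq, List.mem_append, List.mem_ofFn,
      Set.mem_union, Set.mem_range]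
  obtain ⟨μ, hμ⟩ := ih (List.ofFn (fun i => (ts i, ss i)) ++ E)
    (by
      simp only [eqnsSize, List.map_append, List.sum_append, List.map_ofFn, List.sum_ofFn,
        Function.comp_def, List.map_cons, List.sum_cons, Term.subst, size]
      lia)
    (by
      rw [hrange]
      rintro e (⟨i, rfl⟩ | he)
      exacts [hargs i, hE e he])
  exact ⟨μ, (hrange ▸ hμ).insert_func⟩

lemma exists_isMGU_list (E : List (L.Term V × L.Term V)) (hE : Unifies θ {e | e ∈ E}) :
    ∃ μ, IsMGU {e | e ∈ E} μ := by
  induction h : eqnsSize θ E using Nat.strong_induction_on generalizing E with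
  | _ n ih =>
  subst h
  match E with
  | [] => exact ⟨_, by simpa using isMGU_empty⟩
  | (s, t) :: E =>
    have hcons : {e | e ∈ (s, t) :: E} = insert (s, t) {e | e ∈ E} :=
      Set.ext fun _ => List.mem_cons
    rw [hcons] at hE ⊢
    obtain ⟨hst, htail⟩ := unifies_insert.1 hE
    have ihE (F : List (L.Term V × L.Term V)) (hF : eqnsSize θ F ≤ eqnsSize θ E)
        (hθ : Unifies θ {e | e ∈ F}) : ∃ μ, IsMGU {e | e ∈ F} μ :=
      ih _ (hF.trans_lt (Nat.lt_add_of_pos_left (size_pos _))) F hθ rfl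
    match s, t with
    | .var x, t => exact exists_isMGU_insert_var hst htail ihE
    | .func f ts, .var x =>
      exact (exists_isMGU_insert_var hst.symm htail ihE).imp fun _ hμ => hμ.insert_swap
    | .func f ts, .func g ss =>
      simp only [Term.subst, Term.func.injEq] at hst
      obtain ⟨rfl, hfg, hargs⟩ := hst
      obtain rfl := eq_of_heq hfg
      exact exists_isMGU_insert_func (congrFun (eq_of_heq hargs)) htail
        fun F hF hθ => ih _ hF F hθ rfl

lemma exists_isMGU (hfin : E.Finite) (hE : Unifies θ E) : ∃ μ, IsMGU E μ := by
  obtain ⟨F, rfl⟩ := hfin.exists_finset_coe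
  simpa using exists_isMGU_list F.toList (by simpa using hE)

end Unification

/-! ## Literals and orderings -/

section Literal

variable {K : Lit L V}

lemma Lit.exists_eq (K : Lit L V) : ∃ b s t, K = ⟨b, s(s, t)⟩ := by
  rcases K with ⟨b, s, t⟩
  exact ⟨b, s, t, rfl⟩

lemma Lit.comp_comp (K : Lit L V) : K.comp.comp = K := by
  simp only [Lit.comp, Bool.not_not]

lemma Lit.subst_mk (b : Bool) (s t : L.Term V) (σ : Subst L V) :
    Lit.subst ⟨b, s(s, t)⟩ σ = ⟨b, s(s.subst σ, t.subst σ)⟩ := rfl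

lemma Lit.ground_iff : K.Ground ↔ ∀ t ∈ K.eqn, SCLEQ.vars t = ∅ := by
  simp only [Lit.Ground, Lit.vars, Set.eq_empty_iff_forall_notMem, Set.mem_ofPred_eq, not_exists,
    not_and]
  exact ⟨fun h t ht x hx => h x t ht hx, fun h x t ht hx => h t ht x hx⟩

lemma Lit.ground_mk {b : Bool} {s t : L.Term V} :
    Lit.Ground (⟨b, s(s, t)⟩ : Lit L V) ↔ SCLEQ.vars s = ∅ ∧ SCLEQ.vars t = ∅ := by
  simp only [Lit.ground_iff, Sym2.mem_iff, forall_eq_or_imp, forall_eq]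

lemma termMultiset_true (s t : L.Term V) :
    (⟨true, s(s, t)⟩ : Lit L V).termMultiset = {s} + {t} := rfl

lemma termMultiset_false (s t : L.Term V) :
    (⟨false, s(s, t)⟩ : Lit L V).termMultiset = ({s} + {t}) + ({s} + {t}) := rfl

lemma mem_termMultiset {t : L.Term V} : t ∈ K.termMultiset ↔ t ∈ K.eqn := by
  obtain ⟨_ | _, s, s', rfl⟩ := K.exists_eq <;>
  simp only [termMultiset_false, termMultiset_true, Multiset.mem_add, Multiset.mem_singleton,
    Sym2.mem_iff, or_self]

lemma one_lt_card_termMultiset (K : Lit L V) : 1 < Multiset.card K.termMultiset := by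
  obtain ⟨_ | _, s, t, rfl⟩ := K.exists_eq <;>
  simp only [termMultiset_false, termMultiset_true, Multiset.card_add, Multiset.card_singleton] <;>
  norm_num

end Literal

section MultisetExtension

variable {α : Type*} {r : α → α → Prop} {M : Multiset α} {a b : α}

lemma mulExt_singleton_right : MulExt r M {b} ↔ ∀ x ∈ M, r x b := by
  refine ⟨?_, fun h => ⟨M, {b}, 0, Multiset.singleton_ne_zero b, (zero_add M).symm,
    (zero_add _).symm, fun x hx => ⟨b, Multiset.mem_singleton_self b, h x hx⟩⟩⟩
  rintro ⟨X, Y, Z, hY, rfl, hb, hX⟩ x hx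
  have hZ : Z = 0 := by
    have hcard := congrArg Multiset.card hb
    have hpos := Multiset.card_pos.2 hY
    rw [Multiset.card_singleton, Multiset.card_add] at hcard
    exact Multiset.card_eq_zero.1 (by lia)
  rw [hZ, zero_add] at hb hx
  obtain ⟨y, hy, hxy⟩ := hX x hx
  rw [← hb, Multiset.mem_singleton] at hy
  exact hy ▸ hxy

lemma exists_of_mulExt_singleton_left (h : MulExt r {b} M) : ∃ y ∈ M, b = y ∨ r b y := by
  obtain ⟨X, Y, Z, -, h, rfl, hX⟩ := h
  rcases Multiset.mem_add.1 (h ▸ Multiset.mem_singleton_self b) with hb | hb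
  · exact ⟨b, Multiset.mem_add.2 (.inl hb), .inl rfl⟩
  · obtain ⟨y, hy, hby⟩ := hX b hb
    exact ⟨y, Multiset.mem_add.2 (.inr hy), .inr hby⟩

lemma mulExt_singleton_left_of_mem (h : b ∈ M) (hM : 1 < Multiset.card M) : MulExt r {b} M := by
  obtain ⟨N, rfl⟩ := Multiset.exists_cons_of_mem h
  refine ⟨0, N, {b}, ?_, (add_zero _).symm, (Multiset.singleton_add b N).symm,
    fun _ hx => absurd hx (Multiset.notMem_zero _)⟩
  rintro rfl
  exact absurd hM (by simp only [Multiset.cons_zero, Multiset.card_singleton, lt_irrefl,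
    not_false_eq_true])

lemma mulExt_singleton_left_of_rel (h : a ∈ M) (hba : r b a) : MulExt r {b} M :=
  ⟨{b}, M, 0, fun hM => Multiset.notMem_zero a (hM ▸ h), (zero_add _).symm, (zero_add M).symm,
    fun _ hx => ⟨a, h, Multiset.mem_singleton.1 hx ▸ hba⟩⟩

lemma mulExt_cons_of_rel (h : r a b) (M : Multiset α) : MulExt r (a ::ₘ M) (b ::ₘ M) :=
  ⟨{a}, {b}, M, Multiset.singleton_ne_zero b, by rw [add_comm, Multiset.singleton_add],
    by rw [add_comm, Multiset.singleton_add],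
    fun _ hx => ⟨b, Multiset.mem_singleton_self b, Multiset.mem_singleton.1 hx ▸ h⟩⟩

end MultisetExtension

section Ordering

variable {lt : L.Term V → L.Term V → Prop} {K : Lit L V} {s t u β : L.Term V} {p : List ℕ}

lemma IsDesired.irrefl (hlt : IsDesired lt) (t : L.Term V) : ¬ lt t t :=
  hlt.wf.irrefl.irrefl t

lemma IsDesired.not_lt_subterm (hlt : IsDesired lt) (hp : subtermAt u p = some s) :
    ¬ lt u s := by
  induction u using hlt.wf.induction generalizing s with
  | _ u ih =>
    intro h
    have hne : subtermAt u p ≠ none := hp ▸ Option.some_ne_none _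
    have h' := hlt.context _ _ u p hne h
    rw [replaceAt_self hp] at h'
    exact ih _ h' (subtermAt_replaceAt hne u) h'

lemma IsDesired.subterm_eq_or_lt (hlt : IsDesired lt) (hp : subtermAt u p = some s)
    (hu : vars u = ∅) : s = u ∨ lt s u := by
  have hs : vars s = ∅ := Set.subset_empty_iff.1 (hu ▸ vars_subset_of_subtermAt hp)
  rcases hlt.total s u hs hu with h | h | h
  · exact .inr h
  · exact .inl h
  · exact absurd h (hlt.not_lt_subterm hp)

lemma litLtTerm_iff : LitLtTerm lt K β ↔ ∀ t ∈ K.eqn, lt t β := by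
  simp only [LitLtTerm, mulExt_singleton_right, mem_termMultiset]

lemma litLtTerm_mk {b : Bool} : LitLtTerm lt ⟨b, s(s, t)⟩ β ↔ lt s β ∧ lt t β := by
  simp only [litLtTerm_iff, Sym2.mem_iff, forall_eq_or_imp, forall_eq]

lemma clauseLtTerm_iff {C : Clause L V} : ClauseLtTerm lt C β ↔ ∀ K ∈ C, LitLtTerm lt K β := by
  simp only [ClauseLtTerm, mulExt_singleton_right, Multiset.mem_map, forall_exists_index, and_imp,
    forall_apply_eq_imp_iff₂, LitLtTerm]

lemma IsDesired.not_termLtLit (hlt : IsDesired lt) (h : LitLtTerm lt K β) :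
    ¬ TermLtLit lt β K := by
  intro h'
  obtain ⟨y, hy, hβ⟩ := exists_of_mulExt_singleton_left h'
  have hyβ := litLtTerm_iff.1 h y (mem_termMultiset.1 hy)
  rcases hβ with rfl | hβ
  · exact hlt.irrefl _ hyβ
  · exact hlt.irrefl _ (hlt.trans _ _ _ hyβ hβ)

lemma IsDesired.litLtTerm_or_termLtLit (hlt : IsDesired lt) (hK : K.Ground) (hβ : vars β = ∅) :
    LitLtTerm lt K β ∨ TermLtLit lt β K := by
  by_cases h : ∀ t ∈ K.eqn, lt t β
  · exact .inl (litLtTerm_iff.2 h)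
  · push Not at h
    obtain ⟨t, ht, htβ⟩ := h
    have hmem := mem_termMultiset.2 ht
    rcases hlt.total t β (Lit.ground_iff.1 hK t ht) hβ with h | rfl | h
    · exact absurd h htβ
    · exact .inr (mulExt_singleton_left_of_mem hmem (one_lt_card_termMultiset K))
    · exact .inr (mulExt_singleton_left_of_rel hmem h)

lemma litLt_of_lt (h : lt s t) (b : Bool) (u : L.Term V) :
    LitLt lt ⟨b, s(s, u)⟩ ⟨b, s(t, u)⟩ := by
  cases b
  · refine ⟨{s} + {s}, {t} + {t}, {u} + {u}, ?_, ?_, ?_, ?_⟩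
    · exact fun h0 => Multiset.singleton_ne_zero t (add_eq_zero.1 h0).1
    · rw [termMultiset_false]; abel
    · rw [termMultiset_false]; abel
    · intro x hx
      simp only [Multiset.mem_add, Multiset.mem_singleton, or_self] at hx
      exact ⟨t, Multiset.mem_add.2 (.inl (Multiset.mem_singleton_self t)), hx ▸ h⟩
  · exact mulExt_cons_of_rel h {u}

end Ordering

/-! ## Entailment -/

section Realization

variable {M : Type*} [L.Structure M] {a : V → M} {K : Lit L V}

lemma holds_true {s t : L.Term V} :
    Lit.Holds a ⟨true, s(s, t)⟩ ↔ s.realize a = t.realize a := by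
  simp only [Lit.Holds, ↓reduceIte, Sym2.map_mk, Sym2.mk_isDiag_iff]

lemma holds_comp : Lit.Holds a K.comp ↔ ¬ Lit.Holds a K := by
  rcases K with ⟨_ | _, e⟩ <;>
  simp only [Lit.Holds, Lit.comp, Bool.not_true, Bool.not_false, Bool.false_eq_true, ↓reduceIte,
    not_not]

lemma holds_congr {b : Bool} {s t s' t' : L.Term V} (hs : s.realize a = s'.realize a)
    (ht : t.realize a = t'.realize a) :
    Lit.Holds a ⟨b, s(s, t)⟩ ↔ Lit.Holds a ⟨b, s(s', t')⟩ := by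
  simp only [Lit.Holds, Sym2.map_mk, hs, ht]

end Realization

section Entailment

variable {G G' : Set (Lit L V)} {K : Lit L V} {s t u : L.Term V}

lemma Entails.mono (h : G ⊆ G') (hK : Entails G K) : Entails G' K :=
  fun M _ _ a hG => hK M a fun H hH => hG H (h hH)

lemma Entails.of_mem (h : K ∈ G) : Entails G K :=
  fun _ _ _ _ hG => hG K h

lemma Entails.refl (G : Set (Lit L V)) (s : L.Term V) : Entails G ⟨true, s(s, s)⟩ :=
  fun _ _ _ _ _ => holds_true.2 rfl

lemma Entails.symm (h : Entails G ⟨true, s(s, t)⟩) : Entails G ⟨true, s(t, s)⟩ := by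
  rwa [Sym2.eq_swap]

lemma Entails.trans (h : Entails G ⟨true, s(s, t)⟩) (h' : Entails G ⟨true, s(t, u)⟩) :
    Entails G ⟨true, s(s, u)⟩ :=
  fun M _ _ a hG => holds_true.2 ((holds_true.1 (h M a hG)).trans (holds_true.1 (h' M a hG)))

lemma Entails.func {n : ℕ} {f : L.Functions n} {ts ts' : Fin n → L.Term V}
    (h : ∀ i, Entails G ⟨true, s(ts i, ts' i)⟩) :
    Entails G ⟨true, s(Term.func f ts, Term.func f ts')⟩ := by
  intro M _ _ a hG
  rw [holds_true, Term.realize_func, Term.realize_func]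
  exact congrArg _ (funext fun i => holds_true.1 (h i M a hG))

lemma Entails.replaceAt {p : List ℕ} (hp : subtermAt u p = some s)
    (h : Entails G ⟨true, s(t, s)⟩) : Entails G ⟨true, s(SCLEQ.replaceAt u p t, u)⟩ := by
  induction p generalizing u with
  | nil =>
    rw [subtermAt_nil] at hp
    rwa [replaceAt_nil, Option.some.inj hp]
  | cons i p ih =>
    obtain ⟨n, f, ts, j, rfl, rfl, hj⟩ := exists_func_of_subtermAt_cons hp
    rw [replaceAt_func]
    refine Entails.func fun k => ?_
    by_cases hk : k = j
    · rw [hk, Function.update_self]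
      exact ih hj
    · rw [Function.update_of_ne hk]
      exact Entails.refl G _

lemma Defined.mono (h : G ⊆ G') (hK : Defined G K) : Defined G' K :=
  hK.imp (Entails.mono h) (Entails.mono h)

lemma Defined.of_mem (h : K ∈ G) : Defined G K :=
  .inl (Entails.of_mem h)

lemma defined_comp : Defined G K.comp ↔ Defined G K := by
  simp only [Defined, Lit.comp_comp, or_comm]

lemma entails_congr {s' t' : L.Term V} (hs : Entails G ⟨true, s(s, s')⟩)
    (ht : Entails G ⟨true, s(t, t')⟩) (b : Bool) :
    Entails G ⟨b, s(s, t)⟩ ↔ Entails G ⟨b, s(s', t')⟩ :=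
  forall_congr' fun M => forall₄_congr fun _ _ a hG =>
    holds_congr (holds_true.1 (hs M a hG)) (holds_true.1 (ht M a hG))

lemma defined_congr {s' t' : L.Term V} (hs : Entails G ⟨true, s(s, s')⟩)
    (ht : Entails G ⟨true, s(t, t')⟩) (b : Bool) :
    Defined G ⟨b, s(s, t)⟩ ↔ Defined G ⟨b, s(s', t')⟩ :=
  or_congr (entails_congr hs ht b) (entails_congr hs ht !b)

/-- The term algebra with a congruence on it; its quotient is the structure in which an equation
holds exactly if its sides are congruent. -/
abbrev termPrestructure (c : Setoid (L.Term V))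
    (hc : ∀ {n : ℕ} (f : L.Functions n) (ts ts' : Fin n → L.Term V),
      (∀ i, c (ts i) (ts' i)) → c (Term.func f ts) (Term.func f ts')) :
    L.Prestructure c where
  toStructure :=
    { funMap := fun f ts => Term.func f ts
      RelMap := fun _ _ => False }
  fun_equiv := hc _
  rel_equiv := fun _ _ _ => rfl

lemma rel_of_entails (c : Setoid (L.Term V))
    (hc : ∀ {n : ℕ} (f : L.Functions n) (ts ts' : Fin n → L.Term V),
      (∀ i, c (ts i) (ts' i)) → c (Term.func f ts) (Term.func f ts'))
    (hpos : ∀ s t, (⟨true, s(s, t)⟩ : Lit L V) ∈ G → c s t)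
    (hneg : ∀ s t, (⟨false, s(s, t)⟩ : Lit L V) ∈ G → ¬ c s t)
    (h : Entails G ⟨true, s(s, t)⟩) : c s t := by
  let pre := termPrestructure c hc
  let a : V → Quotient c := fun x => ⟦Term.var x⟧
  have realize_eq (u : L.Term V) : u.realize a = ⟦u⟧ := by
    refine (FirstOrder.Language.Term.realize_quotient_mk' c u Term.var).trans (congrArg _ ?_)
    induction u with
    | var x => rfl
    | func f ts ih => exact congrArg (Term.func f) (funext ih)
  have holds_iff (s t : L.Term V) : Lit.Holds a ⟨true, s(s, t)⟩ ↔ c s t := by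
    rw [holds_true, realize_eq, realize_eq, Quotient.eq]
  have : Nonempty (Quotient c) := ⟨⟦s⟧⟩
  refine (holds_iff s t).1 (h (Quotient c) a fun H hH => ?_)
  obtain ⟨_ | _, s', t', rfl⟩ := H.exists_eq
  · exact holds_comp.2 ((holds_iff s' t').not.2 (hneg s' t' hH))
  · exact (holds_iff s' t').2 (hpos s' t' hH)

lemma entails_positive (hG : ∃ K, ¬ Entails G K) (h : Entails G ⟨true, s(s, t)⟩) :
    Entails {K | K ∈ G ∧ K.pos = true} ⟨true, s(s, t)⟩ := by
  let c : Setoid (L.Term V) :=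
    ⟨fun s t => Entails {K | K ∈ G ∧ K.pos = true} ⟨true, s(s, t)⟩,
      Entails.refl _, Entails.symm, Entails.trans⟩
  refine rel_of_entails c (fun f ts ts' => Entails.func)
    (fun s t hst => Entails.of_mem ⟨hst, rfl⟩) (fun s t hst hst' => ?_) h
  obtain ⟨K, hK⟩ := hG
  refine hK fun M _ _ a hM => absurd (hst' M a fun H hH => hM H hH.1) ?_
  exact holds_comp.1 (hM _ hst)

end Entailment

/-! ## Ground rewriting -/

lemma join_of_locally_confluent {α : Type*} {r : α → α → Prop}
    (hwf : WellFounded (Function.swap r))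
    (hloc : ∀ a b c, r a b → r a c → Join (ReflTransGen r) b c) {a b c : α}
    (hb : ReflTransGen r a b) (hc : ReflTransGen r a c) : Join (ReflTransGen r) b c := by
  induction a using hwf.induction generalizing b c with
  | _ a ih =>
    rcases hb.cases_head with rfl | ⟨b', hab, hb⟩
    · exact ⟨c, hc, ReflTransGen.refl⟩
    rcases hc.cases_head with rfl | ⟨c', hac, hc⟩
    · exact ⟨b, ReflTransGen.refl, hb.head hab⟩
    obtain ⟨d, hbd, hcd⟩ := hloc a b' c' hab hac
    obtain ⟨e, hbe, hde⟩ := ih b' hab hb hbd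
    obtain ⟨g, heg, hcg⟩ := ih c' hac (hcd.trans hde) hc
    exact ⟨g, hbe.trans heg, hcg⟩

section Rewriting

variable {lt : L.Term V → L.Term V → Prop} {R : Set (L.Term V × L.Term V)} {s t : L.Term V}
  {p : List ℕ}

/-- All rules are ground. -/
def GroundRules (R : Set (L.Term V × L.Term V)) : Prop :=
  ∀ e ∈ R, vars e.1 = ∅ ∧ vars e.2 = ∅

/-- All rules are oriented by `lt`. -/
def DecreasingRules (lt : L.Term V → L.Term V → Prop) (R : Set (L.Term V × L.Term V)) : Prop :=
  ∀ e ∈ R, lt e.2 e.1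

lemma rewrites_replaceAt {e : L.Term V × L.Term V} (he : e ∈ R)
    (hp : subtermAt s p = some e.1) : Rewrites R s (replaceAt s p e.2) :=
  ⟨e, he, p, Term.var, by rw [subst_var, hp], by rw [subst_var]⟩

lemma rewrites_of_mem (h : (s, t) ∈ R) : Rewrites R s t := by
  simpa only [replaceAt_nil] using rewrites_replaceAt h (subtermAt_nil s)

lemma Rewrites.func {n : ℕ} (f : L.Functions n) (ts : Fin n → L.Term V) (i : Fin n)
    (h : Rewrites R s t) :
    Rewrites R (Term.func f (Function.update ts i s)) (Term.func f (Function.update ts i t)) := by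
  obtain ⟨e, he, p, θ, hp, rfl⟩ := h
  refine ⟨e, he, i.val :: p, θ, ?_, ?_⟩
  · rw [subtermAt_func, Function.update_self, hp]
  · rw [replaceAt_func, Function.update_self, Function.update_idem]

lemma reflTransGen_update {n : ℕ} (f : L.Functions n) (ts : Fin n → L.Term V) (i : Fin n)
    (h : ReflTransGen (Rewrites R) s t) :
    ReflTransGen (Rewrites R) (Term.func f (Function.update ts i s))
      (Term.func f (Function.update ts i t)) :=
  h.lift (fun u => Term.func f (Function.update ts i u)) fun _ _ => Rewrites.func f ts i

lemma reflTransGen_func {n : ℕ} (f : L.Functions n) {ts ts' : Fin n → L.Term V}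
    (h : ∀ i, ReflTransGen (Rewrites R) (ts i) (ts' i)) :
    ReflTransGen (Rewrites R) (Term.func f ts) (Term.func f ts') := by
  suffices ∀ A : Finset (Fin n),
      ReflTransGen (Rewrites R) (Term.func f ts) (Term.func f (A.piecewise ts' ts)) by
    simpa only [Finset.piecewise_univ] using this Finset.univ
  intro A
  induction A using Finset.induction_on with
  | empty => rw [Finset.piecewise_empty]
  | insert i A hi ih =>
    have hstep := reflTransGen_update f (A.piecewise ts' ts) i (h i)
    rw [← Finset.piecewise_insert, ← Finset.piecewise_eq_of_notMem A ts' ts hi,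
      Function.update_eq_self] at hstep
    exact ih.trans hstep

lemma DecreasingRules.lt_of_rewrites (hlt : IsDesired lt) (hR : DecreasingRules lt R)
    (h : Rewrites R s t) : lt t s := by
  obtain ⟨e, he, p, θ, hp, rfl⟩ := h
  have := hlt.context _ _ s p (hp ▸ Option.some_ne_none _) (hlt.subst _ _ θ (hR e he))
  rwa [replaceAt_self hp] at this

lemma DecreasingRules.eq_or_lt (hlt : IsDesired lt) (hR : DecreasingRules lt R)
    (h : ReflTransGen (Rewrites R) s t) : t = s ∨ lt t s := by
  induction h with
  | refl => exact .inl rfl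
  | tail _ h ih =>
    have h' := hR.lt_of_rewrites hlt h
    rcases ih with rfl | ih
    · exact .inr h'
    · exact .inr (hlt.trans _ _ _ h' ih)

lemma DecreasingRules.wellFounded_rewrites (hlt : IsDesired lt) (hR : DecreasingRules lt R) :
    WellFounded (Function.swap (Rewrites R)) :=
  Subrelation.wf (hR.lt_of_rewrites hlt) hlt.wf

lemma exists_isNormalForm (hwf : WellFounded (Function.swap (Rewrites R))) (s : L.Term V) :
    ∃ t, IsNormalForm R t s := by
  induction s using hwf.induction with
  | _ s ih =>
    by_cases h : Irreducible R s
    · exact ⟨s, ReflTransGen.refl, h⟩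
    · simp only [Irreducible, not_forall, not_not] at h
      obtain ⟨t, ht⟩ := h
      obtain ⟨t', htt', ht'⟩ := ih t ht
      exact ⟨t', htt'.head ht, ht'⟩

lemma Irreducible.subtermAt (h : Irreducible R s) (hp : subtermAt s p = some t) :
    Irreducible R t := by
  rintro t' ⟨e, he, q, θ, hq, rfl⟩
  exact h _ ⟨e, he, p ++ q, θ, by rw [subtermAt_append, hp, Option.bind_some, hq], rfl⟩

lemma Irreducible.eq_of_reflTransGen (h : Irreducible R s)
    (hst : ReflTransGen (Rewrites R) s t) : t = s := by
  rcases hst.cases_head with rfl | ⟨u, hu, -⟩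
  · rfl
  · exact absurd hu (h u)

lemma GroundRules.exists_of_rewrites (hR : GroundRules R) (h : Rewrites R s t) :
    ∃ e ∈ R, ∃ p, SCLEQ.subtermAt s p = some e.1 ∧ t = replaceAt s p e.2 := by
  obtain ⟨e, he, p, θ, hp, rfl⟩ := h
  rw [subst_of_ground (hR e he).1] at hp
  exact ⟨e, he, p, hp, by rw [subst_of_ground (hR e he).2]⟩

lemma GroundRules.ground_of_reflTransGen (hR : GroundRules R)
    (h : ReflTransGen (Rewrites R) s t) (hs : vars s = ∅) : vars t = ∅ := by
  induction h with
  | refl => exact hs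
  | tail _ h ih =>
    obtain ⟨e, he, p, -, rfl⟩ := hR.exists_of_rewrites h
    exact vars_replaceAt_eq_empty ih (hR e he).2 p

lemma GroundRules.irreducible_var (hR : GroundRules R) (x : V) :
    Irreducible R (Term.var x) := by
  intro t h
  obtain ⟨e, he, _ | _, hp, -⟩ := hR.exists_of_rewrites h
  · exact Set.notMem_empty x ((hR e he).1 ▸ Option.some.inj hp ▸ mem_vars_var.2 rfl)
  · cases hp

lemma GroundRules.mem_or_exists_of_rewrites_func (hR : GroundRules R) {n : ℕ}
    {f : L.Functions n} {ts : Fin n → L.Term V} (h : Rewrites R (Term.func f ts) t) :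
    (Term.func f ts, t) ∈ R ∨
      ∃ i t', Rewrites R (ts i) t' ∧ t = Term.func f (Function.update ts i t') := by
  obtain ⟨⟨l, r⟩, he, p, hp, rfl⟩ := hR.exists_of_rewrites h
  cases p with
  | nil =>
    rw [subtermAt_nil] at hp
    rw [replaceAt_nil, Option.some.inj hp]
    exact .inl he
  | cons i p =>
    obtain ⟨_, _, _, j, hf, rfl, hj⟩ := exists_func_of_subtermAt_cons hp
    cases hf
    exact .inr ⟨j, _, rewrites_replaceAt he hj, replaceAt_func f ts j p r⟩

lemma join_rewrites_func_update {n : ℕ} (f : L.Functions n) {ts : Fin n → L.Term V}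
    {i j : Fin n} (hij : i ≠ j) (hi : Rewrites R (ts i) s) (hj : Rewrites R (ts j) t) :
    Join (Rewrites R) (Term.func f (Function.update ts i s))
      (Term.func f (Function.update ts j t)) := by
  refine ⟨Term.func f (Function.update (Function.update ts i s) j t), ?_, ?_⟩
  · have := hj.func f (Function.update ts i s) j
    rwa [← Function.update_of_ne hij.symm s ts, Function.update_eq_self] at this
  · have := hi.func f (Function.update ts j t) i
    rwa [← Function.update_of_ne hij t ts, Function.update_eq_self,
      Function.update_comm hij.symm] at this

lemma GroundRules.join_of_rewrites (hR : GroundRules R)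
    (hcrit : ∀ e ∈ R, ∀ t, Rewrites R e.1 t → Join (ReflTransGen (Rewrites R)) t e.2)
    (s a b : L.Term V) (ha : Rewrites R s a) (hb : Rewrites R s b) :
    Join (ReflTransGen (Rewrites R)) a b := by
  induction s generalizing a b with
  | var x => exact absurd ha (hR.irreducible_var x a)
  | func f ts ih =>
    rcases hR.mem_or_exists_of_rewrites_func hb with hb' | ⟨j, b', hj, rfl⟩
    · exact hcrit _ hb' a ha
    rcases hR.mem_or_exists_of_rewrites_func ha with ha' | ⟨i, a', hi, rfl⟩
    · exact Join.symm.symm _ _ (hcrit _ ha' _ hb)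
    by_cases hij : i = j
    · subst hij
      obtain ⟨d, had, hbd⟩ := ih i a' b' hi hj
      exact ⟨_, reflTransGen_update f ts i had, reflTransGen_update f ts i hbd⟩
    · obtain ⟨d, had, hbd⟩ := join_rewrites_func_update f hij hi hj
      exact ⟨d, .single had, .single hbd⟩

end Rewriting

/-! ## Ground superposition -/

section Superposition

variable {lt : L.Term V → L.Term V → Prop} {G : Set (Lit L V)} {s t : L.Term V}

/-- The equations obtained from the positive literals of `G` by ground superposition. They give a
convergent system equivalent to `conv lt G` each of whose rules, unlike those of `conv lt G`, is
derived by rewrite inferences. -/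
inductive Superposed (lt : L.Term V → L.Term V → Prop) (G : Set (Lit L V)) :
    L.Term V → L.Term V → Prop
  | of_mem (s t : L.Term V) : (⟨true, s(s, t)⟩ : Lit L V) ∈ G → Superposed lt G s t
  | symm (s t : L.Term V) : Superposed lt G s t → Superposed lt G t s
  | superpose (l r s t : L.Term V) (p : List ℕ) : Superposed lt G l r → lt r l →
      Superposed lt G s t → subtermAt s p = some l → Superposed lt G (replaceAt s p r) t

/-- The equations of `Superposed lt G` that are oriented by `lt`, as rules. -/
def superposedRules (lt : L.Term V → L.Term V → Prop) (G : Set (Lit L V)) :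
    Set (L.Term V × L.Term V) := {e | Superposed lt G e.1 e.2 ∧ lt e.2 e.1}

lemma Superposed.ground (hG : ∀ K ∈ G, Lit.Ground K) (h : Superposed lt G s t) :
    vars s = ∅ ∧ vars t = ∅ := by
  induction h with
  | of_mem s t h => exact Lit.ground_mk.1 (hG _ h)
  | symm s t _ ih => exact ih.symm
  | superpose l r s t p _ _ _ _ ih ih' => exact ⟨vars_replaceAt_eq_empty ih'.1 ih.2 p, ih'.2⟩

lemma groundRules_superposedRules (hG : ∀ K ∈ G, Lit.Ground K) :
    GroundRules (superposedRules lt G) :=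
  fun _ he => he.1.ground hG

lemma decreasingRules_superposedRules : DecreasingRules lt (superposedRules lt G) :=
  fun _ he => he.2

lemma groundRules_conv : GroundRules (conv lt G) :=
  fun _ he => ⟨he.1, he.2.1⟩

lemma decreasingRules_conv : DecreasingRules lt (conv lt G) :=
  fun _ he => he.2.2.1

lemma Superposed.entails (h : Superposed lt G s t) :
    Entails {K | K ∈ G ∧ K.pos = true} ⟨true, s(s, t)⟩ := by
  induction h with
  | of_mem s t h => exact Entails.of_mem ⟨h, rfl⟩
  | symm s t _ ih => exact ih.symm
  | superpose l r s t p _ _ _ hp ih ih' => exact (Entails.replaceAt hp ih.symm).trans ih'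

lemma superposedRules_subset_conv (hG : ∀ K ∈ G, Lit.Ground K) :
    superposedRules lt G ⊆ conv lt G :=
  fun _ he => ⟨(he.1.ground hG).1, (he.1.ground hG).2, he.2, he.1.entails⟩

lemma Superposed.join (hlt : IsDesired lt) (hG : ∀ K ∈ G, Lit.Ground K)
    (h : Superposed lt G s t) : Join (ReflTransGen (Rewrites (superposedRules lt G))) s t := by
  rcases hlt.total s t (h.ground hG).1 (h.ground hG).2 with hst | rfl | hst
  · exact ⟨s, .refl, .single (rewrites_of_mem ⟨h.symm, hst⟩)⟩
  · exact ⟨s, .refl, .refl⟩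
  · exact ⟨t, .single (rewrites_of_mem ⟨h, hst⟩), .refl⟩

lemma join_superposedRules_of_rewrites (hlt : IsDesired lt) (hG : ∀ K ∈ G, Lit.Ground K)
    (s a b : L.Term V) (ha : Rewrites (superposedRules lt G) s a)
    (hb : Rewrites (superposedRules lt G) s b) :
    Join (ReflTransGen (Rewrites (superposedRules lt G))) a b := by
  have hground := groundRules_superposedRules (lt := lt) hG
  refine hground.join_of_rewrites (fun e he t ht => ?_) s a b ha hb
  obtain ⟨e', he', p, hp, rfl⟩ := hground.exists_of_rewrites ht
  exact (Superposed.superpose _ _ _ _ p he'.1 he'.2 he.1 hp).join hlt hG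

lemma join_superposedRules_of_entails (hlt : IsDesired lt) (hG : ∀ K ∈ G, Lit.Ground K)
    (h : Entails {K | K ∈ G ∧ K.pos = true} ⟨true, s(s, t)⟩) :
    Join (ReflTransGen (Rewrites (superposedRules lt G))) s t := by
  have hwf := (decreasingRules_superposedRules (G := G)).wellFounded_rewrites hlt
  let c : Setoid (L.Term V) := ⟨Join (ReflTransGen (Rewrites (superposedRules lt G))),
    equivalence_join fun _ _ _ =>
      join_of_locally_confluent hwf (join_superposedRules_of_rewrites hlt hG)⟩
  refine rel_of_entails c (fun f ts ts' hts => ?_)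
    (fun s t hst => (Superposed.of_mem s t hst.1).join hlt hG)
    (fun s t hst => absurd hst.2 Bool.false_ne_true) h
  choose d hd hd' using hts
  exact ⟨Term.func f d, reflTransGen_func f hd, reflTransGen_func f hd'⟩

lemma irreducible_conv (hlt : IsDesired lt) (hG : ∀ K ∈ G, Lit.Ground K)
    (h : Irreducible (superposedRules lt G) s) : Irreducible (conv lt G) s := by
  intro s' hs'
  obtain ⟨⟨l, r⟩, ⟨-, -, hrl, hlr⟩, p, hp, rfl⟩ := groundRules_conv.exists_of_rewrites hs'
  obtain ⟨d, hld, hrd⟩ := join_superposedRules_of_entails hlt hG hlr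
  obtain rfl := (h.subtermAt hp).eq_of_reflTransGen hld
  rcases decreasingRules_superposedRules.eq_or_lt hlt hrd with rfl | hlr
  · exact hlt.irrefl _ hrl
  · exact hlt.irrefl _ (hlt.trans _ _ _ hrl hlr)

lemma entails_of_reflTransGen_conv (h : ReflTransGen (Rewrites (conv lt G)) s t) :
    Entails G ⟨true, s(s, t)⟩ := by
  induction h with
  | refl => exact Entails.refl _ _
  | tail _ h ih =>
    obtain ⟨e, he, p, hp, rfl⟩ := groundRules_conv.exists_of_rewrites h
    have hlr := he.2.2.2.mono fun _ hK => hK.1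
    exact ih.trans (Entails.replaceAt hp hlr.symm).symm

end Superposition

/-! ## Variants and fresh variables -/

section

variable {K : Lit L V} {C : Clause L V} {σ τ : Subst L V} {x y : V} {A B : Set V}

lemma Lit.mem_vars_mk {b : Bool} {s t : L.Term V} :
    x ∈ Lit.vars (⟨b, s(s, t)⟩ : Lit L V) ↔ x ∈ SCLEQ.vars s ∨ x ∈ SCLEQ.vars t := by
  simp only [Lit.vars, Sym2.mem_iff, Set.mem_ofPred_eq, exists_eq_or_imp, exists_eq_left]

lemma Lit.finite_vars (K : Lit L V) : K.vars.Finite := by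
  obtain ⟨b, s, t, rfl⟩ := K.exists_eq
  exact ((SCLEQ.finite_vars s).union (SCLEQ.finite_vars t)).subset fun x hx => Lit.mem_vars_mk.1 hx

lemma Lit.subst_subst (K : Lit L V) (σ τ : Subst L V) :
    (K.subst σ).subst τ = K.subst (σ.comp τ) := by
  obtain ⟨b, s, t, rfl⟩ := K.exists_eq
  simp only [Lit.subst_mk, SCLEQ.subst_subst]

lemma Lit.subst_congr (h : ∀ x ∈ K.vars, σ x = τ x) : K.subst σ = K.subst τ := by
  obtain ⟨b, s, t, rfl⟩ := K.exists_eq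
  rw [Lit.subst_mk, Lit.subst_mk,
    SCLEQ.subst_congr fun x hx => h x (Lit.mem_vars_mk.2 (Or.inl hx)),
    SCLEQ.subst_congr fun x hx => h x (Lit.mem_vars_mk.2 (Or.inr hx))]

lemma Lit.mem_vars_subst : y ∈ (K.subst σ).vars ↔ ∃ x ∈ K.vars, y ∈ SCLEQ.vars (σ x) := by
  obtain ⟨b, s, t, rfl⟩ := K.exists_eq
  simp only [Lit.subst_mk, Lit.mem_vars_mk, SCLEQ.mem_vars_subst, or_and_right, exists_or]

lemma Lit.exists_of_subst_eq {b : Bool} {s t : L.Term V} (h : K.subst σ = ⟨b, s(s, t)⟩) :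
    ∃ s' t', K = ⟨b, s(s', t')⟩ ∧ s'.subst σ = s ∧ t'.subst σ = t := by
  obtain ⟨b', s', t', rfl⟩ := K.exists_eq
  rw [Lit.subst_mk, Lit.mk.injEq, Sym2.eq_iff] at h
  obtain ⟨rfl, ⟨hs, ht⟩ | ⟨hs, ht⟩⟩ := h
  · exact ⟨s', t', rfl, hs, ht⟩
  · exact ⟨t', s', by rw [Sym2.eq_swap], ht, hs⟩

lemma Clause.finite_vars (C : Clause L V) : (Clause.vars C).Finite := by
  have hC : Clause.vars C = ⋃ K ∈ {K | K ∈ C}, Lit.vars K := by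
    ext x
    simp only [Clause.vars, Set.mem_ofPred_eq, Set.mem_iUnion, exists_prop]
  rw [hC]
  exact C.finite_toSet.biUnion fun K _ => K.finite_vars

lemma Clause.mem_vars_subst :
    y ∈ Clause.vars (Clause.subst C σ) ↔ ∃ x ∈ Clause.vars C, y ∈ SCLEQ.vars (σ x) := by
  constructor
  · rintro ⟨K, hK, hy⟩
    obtain ⟨H, hH, rfl⟩ := Multiset.mem_map.1 hK
    obtain ⟨x, hx, hy⟩ := Lit.mem_vars_subst.1 hy
    exact ⟨x, ⟨H, hH, hx⟩, hy⟩
  · rintro ⟨x, ⟨K, hK, hx⟩, hy⟩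
    exact ⟨K.subst σ, Multiset.mem_map_of_mem _ hK, Lit.mem_vars_subst.2 ⟨x, hx, hy⟩⟩

lemma Closure.vars_lit_subset (c : Closure L V) : c.lit.vars ⊆ c.vars :=
  fun _ hx => ⟨c.lit, Multiset.mem_cons_self _ _, hx⟩

lemma Closure.vars_subset_of_lit_eq {c : Closure L V} {b : Bool} {s t : L.Term V}
    (h : c.lit = ⟨b, s(s, t)⟩) : SCLEQ.vars s ⊆ c.vars ∧ SCLEQ.vars t ⊆ c.vars := by
  have hc := c.vars_lit_subset
  rw [h] at hc
  exact ⟨fun x hx => hc (Lit.mem_vars_mk.2 (Or.inl hx)),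
    fun x hx => hc (Lit.mem_vars_mk.2 (Or.inr hx))⟩

lemma subst_eq_self_of_disjoint {t : L.Term V} (hσ : σ.dom ⊆ A) (h : Disjoint (vars t) A) :
    t.subst σ = t :=
  subst_eq_self fun _ hx => by_contra fun hne => Set.disjoint_left.1 h hx (hσ hne)

lemma exists_perm_avoiding [Infinite V] (hA : A.Finite) (hB : B.Finite) :
    ∃ π : Equiv.Perm V, ∀ x ∈ B, π x ∉ A := by
  classical
  induction B, hB using Set.Finite.induction_on with
  | empty => exact ⟨Equiv.refl V, fun x hx => hx.elim⟩
  | @insert x B hx hB ih =>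
    obtain ⟨π, hπ⟩ := ih
    obtain ⟨y, hy⟩ := (hA.union (hB.image π)).exists_notMem
    simp only [Set.mem_union, Set.mem_image, not_or, not_exists, not_and] at hy
    refine ⟨π.trans (Equiv.swap (π x) y), fun z hz => ?_⟩
    rcases hz with rfl | hz
    · rw [Equiv.trans_apply, Equiv.swap_apply_left]
      exact hy.1
    · have hne : π z ≠ π x := fun h => hx (π.injective h ▸ hz)
      rw [Equiv.trans_apply, Equiv.swap_apply_of_ne_of_ne hne (hy.2 z hz)]
      exact hπ z hz

lemma exists_isVariant [Infinite V] (c : Closure L V) (hA : A.Finite) :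
    ∃ c' : Closure L V, IsVariant c c' ∧ Disjoint c'.vars A ∧ c'.glit = c.glit := by
  obtain ⟨π, hπ⟩ := exists_perm_avoiding hA (Clause.finite_vars c.clause)
  let ren : Subst L V := fun x => Term.var (π x)
  have hvars : Clause.vars (Clause.subst c.clause ren) = π '' c.vars := by
    ext y
    simp only [Clause.mem_vars_subst, ren, mem_vars_var, Set.mem_image, Closure.vars, eq_comm]
  let sub : Subst L V := Subst.restrict (fun y => c.sub (π.symm y)) (π '' c.vars)
  have hsub : ∀ x ∈ c.vars, sub (π x) = c.sub x := fun x hx => by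
    simp only [sub, Subst.restrict_of_mem _ (Set.mem_image_of_mem π hx), Equiv.symm_apply_apply]
  let c' : Closure L V := ⟨c.lit.subst ren, Clause.subst c.rest ren, sub⟩
  have hc' : c'.vars = π '' c.vars := by
    rw [← hvars, Closure.clause, Clause.subst, Multiset.map_cons]
    rfl
  refine ⟨c', ⟨π, rfl, rfl, hsub, ?_⟩, ?_, ?_⟩
  · rw [hc']
    exact Subst.dom_restrict_subset _ _
  · rw [hc', Set.disjoint_left]
    rintro _ ⟨x, hx, rfl⟩
    exact hπ x hx
  · change (c.lit.subst ren).subst sub = c.lit.subst c.sub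
    rw [Lit.subst_subst]
    exact Lit.subst_congr fun x hx => hsub x (c.vars_lit_subset hx)

lemma IsVariant.dom_subset {c c' : Closure L V} (h : IsVariant c c') : c'.sub.dom ⊆ c'.vars :=
  h.choose_spec.2.2.2

lemma exists_injective_avoiding [Infinite V] (hA : A.Finite) :
    ∃ f : List ℕ → V, Function.Injective f ∧ ∀ q, f q ∉ A := by
  have : Infinite (Aᶜ : Set V) := hA.infinite_compl.to_subtype
  let g := Infinite.natEmbedding (Aᶜ : Set V)
  exact ⟨fun q => g (Encodable.encode q),
    fun q q' h => Encodable.encode_injective (g.injective (Subtype.ext h)), fun q => (g _).2⟩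

end

/-! ## Lifting of ground rewrite steps -/

/-- The side conditions on `δ` and `ρ` in a rewrite inference into the literal `s # t`, instantiated
by `τ`, at a position `p` that lies below a variable: `δ` gives the most general instance in which
`p` is a position of `s`, and `ρ` instantiates the fresh variables, those outside of `A`. -/
structure IsPositionExtension (A : Set V) (s t : L.Term V) (τ : Subst L V) (p : List ℕ)
    (δ ρ : Subst L V) : Prop where
  dom_subset : δ.dom ⊆ vars s ∪ vars t
  fresh : ∀ x ∈ δ.dom, Disjoint (vars (δ x)) A
  position : subtermAt (s.subst δ) p ≠ none
  left_inst : ((s.subst δ).subst τ).subst ρ = s.subst τ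
  right_inst : ((t.subst δ).subst τ).subst ρ = t.subst τ
  dom_inst : ρ.dom ⊆ (vars (s.subst δ) ∪ vars (t.subst δ)) \ A
  mostGeneral : ∀ θ : Subst L V, subtermAt (s.subst θ) p ≠ none →
    (∃ ρ' : Subst L V, (s.subst θ).subst ρ' = s.subst τ ∧ (t.subst θ).subst ρ' = t.subst τ) →
    ∃ ρ' : Subst L V, s.subst θ = (s.subst δ).subst ρ' ∧ t.subst θ = (t.subst δ).subst ρ'

/-- The instantiation of the variables `f q` of a skeleton by the subterms of `t`, extended by `φ`
to the variables outside of the range of `f`. -/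
noncomputable def subtermSubst (f : List ℕ → V) (t : L.Term V) (φ : Subst L V) : Subst L V :=
  Function.extend f (fun q => (subtermAt t q).getD t) φ

section

variable {f : List ℕ → V} {s t u : L.Term V} {p : List ℕ} {x : V} {A : Set V}
  {σ τ θ φ : Subst L V}

lemma skeleton_subst_subtermSubst (hf : Function.Injective f) (φ : Subst L V)
    (hp : subtermAt s p ≠ none) (hs : s.subst θ = t) :
    (skeleton f t p).subst (subtermSubst f s φ) = s :=
  skeleton_subst_eq f hp hs fun q s' hq => by
    rw [subtermSubst, hf.extend_apply, hq, Option.getD_some]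

lemma subst_eq_single_skeleton_subst (hf : Function.Injective f) (hfA : ∀ q, f q ∉ A)
    (hp : subtermAt (θ x) p ≠ none) (hθ : (θ x).subst σ = t) (hu : vars u ⊆ A) :
    u.subst θ =
      (u.subst (Subst.single x (skeleton f t p))).subst (subtermSubst f (θ x) θ) := by
  rw [subst_subst]
  refine subst_congr fun y hy => ?_
  by_cases hyx : y = x
  · subst hyx
    rw [Subst.comp, Subst.single_self, skeleton_subst_subtermSubst hf θ hp hθ]
  · rw [Subst.comp, Subst.single_of_ne hyx, Term.subst, subtermSubst, Function.extend_apply']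
    rintro ⟨q, rfl⟩
    exact hfA q (hu hy)

lemma subst_single_skeleton_inst (hf : Function.Injective f) (hfA : ∀ q, f q ∉ A)
    (hτ : τ.dom ⊆ A) (hp : subtermAt (τ x) p ≠ none) (hu : vars (u.subst τ) = ∅) :
    ((u.subst (Subst.single x (skeleton f (τ x) p))).subst τ).subst
      ((subtermSubst f (τ x) Term.var).restrict (vars (skeleton f (τ x) p))) = u.subst τ := by
  rw [subst_subst, subst_subst]
  refine subst_congr fun y hy => ?_
  by_cases hyx : y = x
  · subst hyx
    have hdisj : Disjoint (vars (skeleton f (τ y) p)) A := Set.disjoint_left.2 fun z hz => by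
      obtain ⟨q, rfl⟩ := vars_skeleton_subset f _ _ hz
      exact hfA q
    rw [Subst.comp, Subst.single_self, ← subst_subst, subst_eq_self_of_disjoint hτ hdisj,
      subst_congr fun z hz => Subst.restrict_of_mem _ hz,
      skeleton_subst_subtermSubst hf _ hp (subst_var _)]
  · rw [Subst.comp, Subst.single_of_ne hyx, Term.subst, Subst.comp,
      subst_of_ground (vars_subst_eq_empty.1 hu y hy)]

lemma exists_isPositionExtension [Infinite V] (hA : A.Finite) (hs : vars s ⊆ A) (ht : vars t ⊆ A)
    (hτ : τ.dom ⊆ A) (hsτ : vars (s.subst τ) = ∅) (htτ : vars (t.subst τ) = ∅)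
    (hp : subtermAt (s.subst τ) p ≠ none) (hps : subtermAt s p = none) :
    ∃ δ ρ, IsPositionExtension A s t τ p δ ρ := by
  obtain ⟨q, q', x, rfl, hq⟩ := exists_subtermAt_var_of_subtermAt_subst hp hps
  have hxs : x ∈ vars s := vars_subset_of_subtermAt hq rfl
  have hpos : ∀ θ : Subst L V, subtermAt (s.subst θ) (q ++ q') = subtermAt (θ x) q' := fun θ => by
    rw [subtermAt_append, subtermAt_subst hq θ, Option.bind_some, Term.subst]
  rw [hpos] at hp
  obtain ⟨f, hf, hfA⟩ := exists_injective_avoiding hA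
  set g := skeleton f (τ x) q'
  have hδx : Subst.single x g x = g := Subst.single_self x g
  have hdom : ∀ y ∈ (Subst.single x g).dom, y = x := fun y hy =>
    by_contra fun h => hy (Subst.single_of_ne h g)
  have hgA : Disjoint (vars g) A := Set.disjoint_left.2 fun y hy => by
    obtain ⟨k, rfl⟩ := vars_skeleton_subset f _ _ hy
    exact hfA k
  refine ⟨Subst.single x g, (subtermSubst f (τ x) Term.var).restrict (vars g), ?_⟩
  exact {
    dom_subset := fun y hy => hdom y hy ▸ Or.inl hxs
    fresh := fun y hy => by rwa [hdom y hy, hδx]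
    position := by
      rw [hpos, hδx, subtermAt_skeleton f hp]
      exact Option.some_ne_none _
    left_inst := subst_single_skeleton_inst hf hfA hτ hp hsτ
    right_inst := subst_single_skeleton_inst hf hfA hτ hp htτ
    dom_inst := fun y hy => by
      have hyg := Subst.dom_restrict_subset _ _ hy
      exact ⟨Or.inl (mem_vars_subst.2 ⟨x, hxs, hδx.symm ▸ hyg⟩), Set.disjoint_left.1 hgA hyg⟩
    mostGeneral := by
      rintro θ hθ ⟨ρ', hρ', -⟩
      rw [hpos] at hθ
      rw [subst_subst] at hρ'
      have hθx : (θ x).subst ρ' = τ x := eqOn_vars_of_subst_eq hρ' hxs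
      exact ⟨_, subst_eq_single_skeleton_subst hf hfA hθ hθx hs,
        subst_eq_single_skeleton_subst hf hfA hθ hθx ht⟩ }

lemma exists_isMGU_replaceAt {l : L.Term V} (hp : subtermAt u p = some s)
    (hθ : subtermAt (u.subst θ) p = some (l.subst θ)) :
    ∃ μ, IsMGU {(s, l)} μ ∧ ∀ (b : Bool) (r t : L.Term V),
      Lit.subst (Lit.subst ⟨b, s(replaceAt u p r, t)⟩ μ) θ =
        ⟨b, s(replaceAt (u.subst θ) p (r.subst θ), t.subst θ)⟩ := by
  have hsl : s.subst θ = l.subst θ := Option.some.inj ((subtermAt_subst hp θ).symm.trans hθ)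
  have hunif : Unifies θ {(s, l)} := by
    rintro _ rfl
    exact hsl
  have hpu : subtermAt u p ≠ none := hp ▸ Option.some_ne_none _
  obtain ⟨μ, hμ⟩ := exists_isMGU (Set.finite_singleton _) hunif
  refine ⟨μ, hμ, fun b r t => ?_⟩
  rw [Lit.subst_subst, hμ.comp_eq hunif, Lit.subst_mk, replaceAt_subst hpu]

end

section

variable {lt : L.Term V → L.Term V → Prop} {I₁ I₂ : RStep L V} {c₁ c₂ : Closure L V} {b : Bool}
  {l r s t : L.Term V} {p : List ℕ}

lemma exists_isRewriteInference_of_position (hv₁ : IsVariant I₁.closure c₁)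
    (hv₂ : IsVariant I₂.closure c₂) (hdisj : Disjoint c₁.vars c₂.vars)
    (h₁ : c₁.lit = ⟨true, s(l, r)⟩) (h₂ : c₂.lit = ⟨b, s(s, t)⟩) (hg₁ : c₁.glit.Ground)
    (hlr : lt (r.subst c₁.sub) (l.subst c₁.sub))
    (hp : subtermAt (s.subst c₂.sub) p = some (l.subst c₁.sub)) (hps : subtermAt s p ≠ none) :
    ∃ I₃, IsRewriteInference lt I₁ I₂ I₃ ∧ I₃.closure.glit =
      ⟨b, s(replaceAt (s.subst c₂.sub) p (r.subst c₁.sub), t.subst c₂.sub)⟩ := by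
  obtain ⟨u, hu⟩ := Option.ne_none_iff_exists'.1 hps
  rw [Closure.glit, h₁, Lit.subst_mk, Lit.ground_mk] at hg₁
  have hfst : ∀ w : L.Term V, vars (w.subst c₁.sub) = ∅ →
      w.subst (c₁.sub.comp c₂.sub) = w.subst c₁.sub := fun w hw => by
    rw [← subst_subst, subst_of_ground hw]
  have hsnd : ∀ w : L.Term V, vars w ⊆ c₂.vars →
      w.subst (c₁.sub.comp c₂.sub) = w.subst c₂.sub := fun w hw => by
    rw [← subst_subst, subst_eq_self_of_disjoint hv₁.dom_subset (hdisj.symm.mono_left hw)]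
  have hst := Closure.vars_subset_of_lit_eq h₂
  obtain ⟨μ, hμ, hglit⟩ := exists_isMGU_replaceAt (l := l) (θ := c₁.sub.comp c₂.sub) hu
    (by rw [hsnd s hst.1, hfst l hg₁.1, hp])
  refine ⟨_, ⟨c₁, c₂, hv₁, hv₂, hdisj, l, r, s, t, b, p, h₁, h₂, hlr, hp,
    Or.inl ⟨u, μ, hu, hμ, rfl⟩⟩, (hglit b r t).trans ?_⟩
  rw [hsnd s hst.1, hsnd t hst.2, hfst r hg₁.2]

lemma exists_isRewriteInference_of_positionExtension {δ ρ : Subst L V}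
    (hv₁ : IsVariant I₁.closure c₁) (hv₂ : IsVariant I₂.closure c₂)
    (hdisj : Disjoint c₁.vars c₂.vars) (h₁ : c₁.lit = ⟨true, s(l, r)⟩)
    (h₂ : c₂.lit = ⟨b, s(s, t)⟩) (hg₁ : c₁.glit.Ground)
    (hlr : lt (r.subst c₁.sub) (l.subst c₁.sub))
    (hp : subtermAt (s.subst c₂.sub) p = some (l.subst c₁.sub)) (hps : subtermAt s p = none)
    (hδ : IsPositionExtension (c₁.vars ∪ c₂.vars) s t c₂.sub p δ ρ) :
    ∃ I₃, IsRewriteInference lt I₁ I₂ I₃ ∧ I₃.closure.glit =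
      ⟨b, s(replaceAt (s.subst c₂.sub) p (r.subst c₁.sub), t.subst c₂.sub)⟩ := by
  obtain ⟨u, hu⟩ := Option.ne_none_iff_exists'.1 hδ.position
  rw [Closure.glit, h₁, Lit.subst_mk, Lit.ground_mk] at hg₁
  have hfst : ∀ w : L.Term V, vars (w.subst c₁.sub) = ∅ →
      w.subst ((c₁.sub.comp c₂.sub).comp ρ) = w.subst c₁.sub := fun w hw => by
    rw [← subst_subst, ← subst_subst, subst_of_ground hw, subst_of_ground hw]
  have hsnd : ∀ w : L.Term V, vars w ⊆ c₂.vars →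
      ((w.subst δ).subst c₂.sub).subst ρ = w.subst c₂.sub →
      (w.subst δ).subst ((c₁.sub.comp c₂.sub).comp ρ) = w.subst c₂.sub := fun w hw hinst => by
    have hwδ : Disjoint (vars (w.subst δ)) c₁.vars := Set.disjoint_left.2 fun y hy => by
      obtain ⟨z, hz, hyz⟩ := mem_vars_subst.1 hy
      by_cases hzδ : z ∈ δ.dom
      · exact fun h => Set.disjoint_left.1 (hδ.fresh z hzδ) hyz (Or.inl h)
      · rw [show δ z = Term.var z from not_not.1 hzδ, mem_vars_var] at hyz
        exact fun h => Set.disjoint_left.1 hdisj h (hyz ▸ hw hz)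
    rw [← subst_subst, ← subst_subst, subst_eq_self_of_disjoint hv₁.dom_subset hwδ, hinst]
  have hst := Closure.vars_subset_of_lit_eq h₂
  obtain ⟨μ, hμ, hglit⟩ := exists_isMGU_replaceAt (l := l) (θ := (c₁.sub.comp c₂.sub).comp ρ) hu
    (by rw [hsnd s hst.1 hδ.left_inst, hfst l hg₁.1, hp])
  refine ⟨_, ⟨c₁, c₂, hv₁, hv₂, hdisj, l, r, s, t, b, p, h₁, h₂, hlr, hp,
    Or.inr ⟨hps, δ, ρ, μ, u, hδ.dom_subset, hδ.fresh, hu, hδ.left_inst, hδ.right_inst,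
      hδ.dom_inst, hδ.mostGeneral, hμ, rfl⟩⟩, (hglit b r (t.subst δ)).trans ?_⟩
  rw [hsnd s hst.1 hδ.left_inst, hsnd t hst.2 hδ.right_inst, hfst r hg₁.2]

lemma exists_isRewriteInference [Infinite V] (h₁ : I₁.closure.glit = ⟨true, s(l, r)⟩)
    (h₂ : I₂.closure.glit = ⟨b, s(s, t)⟩) (hg₁ : I₁.closure.glit.Ground)
    (hg₂ : I₂.closure.glit.Ground) (hlr : lt r l) (hp : subtermAt s p = some l) :
    ∃ I₃, IsRewriteInference lt I₁ I₂ I₃ ∧ I₃.closure.glit = ⟨b, s(replaceAt s p r, t)⟩ := by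
  obtain ⟨c₂, hv₂, -, hc₂⟩ := exists_isVariant I₂.closure (Set.finite_empty (α := V))
  obtain ⟨c₁, hv₁, hdisj, hc₁⟩ := exists_isVariant I₁.closure (Clause.finite_vars c₂.clause)
  rw [← hc₁] at h₁ hg₁
  rw [← hc₂] at h₂ hg₂
  obtain ⟨l', r', hl', rfl, rfl⟩ := Lit.exists_of_subst_eq h₁
  obtain ⟨s', t', hs', rfl, rfl⟩ := Lit.exists_of_subst_eq h₂
  by_cases hps : subtermAt s' p = none
  · have hst := Closure.vars_subset_of_lit_eq hs'
    rw [h₂, Lit.ground_mk] at hg₂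
    obtain ⟨δ, ρ, hδ⟩ := exists_isPositionExtension (p := p)
      ((Clause.finite_vars c₁.clause).union (Clause.finite_vars c₂.clause))
      (hst.1.trans Set.subset_union_right) (hst.2.trans Set.subset_union_right)
      (hv₂.dom_subset.trans Set.subset_union_right) hg₂.1 hg₂.2 (hp ▸ Option.some_ne_none _) hps
    exact exists_isRewriteInference_of_positionExtension hv₁ hv₂ hdisj hl' hs' hg₁ hlr hp hps hδ
  · exact exists_isRewriteInference_of_position hv₁ hv₂ hdisj hl' hs' hg₁ hlr hp hps

end

/-! ## Reduction chains -/

/-- The rewrite steps that can be derived from the closures in `S`, by a derivation tree instead of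
a list of steps. -/
inductive Derivable (lt : L.Term V → L.Term V → Prop) (S : Set (Closure L V)) : RStep L V → Prop
  | leaf (c : Closure L V) : c ∈ S → Derivable lt S (RStep.leaf c)
  | infer (I₁ I₂ I₃ : RStep L V) : Derivable lt S I₁ → Derivable lt S I₂ →
      IsRewriteInference lt I₁ I₂ I₃ → Derivable lt S I₃

section

variable {lt : L.Term V → L.Term V → Prop} {S : Set (Closure L V)} {P : List (RStep L V)}
  {I : RStep L V} {G : Set (Lit L V)} {Γ : Trail L V} {c : Closure L V} {s t : L.Term V}

lemma IsChain.concat (hP : IsChain lt S P)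
    (hI : (∃ c ∈ S, I = RStep.leaf c) ∨ ∃ I₁ ∈ P, ∃ I₂ ∈ P, IsRewriteInference lt I₁ I₂ I) :
    IsChain lt S (P ++ [I]) := by
  have hlen : P.length ≤ (P ++ [I]).length := by
    rw [List.length_append]
    exact Nat.le_add_right _ _
  have hget : ∀ (j : ℕ) (hj : j < P.length), (P ++ [I]).get ⟨j, hj.trans_le hlen⟩ = P[j] :=
    fun j hj => List.getElem_append_left hj
  rintro ⟨i, hi⟩
  rw [List.length_append, List.length_singleton] at hi
  by_cases hiP : i < P.length
  · rw [hget i hiP]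
    refine (hP ⟨i, hiP⟩).imp id ?_
    rintro ⟨j, k, hji, hki, h⟩
    exact ⟨⟨j, j.2.trans_le hlen⟩, ⟨k, k.2.trans_le hlen⟩, hji, hki,
      by rwa [hget j j.2, hget k k.2]⟩
  · obtain rfl : i = P.length := by omega
    rw [List.get_eq_getElem, List.getElem_concat_length rfl]
    refine hI.imp id ?_
    rintro ⟨I₁, h₁, I₂, h₂, h⟩
    obtain ⟨j, hj, rfl⟩ := List.mem_iff_getElem.1 h₁
    obtain ⟨k, hk, rfl⟩ := List.mem_iff_getElem.1 h₂
    exact ⟨⟨j, hj.trans_le hlen⟩, ⟨k, hk.trans_le hlen⟩, hj, hk, by rwa [hget j hj, hget k hk]⟩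

lemma Derivable.exists_isChain_append (h : Derivable lt S I) (hP : IsChain lt S P) :
    ∃ Q, IsChain lt S (P ++ Q ++ [I]) := by
  induction h generalizing P with
  | leaf c hc => exact ⟨[], (List.append_nil P).symm ▸ hP.concat (Or.inl ⟨c, hc, rfl⟩)⟩
  | infer I₁ I₂ I₃ _ _ h ih₁ ih₂ =>
    obtain ⟨Q₁, hQ₁⟩ := ih₁ hP
    obtain ⟨Q₂, hQ₂⟩ := ih₂ hQ₁
    refine ⟨Q₁ ++ [I₁] ++ Q₂ ++ [I₂], ?_⟩
    simp only [← List.append_assoc]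
    refine hQ₂.concat (Or.inr ⟨I₁, ?_, I₂, ?_, h⟩)
    · simp only [List.mem_append, List.mem_singleton, true_or, or_true]
    · simp only [List.mem_append, List.mem_singleton, or_true]

lemma Derivable.exists_isChain (h : Derivable lt S I) :
    ∃ P, IsChain lt S P ∧ P.getLast? = some I := by
  obtain ⟨Q, hQ⟩ := h.exists_isChain_append (P := []) fun i => i.elim0
  exact ⟨_, hQ, List.getLast?_concat⟩

lemma Superposed.exists_derivable [Infinite V] (hG : ∀ K ∈ G, Lit.Ground K)
    (hS : ∀ K ∈ G, ∃ c ∈ S, Closure.glit c = K) (h : Superposed lt G s t) :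
    ∃ I, Derivable lt S I ∧ I.closure.glit = ⟨true, s(s, t)⟩ := by
  induction h with
  | of_mem s t h =>
    obtain ⟨c, hc, hcl⟩ := hS _ h
    exact ⟨_, Derivable.leaf c hc, hcl⟩
  | symm s t _ ih => rwa [Sym2.eq_swap]
  | superpose l r s t p h hlt h' hp ih ih' =>
    obtain ⟨I₁, hI₁, h₁⟩ := ih
    obtain ⟨I₂, hI₂, h₂⟩ := ih'
    obtain ⟨I₃, h₃, hI₃⟩ := exists_isRewriteInference h₁ h₂ (h₁ ▸ Lit.ground_mk.2 (h.ground hG))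
      (h₂ ▸ Lit.ground_mk.2 (h'.ground hG)) hlt hp
    exact ⟨I₃, Derivable.infer _ _ _ hI₁ hI₂ h₃, hI₃⟩

lemma Derivable.exists_of_reflTransGen [Infinite V] {b : Bool} {s' : L.Term V}
    (hG : ∀ K ∈ G, Lit.Ground K) (hS : ∀ K ∈ G, ∃ c ∈ S, Closure.glit c = K)
    (hs : vars s = ∅) (ht : vars t = ∅)
    (h : ReflTransGen (Rewrites (superposedRules lt G)) s s')
    (hI : ∃ I, Derivable lt S I ∧ I.closure.glit = ⟨b, s(s, t)⟩) :
    ∃ I, Derivable lt S I ∧ I.closure.glit = ⟨b, s(s', t)⟩ := by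
  have hR := groundRules_superposedRules (lt := lt) hG
  induction h with
  | refl => exact hI
  | tail hab hbc ih =>
    obtain ⟨I₂, hI₂, h₂⟩ := ih
    obtain ⟨e, he, p, hp, rfl⟩ := hR.exists_of_rewrites hbc
    obtain ⟨I₁, hI₁, h₁⟩ := he.1.exists_derivable hG hS
    obtain ⟨I₃, h₃, hI₃⟩ := exists_isRewriteInference h₁ h₂
      (h₁ ▸ Lit.ground_mk.2 (he.1.ground hG))
      (h₂ ▸ Lit.ground_mk.2 ⟨hR.ground_of_reflTransGen hab hs, ht⟩) he.2 hp
    exact ⟨I₃, Derivable.infer _ _ _ hI₁ hI₂ h₃, hI₃⟩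

lemma exists_derivable_isLitNormalForm [Infinite V] (hlt : IsDesired lt)
    (hΓ : ∀ K ∈ Trail.lits Γ, Lit.Ground K) (hc : c.glit.Ground) :
    ∃ I, Derivable lt (leafSet Γ c) I ∧
      IsLitNormalForm (conv lt (Trail.lits Γ)) I.closure.glit c.glit := by
  obtain ⟨b, s, t, hst⟩ := c.glit.exists_eq
  rw [hst, Lit.ground_mk] at hc
  have hS : ∀ K ∈ Trail.lits Γ, ∃ d ∈ leafSet Γ c, Closure.glit d = K := by
    rintro K ⟨a, ha, rfl⟩
    exact ⟨a.closure, Or.inr ⟨a, ha, rfl⟩, rfl⟩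
  have hwf := decreasingRules_superposedRules (lt := lt) (G := Trail.lits Γ)
    |>.wellFounded_rewrites hlt
  obtain ⟨s', hs, hs'⟩ := exists_isNormalForm hwf s
  obtain ⟨t', ht, ht'⟩ := exists_isNormalForm hwf t
  have hI := Derivable.exists_of_reflTransGen hΓ hS hc.1 hc.2 hs
    ⟨RStep.leaf c, Derivable.leaf c (Or.inl rfl), hst⟩
  rw [Sym2.eq_swap] at hI
  have hgs' := (groundRules_superposedRules hΓ).ground_of_reflTransGen hs hc.1
  obtain ⟨I, hI, hIg⟩ := Derivable.exists_of_reflTransGen hΓ hS hc.2 hgs' ht hI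
  have hmono : ∀ u v, Rewrites (superposedRules lt (Trail.lits Γ)) u v →
      Rewrites (conv lt (Trail.lits Γ)) u v := fun u v ⟨e, he, h⟩ =>
    ⟨e, superposedRules_subset_conv hΓ he, h⟩
  exact ⟨I, hI, b, s, t, s', t', hst, hIg.trans (by rw [Sym2.eq_swap]),
    ⟨ReflTransGen.mono hmono _ _ hs, irreducible_conv hlt hΓ hs'⟩,
    ⟨ReflTransGen.mono hmono _ _ ht, irreducible_conv hlt hΓ ht'⟩⟩

lemma ReducesTo.exists_isReductionChainApp (h : ReducesTo lt Γ c P) :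
    ∃ P, IsReductionChainApp lt Γ c P := by
  induction hn : P.length using Nat.strong_induction_on generalizing P with
  | _ n ih =>
    by_cases hmin : ∀ i < P.length, ¬ ReducesTo lt Γ c (P.eraseIdx i)
    · exact ⟨P, h, hmin⟩
    · push Not at hmin
      obtain ⟨i, hi, h'⟩ := hmin
      exact ih _ (by rw [List.length_eraseIdx_of_lt hi]; omega) h' rfl

lemma exists_isReductionChainApp [Infinite V] (hlt : IsDesired lt)
    (hΓ : ∀ K ∈ Trail.lits Γ, Lit.Ground K) (hc : c.glit.Ground) :
    ∃ P I, IsReductionChainApp lt Γ c P ∧ P.getLast? = some I := by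
  obtain ⟨I, hI, hIc⟩ := exists_derivable_isLitNormalForm hlt hΓ hc
  obtain ⟨P, hP, hPI⟩ := hI.exists_isChain
  obtain ⟨P', hP'⟩ := ReducesTo.exists_isReductionChainApp ⟨hP, I, hPI, hIc⟩
  obtain ⟨I', hI', -⟩ := hP'.1.2
  exact ⟨P', I', hP', hI'⟩

end

/-! ## An invariant of regular runs -/

section

variable {lt : L.Term V → L.Term V → Prop} {N U : Set (Clause L V)} {β : L.Term V}
  {Γ : Trail L V} {a : AnnLit L V} {G G' : Set (Lit L V)} {K K' : Lit L V} {σ : Subst L V}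

/-- The ground instances below `β` of the unit equations in `N` are entailed by `G`: the property
that the first decision of a regular run establishes for the trail. -/
def UnitsEntailed (lt : L.Term V → L.Term V → Prop) (N : Set (Clause L V)) (β : L.Term V)
    (G : Set (Lit L V)) : Prop :=
  ∀ l r : L.Term V, ({⟨true, s(l, r)⟩} : Clause L V) ∈ N → ∀ σ : Subst L V,
    Lit.Ground (Lit.subst ⟨true, s(l, r)⟩ σ) → LitLtTerm lt (Lit.subst ⟨true, s(l, r)⟩ σ) β →
    Entails G (Lit.subst ⟨true, s(l, r)⟩ σ)

/-- A regular run may append `a` to the trail `Γ`: the properties of `a` that Propagate and Decide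
guarantee. -/
structure Appendable (lt : L.Term V → L.Term V → Prop) (N : Set (Clause L V)) (β : L.Term V)
    (Γ : Trail L V) (a : AnnLit L V) : Prop where
  ground : a.glit.Ground
  undefined : ¬ Defined (Trail.lits Γ) a.glit
  irreducible : ∀ t ∈ a.glit.eqn, Irreducible (conv lt (Trail.lits Γ)) t
  level : a.level = Trail.lastLevel Γ ∨ a.level = Trail.lastLevel Γ + 1
  units : 0 < a.level → UnitsEntailed lt N β (Trail.lits Γ)

/-- The trail invariant of regular runs: each literal was appendable to the prefix before it. -/
def TrailInv (lt : L.Term V → L.Term V → Prop) (N : Set (Clause L V)) (β : L.Term V)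
    (Γ : Trail L V) : Prop :=
  ∀ (Γ₁ : Trail L V) (a : AnnLit L V) (Γ₂ : Trail L V), Γ = Γ₁ ++ a :: Γ₂ →
    Appendable lt N β Γ₁ a

/-- The state invariant of regular runs: the trail invariant, and the decision level is the level
of the last trail literal. -/
structure StateInv (lt : L.Term V → L.Term V → Prop) (S : State L V) : Prop where
  ground : vars S.β = ∅
  trail : TrailInv lt S.N S.β S.trail
  level : S.k = Trail.lastLevel S.trail

lemma UnitsEntailed.mono (hG : G ⊆ G') (h : UnitsEntailed lt N β G) : UnitsEntailed lt N β G' :=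
  fun l r hlr σ hσ hβ => (h l r hlr σ hσ hβ).mono hG

lemma lits_nil : Trail.lits ([] : Trail L V) = ∅ := by
  simp only [Trail.lits, List.not_mem_nil, false_and, exists_false, Set.ofPred_false]

lemma lits_snoc (Γ : Trail L V) (a : AnnLit L V) :
    Trail.lits (Γ ++ [a]) = insert a.glit (Trail.lits Γ) := by
  ext K
  simp only [Trail.lits, List.mem_append, List.mem_singleton, Set.mem_insert_iff,
    Set.mem_ofPred_eq, or_and_right, exists_or, exists_eq_left, eq_comm (a := K), or_comm]

lemma lastLevel_snoc (Γ : Trail L V) (a : AnnLit L V) : Trail.lastLevel (Γ ++ [a]) = a.level := by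
  simp only [Trail.lastLevel, List.getLast?_concat, Option.map_some, Option.getD_some]

lemma trailInv_nil : TrailInv lt N β [] :=
  fun _ _ _ h => absurd h.symm (List.append_ne_nil_of_right_ne_nil _ (List.cons_ne_nil _ _))

lemma TrailInv.snoc (h : TrailInv lt N β Γ) (ha : Appendable lt N β Γ a) :
    TrailInv lt N β (Γ ++ [a]) := by
  intro Γ₁ b Γ₂ he
  rcases List.eq_nil_or_concat Γ₂ with rfl | ⟨Γ₃, c, rfl⟩
  · obtain ⟨rfl, hab⟩ := List.append_inj' he rfl
    obtain rfl := List.singleton_inj.1 hab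
    exact ha
  · rw [List.concat_eq_append, ← List.cons_append, ← List.append_assoc] at he
    exact h _ _ _ (List.append_inj' he rfl).1

lemma TrailInv.of_append {Δ : Trail L V} (h : TrailInv lt N β (Γ ++ Δ)) : TrailInv lt N β Γ := by
  rintro Γ₁ a Γ₂ rfl
  exact h Γ₁ a (Γ₂ ++ Δ) (by rw [List.append_assoc, List.cons_append])

lemma TrailInv.ground (h : TrailInv lt N β Γ) : ∀ K ∈ Trail.lits Γ, Lit.Ground K := by
  rintro _ ⟨a, ha, rfl⟩
  obtain ⟨Γ₁, Γ₂, rfl⟩ := List.append_of_mem ha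
  exact (h _ _ _ rfl).ground

lemma TrailInv.unitsEntailed (h : TrailInv lt N β Γ) (hΓ : 0 < Trail.lastLevel Γ) :
    UnitsEntailed lt N β (Trail.lits Γ) := by
  rcases List.eq_nil_or_concat Γ with rfl | ⟨Γ', a, rfl⟩
  · exact absurd hΓ (lt_irrefl 0)
  · rw [List.concat_eq_append] at h hΓ ⊢
    rw [lastLevel_snoc] at hΓ
    rw [lits_snoc]
    exact ((h Γ' a [] rfl).units hΓ).mono (Set.subset_insert _ _)

lemma exists_not_entails_empty [Nonempty V] : ∃ K : Lit L V, ¬ Entails ∅ K := by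
  obtain ⟨x⟩ := ‹Nonempty V›
  refine ⟨⟨false, s(Term.var x, Term.var x)⟩, fun h => ?_⟩
  let _ : L.Structure PUnit.{max u w + 1} :=
    { funMap := fun _ _ => PUnit.unit
      RelMap := fun _ _ => False }
  exact h PUnit (fun _ => PUnit.unit) (fun _ hH => hH.elim) rfl

lemma not_entails_insert_comp (hK : ¬ Defined G K) : ¬ Entails (insert K G) K.comp := by
  refine fun h => hK (Or.inr fun M _ _ a hG => ?_)
  by_contra hc
  exact hc (h M a (Set.forall_mem_insert.2 ⟨not_not.1 (mt holds_comp.2 hc), hG⟩))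

lemma TrailInv.exists_not_entails [Nonempty V] (h : TrailInv lt N β Γ) :
    ∃ K, ¬ Entails (Trail.lits Γ) K := by
  rcases List.eq_nil_or_concat Γ with rfl | ⟨Γ', a, rfl⟩
  · rw [lits_nil]
    exact exists_not_entails_empty
  · rw [List.concat_eq_append] at h ⊢
    rw [lits_snoc]
    exact ⟨_, not_entails_insert_comp (h Γ' a [] rfl).undefined⟩

lemma IsLitNormalForm.ground_and_not_defined_and_irreducible
    (h : IsLitNormalForm (conv lt G) K' K) (hK : K.Ground) (hu : ¬ Defined G K) :
    K'.Ground ∧ ¬ Defined G K' ∧ ∀ t ∈ K'.eqn, Irreducible (conv lt G) t := by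
  obtain ⟨b, s, t, s', t', rfl, rfl, hs, ht⟩ := h
  rw [Lit.ground_mk] at hK ⊢
  refine ⟨⟨groundRules_conv.ground_of_reflTransGen hs.1 hK.1,
    groundRules_conv.ground_of_reflTransGen ht.1 hK.2⟩, ?_, Sym2.ball.2 ⟨hs.2, ht.2⟩⟩
  rwa [← defined_congr (entails_of_reflTransGen_conv hs.1) (entails_of_reflTransGen_conv ht.1)]

lemma IsReductionChainApp.isLitNormalForm {c : Closure L V} {P : List (RStep L V)}
    {I : RStep L V} (h : IsReductionChainApp lt Γ c P) (hI : P.getLast? = some I) :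
    IsLitNormalForm (conv lt (Trail.lits Γ)) I.closure.glit c.glit := by
  obtain ⟨-, I', hI', hnf⟩ := h.1
  obtain rfl := Option.some.inj (hI.symm.trans hI')
  exact hnf

lemma IsDesired.not_defined_of_bUndef (hlt : IsDesired lt) (h : BUndef lt Γ β K)
    (hK : LitLtTerm lt K β) : ¬ Defined (Trail.lits Γ) K :=
  h.resolve_left (hlt.not_termLtLit hK)

lemma Lit.subst_var (K : Lit L V) : K.subst Term.var = K := by
  obtain ⟨b, s, t, rfl⟩ := K.exists_eq
  rw [Lit.subst_mk, SCLEQ.subst_var, SCLEQ.subst_var]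

lemma clause_subst_singleton : Clause.subst ({K} : Clause L V) σ = {K.subst σ} :=
  Multiset.map_singleton _ _

lemma grounding_singleton :
    Grounding σ ({K} : Clause L V) ↔ σ.dom.Finite ∧ (K.subst σ).Ground := by
  simp only [Grounding, Clause.Ground, clause_subst_singleton, Multiset.mem_singleton,
    forall_eq]

lemma exists_irreducible_subst {R : Set (L.Term V × L.Term V)}
    (hwf : WellFounded (Function.swap (Rewrites R))) (σ : Subst L V) (A : Set V) :
    ∃ τ : Subst L V, τ.dom ⊆ A ∧ SubstIrreducible R τ ∧
      ∀ x ∈ A, ReflTransGen (Rewrites R) (σ x) (τ x) := by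
  choose nf hnf using exists_isNormalForm hwf
  have hτ : ∀ x ∈ A, Subst.restrict (fun x => nf (σ x)) A x = nf (σ x) := fun x =>
    Subst.restrict_of_mem _
  refine ⟨_, Subst.dom_restrict_subset (fun x => nf (σ x)) A, fun x hx => ?_, fun x hx => ?_⟩
  · rw [hτ x (Subst.dom_restrict_subset _ A hx)]
    exact (hnf _).2
  · rw [hτ x hx]
    exact (hnf _).1

lemma reflTransGen_subst {R : Set (L.Term V × L.Term V)} {t : L.Term V} {τ : Subst L V}
    (h : ∀ x ∈ vars t, ReflTransGen (Rewrites R) (σ x) (τ x)) :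
    ReflTransGen (Rewrites R) (t.subst σ) (t.subst τ) := by
  induction t with
  | var x => exact h x (mem_vars_var.2 rfl)
  | func f ts ih =>
    exact reflTransGen_func f fun i => ih i fun x hx => h x (mem_vars_func.2 ⟨i, hx⟩)

lemma applicable_conflict {D : Clause L V} {k : ℕ} (hD : D ∈ N ∪ U) (hσ : Grounding σ D)
    (hf : ClauseBFalse lt Γ β (Clause.subst D σ))
    (hirr : SubstIrreducible (conv lt (Trail.lits Γ)) σ) :
    Applicable lt Rule.conflict ⟨Γ, N, U, β, k, Status.top⟩ := by
  by_cases h0 : ClauseHasLevel Γ (Clause.subst D σ) 0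
  · exact ⟨_, Step.conflictBot Γ N U β k D σ hD hσ hf hirr h0⟩
  · exact ⟨_, Step.conflict Γ N U β k D σ hD hσ hf hirr h0⟩

lemma applicable_propagate_singleton [Infinite V] (hlt : IsDesired lt)
    (hΓ : ∀ H ∈ Trail.lits Γ, Lit.Ground H) {k : ℕ} (hK : {K} ∈ N ∪ U) (hσ : Grounding σ {K})
    (hu : ¬ Defined (Trail.lits Γ) (K.subst σ)) (hβ : LitLtTerm lt (K.subst σ) β)
    (hirr : SubstIrreducible (conv lt (Trail.lits Γ)) σ) :
    Applicable lt Rule.propagate ⟨Γ, N, U, β, k, Status.top⟩ := by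
  obtain ⟨b, s, t, rfl⟩ := K.exists_eq
  obtain ⟨P, I, hP, hI⟩ := exists_isReductionChainApp hlt hΓ
    (c := ⟨Lit.subst ⟨b, s(s, t)⟩ Term.var, Clause.subst 0 Term.var, σ⟩)
    (by rw [Lit.subst_var]; exact (grounding_singleton.1 hσ).2)
  refine ⟨_, Step.propagate Γ N U β k 0 0 b s t σ Term.var P I hK hσ
    (fun _ h => absurd h (Multiset.notMem_zero _)) (fun _ h => absurd h (Multiset.notMem_zero _))
    ?_ (Or.inr hu) ?_ hirr hP hI⟩
  · simpa only [Multiset.notMem_zero, false_and, exists_false, Set.ofPred_false]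
      using isMGU_empty
  · rw [clauseLtTerm_iff, Multiset.cons_zero, clause_subst_singleton, Lit.subst_var,
      clause_subst_singleton]
    exact fun H hH => Multiset.mem_singleton.1 hH ▸ hβ

lemma entails_subst_of_not_applicable [Infinite V] (hlt : IsDesired lt)
    (hΓ : ∀ H ∈ Trail.lits Γ, Lit.Ground H) {k : ℕ}
    (hc : ¬ Applicable lt Rule.conflict ⟨Γ, N, U, β, k, Status.top⟩)
    (hp : ¬ Applicable lt Rule.propagate ⟨Γ, N, U, β, k, Status.top⟩)
    (hK : {K} ∈ N) (hσ : Grounding σ {K}) (hβ : LitLtTerm lt (K.subst σ) β)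
    (hirr : SubstIrreducible (conv lt (Trail.lits Γ)) σ) :
    Entails (Trail.lits Γ) (K.subst σ) := by
  by_contra ht
  by_cases hf : Entails (Trail.lits Γ) (K.subst σ).comp
  · refine hc (applicable_conflict (Or.inl hK) hσ ?_ hirr)
    rw [clause_subst_singleton]
    exact fun H hH => Multiset.mem_singleton.1 hH ▸ ⟨hβ, hf⟩
  · exact hp (applicable_propagate_singleton hlt hΓ (Or.inl hK) hσ (not_or.2 ⟨ht, hf⟩) hβ hirr)

lemma unitsEntailed_of_not_applicable [Infinite V] (hlt : IsDesired lt)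
    (hΓ : ∀ H ∈ Trail.lits Γ, Lit.Ground H) {k : ℕ}
    (hc : ¬ Applicable lt Rule.conflict ⟨Γ, N, U, β, k, Status.top⟩)
    (hp : ¬ Applicable lt Rule.propagate ⟨Γ, N, U, β, k, Status.top⟩) :
    UnitsEntailed lt N β (Trail.lits Γ) := by
  intro l r hlr σ hg hβ
  rw [Lit.subst_mk] at hg hβ ⊢
  rw [Lit.ground_mk] at hg
  rw [litLtTerm_mk] at hβ
  obtain ⟨τ, hdom, hirr, hστ⟩ := exists_irreducible_subst
    (decreasingRules_conv (G := Trail.lits Γ).wellFounded_rewrites hlt) σ (vars l ∪ vars r)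
  have hl := reflTransGen_subst fun x hx => hστ x (Or.inl hx)
  have hr := reflTransGen_subst fun x hx => hστ x (Or.inr hx)
  have below : ∀ {s t : L.Term V}, ReflTransGen (Rewrites (conv lt (Trail.lits Γ))) s t →
      lt s β → lt t β := fun h hs => by
    rcases decreasingRules_conv.eq_or_lt hlt h with rfl | h
    · exact hs
    · exact hlt.trans _ _ _ h hs
  have hτ : Grounding τ ({⟨true, s(l, r)⟩} : Clause L V) :=
    grounding_singleton.2 ⟨((finite_vars l).union (finite_vars r)).subset hdom,
      Lit.ground_mk.2 ⟨groundRules_conv.ground_of_reflTransGen hl hg.1,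
        groundRules_conv.ground_of_reflTransGen hr hg.2⟩⟩
  have hent := entails_subst_of_not_applicable hlt hΓ hc hp hlr hτ
    (litLtTerm_mk.2 ⟨below hl hβ.1, below hr hβ.2⟩) hirr
  exact ((entails_of_reflTransGen_conv hl).trans hent).trans
    (entails_of_reflTransGen_conv hr).symm

lemma TrailInv.snoc_of_isReductionChainApp (hT : TrailInv lt N β Γ) {c d : Closure L V} {k : ℕ}
    {P : List (RStep L V)} {I : RStep L V} (hP : IsReductionChainApp lt Γ c P)
    (hI : P.getLast? = some I) (hd : d.glit = I.closure.glit) (hc : c.glit.Ground)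
    (hu : ¬ Defined (Trail.lits Γ) c.glit)
    (hk : k = Trail.lastLevel Γ ∨ k = Trail.lastLevel Γ + 1)
    (hunits : 0 < k → UnitsEntailed lt N β (Trail.lits Γ)) :
    TrailInv lt N β (Γ ++ [⟨d, k⟩]) := by
  obtain ⟨hg, hu', hirr⟩ :=
    (hP.isLitNormalForm hI).ground_and_not_defined_and_irreducible hc hu
  rw [← hd] at hg hu' hirr
  exact hT.snoc ⟨hg, hu', hirr, hk, hunits⟩

lemma subst_subst_of_isMGU {s t : L.Term V} {C : Multiset (L.Term V × L.Term V)}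
    {μ : Subst L V} (hC : ∀ e ∈ C, e.1.subst σ = s.subst σ ∧ e.2.subst σ = t.subst σ)
    (hμ : IsMGU {d | ∃ e ∈ C, d = (e.1, s) ∨ d = (e.2, t)} μ) (K : Lit L V) :
    (K.subst μ).subst σ = K.subst σ := by
  rw [Lit.subst_subst, hμ.comp_eq]
  rintro _ ⟨e, he, rfl | rfl⟩
  · exact (hC e he).1
  · exact (hC e he).2

lemma Step.stateInv [Infinite V] (hlt : IsDesired lt) {ρ : Rule} {S S' : State L V}
    (h : Step lt ρ S S') (hS : StateInv lt S)
    (hc : ρ = Rule.decide → ¬ Applicable lt Rule.conflict S)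
    (hp : ρ = Rule.decide → S.k = 0 → ¬ Applicable lt Rule.propagate S) : StateInv lt S' := by
  obtain ⟨hβ, hT, hk⟩ := hS
  cases h with
  | propagate Γ N U β k C₀ C₁ b s t σ μ P I _ hσ _ hC₁ hμ hu hltβ _ hP hI =>
    have hlit : Closure.glit ⟨Lit.subst ⟨b, s(s, t)⟩ μ, Clause.subst C₀ μ, σ⟩ =
        Lit.subst ⟨b, s(s, t)⟩ σ := subst_subst_of_isMGU hC₁ hμ _
    have hbelow := clauseLtTerm_iff.1 hltβ _ (Multiset.mem_map_of_mem _
      (Multiset.mem_map_of_mem _ (Multiset.mem_cons_self _ _)))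
    refine ⟨hβ, hT.snoc_of_isReductionChainApp hP hI rfl ?_ ?_ (Or.inl hk)
      fun h => hT.unitsEntailed (hk ▸ h), (lastLevel_snoc Γ ⟨_, k⟩).symm⟩
    · rw [hlit]
      exact hσ.2 _ (Multiset.mem_map_of_mem _ (Multiset.mem_cons_self _ _))
    · exact hlt.not_defined_of_bUndef (hlit.symm ▸ hu) hbelow
  | decide Γ N U β k C₀ K σ P I _ hσ _ hu hltβ _ hP hI =>
    have hbelow := clauseLtTerm_iff.1 hltβ _
      (Multiset.mem_map_of_mem _ (Multiset.mem_cons_self _ _))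
    refine ⟨hβ, hT.snoc_of_isReductionChainApp hP hI rfl
      (hσ.2 _ (Multiset.mem_map_of_mem _ (Multiset.mem_cons_self _ _)))
      (hlt.not_defined_of_bUndef hu hbelow) (Or.inr (congrArg (· + 1) hk)) fun _ => ?_,
      (lastLevel_snoc Γ ⟨_, k + 1⟩).symm⟩
    rcases Nat.eq_zero_or_pos k with h0 | h0
    · exact unitsEntailed_of_not_applicable hlt hT.ground (hc rfl) (hp rfl h0)
    · exact hT.unitsEntailed (hk ▸ h0)
  | skip Γ K H N U β k D σ _ _ =>
    exact ⟨hβ, TrailInv.of_append (Δ := [H]) (by rwa [List.append_assoc]),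
      (lastLevel_snoc _ _).symm⟩
  | backtrack Γ Γ' K N U β k i i' D H σ _ _ _ _ hi1 hi0 =>
    refine ⟨hβ, hT.of_append, ?_⟩
    rcases (hT Γ K Γ' rfl).level with hK | hK
    · simp only [hi0 (by omega), hK, Nat.sub_zero]
    · simp only [hi1 hK, hK, Nat.add_sub_cancel]
  | grow _ _ _ _ _ _ hβ' _ => exact ⟨hβ', trailInv_nil, rfl⟩
  | _ => exact ⟨hβ, hT, hk⟩

lemma ResultsFromRegularRun.stateInv [Infinite V] (hlt : IsDesired lt) {S : State L V}
    (h : ResultsFromRegularRun lt S) : StateInv lt S := by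
  obtain ⟨n, st, rl, hrun, rfl⟩ := h
  suffices ∀ i ≤ n, StateInv lt (st i) from this n le_rfl
  intro i
  induction i with
  | zero =>
    intro _
    obtain ⟨N, β, hβ, h0⟩ := hrun.init
    rw [h0]
    exact ⟨hβ, trailInv_nil, rfl⟩
  | succ i ih =>
    intro hi
    refine (hrun.step i hi).stateInv hlt (ih (Nat.le_of_succ_le hi)) (fun hd => ?_)
      fun hd h0 => hrun.propagateFirst i hi h0 hd
    exact (hrun.precedence i hi (by rw [hd]; exact Rule.noConfusion)
      (by rw [hd]; exact Rule.noConfusion)).1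

end

/-! ## Defining literals and levels -/

section

variable {lt : L.Term V → L.Term V → Prop} {N : Set (Clause L V)} {β : L.Term V}
  {Γ : Trail L V} {K H : Lit L V} {b : Bool} {s t u u' x : L.Term V} {p : List ℕ}

/-- The literal `K` becomes defined when the `i`-th literal is appended to the prefix of `Γ` before
it. This describes the defining literal without reference to cores. -/
def DefinedAt (Γ : Trail L V) (K : Lit L V) (i : ℕ) : Prop :=
  ¬ Defined (Trail.lits (Γ.take i)) K ∧ Defined (Trail.lits (Γ.take (i + 1))) K

lemma lits_take_mono (Γ : Trail L V) {i j : ℕ} (h : i ≤ j) :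
    Trail.lits (Γ.take i) ⊆ Trail.lits (Γ.take j) := by
  rintro _ ⟨a, ha, rfl⟩
  exact ⟨a, List.take_subset_take_left Γ h ha, rfl⟩

lemma lits_take_subset (Γ : Trail L V) (i : ℕ) : Trail.lits (Γ.take i) ⊆ Trail.lits Γ := by
  rintro _ ⟨a, ha, rfl⟩
  exact ⟨a, List.take_subset i Γ ha, rfl⟩

lemma lits_take_eq_subLits (Γ : Trail L V) (n : ℕ) :
    Trail.lits (Γ.take n) = subLits Γ {j | j.val < n} := by
  ext K
  constructor
  · rintro ⟨a, ha, rfl⟩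
    obtain ⟨j, hj, rfl⟩ := List.mem_take_iff_getElem.1 ha
    rw [lt_min_iff] at hj
    exact ⟨⟨j, hj.2⟩, Finset.mem_filter.2 ⟨Finset.mem_univ _, hj.1⟩, rfl⟩
  · rintro ⟨j, hj, rfl⟩
    exact ⟨Γ.get j, List.mem_take_iff_getElem.2
      ⟨j, lt_min (Finset.mem_filter.1 hj).2 j.isLt, rfl⟩, rfl⟩

lemma subLits_subset_lits_take {Δ : Finset (Fin Γ.length)} {n : ℕ} (h : ∀ j ∈ Δ, j.val < n) :
    subLits Γ Δ ⊆ Trail.lits (Γ.take n) := by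
  rw [lits_take_eq_subLits]
  exact fun _ ⟨j, hj, hK⟩ => ⟨j, Finset.mem_filter.2 ⟨Finset.mem_univ _, h j hj⟩, hK⟩

lemma exists_definedAt (h : Defined (Trail.lits Γ) K) (h0 : ¬ Defined ∅ K) :
    ∃ i : Fin Γ.length, DefinedAt Γ K i := by
  classical
  have hlen : Defined (Trail.lits (Γ.take Γ.length)) K := by rwa [List.take_length]
  have hex : ∃ n, Defined (Trail.lits (Γ.take n)) K := ⟨_, hlen⟩
  have hpos : Nat.find hex ≠ 0 := by
    rw [ne_eq, Nat.find_eq_zero, List.take_zero, lits_nil]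
    exact h0
  obtain ⟨i, hi⟩ := Nat.exists_eq_succ_of_ne_zero hpos
  have hle := Nat.find_min' hex hlen
  refine ⟨⟨i, by omega⟩, Nat.find_min hex (hi ▸ Nat.lt_succ_self i), ?_⟩
  have hspec := Nat.find_spec hex
  rwa [hi] at hspec

lemma DefinedAt.unique {i j : ℕ} (hi : DefinedAt Γ K i) (hj : DefinedAt Γ K j) : i = j := by
  by_contra h
  rcases Nat.lt_or_gt_of_ne h with h | h
  · exact hj.1 (hi.2.mono (lits_take_mono Γ h))
  · exact hi.1 (hj.2.mono (lits_take_mono Γ h))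

lemma definedAt_comp {i : ℕ} : DefinedAt Γ K.comp i ↔ DefinedAt Γ K i := by
  simp only [DefinedAt, defined_comp]

lemma definedAt_congr {i : ℕ} (h : Entails (Trail.lits (Γ.take i)) ⟨true, s(u, u')⟩) :
    DefinedAt Γ ⟨b, s(u, t)⟩ i ↔ DefinedAt Γ ⟨b, s(u', t)⟩ i :=
  and_congr (not_congr (defined_congr h (Entails.refl _ _) b))
    (defined_congr (h.mono (lits_take_mono Γ (Nat.le_succ i))) (Entails.refl _ _) b)

lemma DefinedAt.isDefining {i : Fin Γ.length} (h : DefinedAt Γ K i) : IsDefining Γ K i := by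
  have not_core_before {Δ : Finset (Fin Γ.length)} (hΔ : Defined (subLits Γ Δ) K) :
      ¬ ∀ j ∈ Δ, j < i := fun hlt => h.1 (hΔ.mono (subLits_subset_lits_take hlt))
  constructor
  · obtain ⟨Δ, hΔ, hmin⟩ := exists_minimal_le_of_wellFoundedLT
      (fun Δ => Defined (subLits Γ Δ) K) _ (lits_take_eq_subLits Γ (i + 1) ▸ h.2)
    have hle : ∀ j ∈ Δ, j ≤ i := fun j hj =>
      Nat.lt_succ_iff.1 (Finset.mem_filter.1 (hΔ hj)).2
    refine ⟨Δ, hmin, by_contra fun hi => not_core_before hmin.1 fun j hj => ?_, hle⟩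
    exact lt_of_le_of_ne (hle j hj) fun hji => hi (hji ▸ hj)
  · intro Λ hΛ
    have hne : Λ.Nonempty := by
      rw [Finset.nonempty_iff_ne_empty]
      rintro rfl
      exact not_core_before hΛ.1 fun j hj => absurd hj (Finset.notMem_empty j)
    refine ⟨Λ.max' hne, Λ.isGreatest_max' hne, not_lt.1 fun hlt => not_core_before hΛ.1 ?_⟩
    exact fun j hj => (Λ.le_max' j hj).trans_lt hlt

lemma TrailInv.appendable_get (hT : TrailInv lt N β Γ) (i : Fin Γ.length) :
    Appendable lt N β (Γ.take i) (Γ.get i) :=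
  hT (Γ.take i) (Γ.get i) (Γ.drop (i + 1)) (by
    rw [List.get_eq_getElem, List.getElem_cons_drop, List.take_append_drop])

lemma TrailInv.take (hT : TrailInv lt N β Γ) (i : ℕ) : TrailInv lt N β (Γ.take i) :=
  TrailInv.of_append (Δ := Γ.drop i) (by rwa [List.take_append_drop])

lemma TrailInv.definedAt_get (hT : TrailInv lt N β Γ) (i : Fin Γ.length) :
    DefinedAt Γ (Γ.get i).glit i :=
  ⟨(hT.appendable_get i).undefined, Defined.of_mem ⟨Γ.get i, List.mem_take_iff_getElem.2
    ⟨i, lt_min (Nat.lt_succ_self i) i.isLt, rfl⟩, rfl⟩⟩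

lemma TrailInv.eq_get_of_definedAt (hT : TrailInv lt N β Γ) {i : Fin Γ.length}
    (hi : DefinedAt Γ K i) (hK : K ∈ Trail.lits Γ) : K = (Γ.get i).glit := by
  obtain ⟨a, ha, rfl⟩ := hK
  obtain ⟨j, rfl⟩ := List.get_of_mem ha
  rw [Fin.ext (hi.unique (hT.definedAt_get j))]

lemma TrailInv.hasLevel (hT : TrailInv lt N β Γ) {i : Fin Γ.length} (hi : DefinedAt Γ K i) :
    HasLevel Γ K (Γ.get i).level := by
  by_cases hK : K ∈ Trail.lits Γ
  · exact Or.inl ⟨_, Γ.get_mem i, (hT.eq_get_of_definedAt hi hK).symm, rfl⟩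
  · exact Or.inr ⟨hK, hi.2.mono (lits_take_subset Γ _), Or.inl ⟨i, hi.isDefining, rfl⟩⟩

lemma TrailInv.hasLevel_zero (hT : TrailInv lt N β Γ) (h : Defined ∅ K) : HasLevel Γ K 0 := by
  have hempty : IsCore Γ K ∅ := ⟨h.mono (Set.empty_subset _), fun _ _ _ => Finset.empty_subset _⟩
  refine Or.inr ⟨?_, h.mono (Set.empty_subset _), Or.inr ⟨?_, rfl⟩⟩
  · rintro ⟨a, ha, rfl⟩
    obtain ⟨j, rfl⟩ := List.get_of_mem ha
    exact (hT.definedAt_get j).1 (h.mono (Set.empty_subset _))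
  · rintro ⟨i, -, hi⟩
    obtain ⟨j, hj, -⟩ := hi ∅ hempty
    exact Finset.notMem_empty j hj.1

lemma TrailInv.hasLevel_zero_or_definedAt (hT : TrailInv lt N β Γ)
    (h : Defined (Trail.lits Γ) K) :
    HasLevel Γ K 0 ∨ ∃ i : Fin Γ.length, DefinedAt Γ K i ∧ 0 < (Γ.get i).level := by
  by_cases h0 : Defined ∅ K
  · exact Or.inl (hT.hasLevel_zero h0)
  · obtain ⟨i, hi⟩ := exists_definedAt h h0
    rcases Nat.eq_zero_or_pos (Γ.get i).level with hz | hz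
    · exact Or.inl (hz ▸ hT.hasLevel hi)
    · exact Or.inr ⟨i, hi, hz⟩

/-! ## Rewriting with unit clauses -/

lemma IsDesired.bUndef_or_bDef (hlt : IsDesired lt) (hβ : vars β = ∅) (hK : K.Ground) :
    BUndef lt Γ β K ∨ BDef lt Γ β K := by
  rcases hlt.litLtTerm_or_termLtLit hK hβ with h | h
  · by_cases hd : Defined (Trail.lits Γ) K
    · exact Or.inr ⟨h, hd⟩
    · exact Or.inl (Or.inr hd)
  · exact Or.inl (Or.inl h)

lemma TrailInv.isM (hT : TrailInv lt N β Γ) {i : Fin Γ.length} (hK : BDef lt Γ β K)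
    (hi : DefinedAt Γ K i) (hne : K ≠ (Γ.get i).glit) (hne' : K.comp ≠ (Γ.get i).glit) :
    IsM lt Γ β i K :=
  ⟨hK, fun h => hne (hT.eq_get_of_definedAt hi h),
    fun h => hne' (hT.eq_get_of_definedAt (definedAt_comp.2 hi) h), hi.isDefining⟩

lemma TrailInv.trailRel_of_definedAt (hT : TrailInv lt N β Γ) {i : Fin Γ.length}
    (hpos : 0 < (Γ.get i).level) (hK : BDef lt Γ β K) (hH : BDef lt Γ β H)
    (hKi : DefinedAt Γ K i) (hHi : DefinedAt Γ H i) (hne : H ≠ (Γ.get i).glit)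
    (hne' : H.comp ≠ (Γ.get i).glit) (hKH : LitLt lt K H) : TrailRel lt Γ β K H := by
  have hKp : Pos lt Γ β K := ⟨hK, _, hpos, hT.hasLevel hKi⟩
  have hHp : Pos lt Γ β H := ⟨hH, _, hpos, hT.hasLevel hHi⟩
  have hHM := hT.isM hH hHi hne hne'
  by_cases hKl : K = (Γ.get i).glit ∨ K.comp = (Γ.get i).glit
  · exact .lm K H i i hKp hHp hKl hHM le_rfl
  · obtain ⟨hl, hl'⟩ := not_or.1 hKl
    exact .mm K H i i hKp hHp (hT.isM hK hKi hl hl') hHM (Or.inr ⟨rfl, hKH⟩)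

lemma TrailInv.trailRel_of_litLt (hT : TrailInv lt N β Γ) (hK : BDef lt Γ β K)
    (hH : BDef lt Γ β H)
    (hiff : ∀ i : Fin Γ.length, 0 < (Γ.get i).level → (DefinedAt Γ K i ↔ DefinedAt Γ H i))
    (hne : ∀ i : Fin Γ.length, 0 < (Γ.get i).level → H ≠ (Γ.get i).glit ∧ H.comp ≠ (Γ.get i).glit)
    (hKH : LitLt lt K H) : TrailRel lt Γ β K H := by
  by_cases hpos : ∃ i : Fin Γ.length, DefinedAt Γ H i ∧ 0 < (Γ.get i).level
  · obtain ⟨i, hHi, hi⟩ := hpos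
    exact hT.trailRel_of_definedAt hi hK hH ((hiff i hi).2 hHi) hHi (hne i hi).1 (hne i hi).2 hKH
  · have hH0 := (hT.hasLevel_zero_or_definedAt hH.2).resolve_right hpos
    have hK0 := (hT.hasLevel_zero_or_definedAt hK.2).resolve_right fun ⟨i, hKi, hi⟩ =>
      hpos ⟨i, (hiff i hi).1 hKi, hi⟩
    exact .zz K H ⟨hK, hK0⟩ ⟨hH, hH0⟩ hKH

lemma TrailInv.notMem_eqn_get [Nonempty V] (hT : TrailInv lt N β Γ) {i : Fin Γ.length}
    (hs : vars s = ∅) (ht : vars t = ∅) (hts : lt t s) (hp : subtermAt u p = some s)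
    (hst : Entails (Trail.lits (Γ.take i)) ⟨true, s(s, t)⟩) : u ∉ (Γ.get i).glit.eqn := by
  have hrule : (s, t) ∈ conv lt (Trail.lits (Γ.take i)) :=
    ⟨hs, ht, hts, entails_positive (hT.take i).exists_not_entails hst⟩
  exact fun hu => (hT.appendable_get i).irreducible u hu _ (rewrites_replaceAt hrule hp)

lemma TrailInv.trailRel_replaceAt [Nonempty V] (hlt : IsDesired lt) (hT : TrailInv lt N β Γ)
    (hs : vars s = ∅) (ht : vars t = ∅) (hts : lt t s) (hp : subtermAt u p = some s)
    (hΓ : Entails (Trail.lits Γ) ⟨true, s(s, t)⟩)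
    (htake : ∀ i : Fin Γ.length, 0 < (Γ.get i).level →
      Entails (Trail.lits (Γ.take i)) ⟨true, s(s, t)⟩)
    (hu : BDef lt Γ β ⟨b, s(u, x)⟩) :
    TrailRel lt Γ β ⟨b, s(replaceAt u p t, x)⟩ ⟨b, s(u, x)⟩ := by
  have hlt' : lt (replaceAt u p t) u := by
    have h := hlt.context _ _ u p (hp ▸ Option.some_ne_none _) hts
    rwa [replaceAt_self hp] at h
  have hd : BDef lt Γ β ⟨b, s(replaceAt u p t, x)⟩ := by
    obtain ⟨huβ, hxβ⟩ := litLtTerm_mk.1 hu.1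
    exact ⟨litLtTerm_mk.2 ⟨hlt.trans _ _ _ hlt' huβ, hxβ⟩,
      (defined_congr (Entails.replaceAt hp hΓ.symm) (Entails.refl _ _) b).2 hu.2⟩
  refine hT.trailRel_of_litLt hd hu
    (fun i hi => definedAt_congr (Entails.replaceAt hp (htake i hi).symm)) (fun i hi => ?_)
    (litLt_of_lt hlt' b x)
  have hne := hT.notMem_eqn_get hs ht hts hp (htake i hi)
  exact ⟨fun h => hne (h ▸ Sym2.mem_mk_left u x), fun h => hne (h ▸ Sym2.mem_mk_left u x)⟩

lemma TrailInv.trailLt_of_unit_rewrite [Nonempty V] (hlt : IsDesired lt) (hβ : vars β = ∅)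
    (hT : TrailInv lt N β Γ) (hk : 0 < Trail.lastLevel Γ) {l r : L.Term V}
    (hunit : ({⟨true, s(l, r)⟩} : Clause L V) ∈ N) {σ : Subst L V}
    (hσ : Lit.Ground (Lit.subst ⟨true, s(l, r)⟩ σ)) (hrl : lt (r.subst σ) (l.subst σ))
    (hp : subtermAt u p = some (l.subst σ)) (hu : Lit.Ground ⟨b, s(u, x)⟩) :
    TrailLt lt Γ β ⟨b, s(replaceAt u p (r.subst σ), x)⟩ ⟨b, s(u, x)⟩ := by
  obtain ⟨hlσ, hrσ⟩ := Lit.ground_mk.1 hσ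
  obtain ⟨hug, hxg⟩ := Lit.ground_mk.1 hu
  have hu' : Lit.Ground ⟨b, s(replaceAt u p (r.subst σ), x)⟩ :=
    Lit.ground_mk.2 ⟨vars_replaceAt_eq_empty hug hrσ p, hxg⟩
  refine ⟨hu', hu, ?_⟩
  rcases hlt.bUndef_or_bDef hβ hu with hund | hdef
  · rcases hlt.bUndef_or_bDef hβ hu' with hund' | hdef'
    · have hlt' := hlt.context _ _ u p (hp ▸ Option.some_ne_none _) hrl
      rw [replaceAt_self hp] at hlt'
      exact .uu _ _ hund' hund (litLt_of_lt hlt' b x)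
    · exact .du _ _ hdef' hund
  · have hlβ : lt (l.subst σ) β := by
      have huβ := (litLtTerm_mk.1 hdef.1).1
      rcases hlt.subterm_eq_or_lt hp hug with h | h
      · exact h ▸ huβ
      · exact hlt.trans _ _ _ h huβ
    have hent : ∀ {G : Set (Lit L V)}, UnitsEntailed lt N β G →
        Entails G ⟨true, s(l.subst σ, r.subst σ)⟩ := fun h =>
      h l r hunit σ hσ (litLtTerm_mk.2 ⟨hlβ, hlt.trans _ _ _ hrl hlβ⟩)
    exact hT.trailRel_replaceAt hlt hlσ hrσ hrl hp (hent (hT.unitsEntailed hk))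
      (fun i hi => hent ((hT.appendable_get i).units hi)) hdef

lemma subst_matcher_subst {l r : L.Term V} {μ σ σ' : Subst L V} {A : Set V}
    (hl : l.subst σ = (l.subst μ).subst σ') (hr : vars (r.subst σ) = ∅)
    (hA : vars (l.subst μ) ⊆ A) (hdisj : Disjoint (vars l ∪ vars r) A) (hμ : μ.dom ⊆ vars l)
    (hσ : σ.dom ⊆ vars l ∪ vars r) :
    (((r.subst μ).subst σ).subst σ').subst σ' = r.subst σ := by
  simp only [subst_subst]
  refine subst_congr fun x hx => ?_
  have hx' : vars (σ x) = ∅ := vars_subst_eq_empty.1 hr x hx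
  suffices ((μ x).subst σ).subst σ' = σ x by
    simp only [Subst.comp, this, subst_of_ground hx']
  by_cases hxl : x ∈ vars l
  · have hμx : vars (μ x) ⊆ A := fun y hy => hA (mem_vars_subst.2 ⟨x, hxl, hy⟩)
    rw [subst_eq_self_of_disjoint hσ (hdisj.symm.mono_left hμx)]
    rw [subst_subst] at hl
    exact (eqOn_vars_of_subst_eq hl hxl).symm
  · rw [show μ x = Term.var x from not_not.1 fun h => hxl (hμ h)]
    exact subst_of_ground hx' σ'

end

end SCLEQ

theorem mainTheorem9_general {L : FirstOrder.Language} {V : Type*} [Infinite V]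
    (lt : L.Term V → L.Term V → Prop) (hlt : SCLEQ.IsDesired lt)
    (S : SCLEQ.State L V) (hS : SCLEQ.ResultsFromRegularRun lt S) (hk : 0 < S.k)
    (l r : L.Term V) (hunit : ({⟨true, s(l, r)⟩} : SCLEQ.Clause L V) ∈ S.N)
    (C : SCLEQ.Clause L V) (b : Bool) (u t l' : L.Term V) (p : List ℕ)
    (hp : SCLEQ.subtermAt u p = some l')
    (μ : SCLEQ.Subst L V) (hμ : l' = l.subst μ)
    (σ σ' : SCLEQ.Subst L V)
    (hσ' : SCLEQ.Clause.Ground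
      (SCLEQ.Clause.subst ((⟨b, s(u, t)⟩ : SCLEQ.Lit L V) ::ₘ C) σ'))
    (hσ : SCLEQ.Lit.Ground (SCLEQ.Lit.subst ⟨true, s(l, r)⟩ σ))
    (hl : l.subst σ = l'.subst σ') (hr : lt (r.subst σ) (l.subst σ)) :
    SCLEQ.TrailClauseLt lt S.trail S.β
      ((⟨b, s(SCLEQ.replaceAt (u.subst σ') p (r.subst σ), t.subst σ')⟩ : SCLEQ.Lit L V) ::ₘ
        SCLEQ.Clause.subst C σ')
      (SCLEQ.Clause.subst ((⟨b, s(u, t)⟩ : SCLEQ.Lit L V) ::ₘ C) σ') ∧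
    (Disjoint (SCLEQ.vars l ∪ SCLEQ.vars r)
        (SCLEQ.Clause.vars ((⟨b, s(u, t)⟩ : SCLEQ.Lit L V) ::ₘ C)) →
      μ.dom ⊆ SCLEQ.vars l → σ.dom ⊆ SCLEQ.vars l ∪ SCLEQ.vars r →
      SCLEQ.TrailClauseLt lt S.trail S.β
        (SCLEQ.Clause.subst
          ((⟨b, s(SCLEQ.replaceAt u p (((r.subst μ).subst σ).subst σ'), t)⟩ :
            SCLEQ.Lit L V) ::ₘ C) σ')
        (SCLEQ.Clause.subst ((⟨b, s(u, t)⟩ : SCLEQ.Lit L V) ::ₘ C) σ')) := by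
  have hinv := hS.stateInv hlt
  have hup : SCLEQ.subtermAt (u.subst σ') p = some (l.subst σ) := by
    rw [SCLEQ.subtermAt_subst hp, hl]
  have hrewrite : SCLEQ.TrailLt lt S.trail S.β
      ⟨b, s(SCLEQ.replaceAt (u.subst σ') p (r.subst σ), t.subst σ')⟩
      ⟨b, s(u.subst σ', t.subst σ')⟩ :=
    hinv.trail.trailLt_of_unit_rewrite hlt hinv.ground (hinv.level ▸ hk) hunit hσ hr hup
      (hσ' _ (Multiset.mem_map_of_mem _ (Multiset.mem_cons_self _ _)))
  simp only [SCLEQ.Clause.subst, Multiset.map_cons, SCLEQ.Lit.subst_mk]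
  refine ⟨SCLEQ.mulExt_cons_of_rel hrewrite _, fun hdisj hμσ hσdom => ?_⟩
  have hvars : SCLEQ.vars (l.subst μ) ⊆ SCLEQ.Clause.vars (⟨b, s(u, t)⟩ ::ₘ C) := fun x hx =>
    ⟨_, Multiset.mem_cons_self _ _, SCLEQ.Lit.mem_vars_mk.2
      (Or.inl (SCLEQ.vars_subset_of_subtermAt hp (hμ ▸ hx)))⟩
  rw [SCLEQ.replaceAt_subst (hp ▸ Option.some_ne_none _), SCLEQ.subst_matcher_subst (hμ ▸ hl)
    (SCLEQ.Lit.ground_mk.1 hσ).2 hvars hdisj hμσ hσdom]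
  exact SCLEQ.mulExt_cons_of_rel hrewrite _

theorem mainTheorem9 {L : FirstOrder.Language} {V : Type*} [Infinite V]
    (lt : L.Term V → L.Term V → Prop) (hlt : SCLEQ.IsDesired lt)
    (S : SCLEQ.State L V) (hS : SCLEQ.ResultsFromRegularRun lt S) (hk : 0 < S.k)
    -- the unit clause `l ≈ r`
    (l r : L.Term V) (hunit : ({⟨true, s(l, r)⟩} : SCLEQ.Clause L V) ∈ S.N)
    -- the clause `C ∨ L[l']_p` with `L = (u # t)` and `p` a position in the side `u`
    (C : SCLEQ.Clause L V) (b : Bool) (u t l' : L.Term V) (p : List ℕ)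
    (hC : ((⟨b, s(u, t)⟩ : SCLEQ.Lit L V) ::ₘ C) ∈ S.N)
    (hp : SCLEQ.subtermAt u p = some l')
    (μ : SCLEQ.Subst L V) (hμ : l' = l.subst μ)
    (σ σ' : SCLEQ.Subst L V)
    (hσ' : SCLEQ.Clause.Ground
      (SCLEQ.Clause.subst ((⟨b, s(u, t)⟩ : SCLEQ.Lit L V) ::ₘ C) σ'))
    (hσ : SCLEQ.Lit.Ground (SCLEQ.Lit.subst ⟨true, s(l, r)⟩ σ))
    (hl : l.subst σ = l'.subst σ') (hr : lt (r.subst σ) (l.subst σ)) :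
    SCLEQ.TrailClauseLt lt S.trail S.β
      ((⟨b, s(SCLEQ.replaceAt (u.subst σ') p (r.subst σ), t.subst σ')⟩ : SCLEQ.Lit L V) ::ₘ
        SCLEQ.Clause.subst C σ')
      (SCLEQ.Clause.subst ((⟨b, s(u, t)⟩ : SCLEQ.Lit L V) ::ₘ C) σ') ∧
    -- the form with `r μ σ σ'`, under the usual variable conventions
    (Disjoint (SCLEQ.vars l ∪ SCLEQ.vars r)
        (SCLEQ.Clause.vars ((⟨b, s(u, t)⟩ : SCLEQ.Lit L V) ::ₘ C)) →
      μ.dom ⊆ SCLEQ.vars l → σ.dom ⊆ SCLEQ.vars l ∪ SCLEQ.vars r →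
      SCLEQ.TrailClauseLt lt S.trail S.β
        (SCLEQ.Clause.subst
          ((⟨b, s(SCLEQ.replaceAt u p (((r.subst μ).subst σ).subst σ'), t)⟩ :
            SCLEQ.Lit L V) ::ₘ C) σ')
        (SCLEQ.Clause.subst ((⟨b, s(u, t)⟩ : SCLEQ.Lit L V) ::ₘ C) σ')) :=
  mainTheorem9_general lt hlt S hS hk l r hunit C b u t l' p hp μ hμ σ σ' hσ' hσ hl hr
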